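/- **Notation.** Let $N\in\mathbb N$, and let $\varphi\in\mathcal S(\mathbb R^N)$ be radial, supported in $\{\tfrac34\le|\xi|\le\tfrac83\}$, with $\sum_{q\in\mathbb Z}\varphi(2^{-q}\xi)=1$ for all $\xi\ne0$. Let $\mathcal Z'$ be the dual of $\mathcal Z=\{\psi\in\mathcal S(\mathbb R^N): D^\alpha\hat\psi(0)=0\ \forall\alpha\}$ (tempered distributions modulo polynomials), and put $\dot\Delta_j f=\varphi(2^{-j}D)f$ for $f\in\mathcal Z'$. For $s\in\mathbb R$, $p,\rho\in[1,\infty]$, $T\in(0,\infty]$, $k_0\in\mathbb Z$ let $$\|f\|_{\dot B^s_{p,1}}=\sum_{j\in\mathbb Z}2^{js}\|\dot\Delta_jf\|_{L^p},\qquad \|f\|_{\tilde L^\rho_T(\dot B^s_{p,1})}=\sum_{j\in\mathbb Z}2^{js}\|\dot\Delta_jf\|_{L^\rho(0,T;L^p)},$$ and let $\|\cdot\|^h$ denote the same sums restricted to $j\ge k_0$ (norms of pairs are sums of norms). $\dot B^s_{p,1}$ is the set of $f\in\mathcal Z'$ with finite norm; $\tilde L^\rho_T(\dot B^s_{p,1})$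 consists of the (weakly) measurable $f:(0,T)\to\mathcal Z'$ with finite norm; and $\tilde C_T(\dot B^s_{p,1})=\tilde L^\infty_T(\dot B^s_{p,1})\cap C([0,T];\dot B^s_{p,1})$ (with $[0,\infty)$ in place of $[0,T]$ if $T=\infty$). **Lemma 3.4.** Let $\nu>0$ and $1\le\rho_2\le\rho_1\le\infty$. There is a constant $C>0$, depending only on $\nu,\rho_1,\rho_2$ (and on $N,\varphi$), such that the following holds for all $s\in\mathbb R$, $p\in[1,\infty]$ and $T\in(0,\infty]$. Let $(a_0,v_0)\in(\dot B^s_{p,1})^2$ and $(F,G)\in\big(\tilde L^{\rho}_T(\dot B^{s-2+2/\rho}_{p,1})\big)^2$, where $\rho=\rho_1$ or $\rho=\rho_2$. Then the system $$\partial_t a+\Delta v=F,\qquad \partial_t v-\nu\Delta v-\Delta a=G,\qquad (a,v)|_{t=0}=(a_0,v_0)$$ (understood in $\mathcal Z'$, integrated in time and tested against every $\psi\in\mathcal Z$) has a unique solution $(a,v)$ in $\big(\tilde C_T(\dot B^s_{p,1})\cap\tilde L^{\rho_1}_T(\dot B^{s+2/\rho_1}_{p,1})\big)^2$. Moreover,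 for every $k_0\in\mathbb Z$, $$\|(a,v)\|^h_{\tilde L^{\rho_1}_T(\dot B^{s+2/\rho_1}_{p,1})}\le C\Big(\|(a_0,v_0)\|^h_{\dot B^s_{p,1}}+\|(F,G)\|^h_{\tilde L^{\rho_2}_T(\dot B^{s-2+2/\rho_2}_{p,1})}\Big)$$ (the right-hand side may be $+\infty$ if $\rho=\rho_1\neq\rho_2$). -/

import Mathlib

open MeasureTheory Set Filter Topology
open scoped ENNReal NNReal SchwartzMap FourierTransform Laplacian

noncomputable section

namespace CoupledSystem

/-- The space `ℝ^N` with its Euclidean norm. -/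
abbrev Space (N : ℕ) : Type := EuclideanSpace ℝ (Fin N)

/-- Multiplying the Fourier transform of `ψ` by a smooth symbol `g` of temperate growth does not
destroy the vanishing of all its derivatives at `0`. -/
theorem flat_mul {N : ℕ} {g u : Space N → ℂ} (hg : ContDiff ℝ (⊤ : ℕ∞) g)
    (hu : ContDiff ℝ (⊤ : ℕ∞) u) (h : ∀ n : ℕ, iteratedFDeriv ℝ n u 0 = 0) (n : ℕ) :
    iteratedFDeriv ℝ n (fun ξ => g ξ * u ξ) 0 = 0 := by
  have := norm_iteratedFDeriv_mul_le (n := n) (N := ((⊤ : ℕ∞) : WithTop ℕ∞)) hg hu (0 : Space N)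
    (by exact_mod_cast le_top)
  simpa [h] using this

/-- The space `𝒵(ℝ^N)` of Schwartz functions all of whose Fourier derivatives
`D^α ψ̂ (0)` vanish. It carries the topology induced by the Schwartz space. -/
def 𝒵 (N : ℕ) : Submodule ℂ 𝓢(Space N, ℂ) where
  carrier := {ψ | ∀ n : ℕ, iteratedFDeriv ℝ n (𝓕 ψ : 𝓢(Space N, ℂ)) 0 = 0}
  zero_mem' := fun n => by
    have : ((0 : 𝓢(Space N, ℂ)) : Space N → ℂ) = 0 := rfl
    rw [FourierTransform.fourier_zero, this, iteratedFDeriv_zero]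
    rfl
  add_mem' := by
    intro a b ha hb n
    have h := iteratedFDeriv_add (𝕜 := ℝ) (i := n) ((𝓕 a : 𝓢(Space N, ℂ)).smooth n)
      ((𝓕 b : 𝓢(Space N, ℂ)).smooth n)
    have e : ((𝓕 (a + b) : 𝓢(Space N, ℂ)) : Space N → ℂ)
        = (𝓕 a : 𝓢(Space N, ℂ)) + (𝓕 b : 𝓢(Space N, ℂ)) := by
      rw [FourierTransform.fourier_add]; rfl
    rw [e, h, Pi.add_apply, ha n, hb n, add_zero]
  smul_mem' := by
    intro c a ha n
    have e : ((𝓕 (c • a) : 𝓢(Space N, ℂ)) : Space N → ℂ)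
        = fun ξ => c * (𝓕 a : 𝓢(Space N, ℂ)) ξ := by
      rw [FourierTransform.fourier_smul]; rfl
    rw [e]
    exact flat_mul contDiff_const ((𝓕 a : 𝓢(Space N, ℂ)).smooth (⊤ : ℕ∞)) ha n

/-- The space `𝒵'(ℝ^N)` of continuous linear functionals on `𝒵(ℝ^N)`, that is, of tempered
distributions modulo polynomials. -/
abbrev 𝒵' (N : ℕ) : Type := 𝒵 N →L[ℂ] ℂ

/-- Fourier side of a Fourier multiplier. -/
theorem fourier_multiplier {N : ℕ} {g : Space N → ℂ} (hg : g.HasTemperateGrowth)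
    (ψ : 𝓢(Space N, ℂ)) :
    ((𝓕 (SchwartzMap.fourierMultiplierCLM ℂ g ψ) : 𝓢(Space N, ℂ)) : Space N → ℂ)
      = fun ξ => g ξ * (𝓕 ψ : 𝓢(Space N, ℂ)) ξ := by
  rw [SchwartzMap.fourierMultiplierCLM_apply, FourierTransform.fourier_fourierInv_eq]
  ext ξ
  rw [SchwartzMap.smulLeftCLM_apply_apply hg, smul_eq_mul]

theorem laplacian_mem {N : ℕ} (ψ : 𝓢(Space N, ℂ)) (hψ : ψ ∈ 𝒵 N) :
    LineDeriv.laplacianCLM ℂ (Space N) 𝓢(Space N, ℂ) ψ ∈ 𝒵 N := by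
  rw [SchwartzMap.laplacianCLM_eq, SchwartzMap.laplacian_eq_fourierMultiplierCLM,
    ← SchwartzMap.fourierMultiplierCLM_ofReal ℂ (by fun_prop)]
  have hg : (fun x : Space N => (RCLike.ofReal (K := ℂ) ((‖·‖ ^ 2 : Space N → ℝ) x))).HasTemperateGrowth := by
    have : (‖·‖ ^ 2 : Space N → ℝ).HasTemperateGrowth := by fun_prop
    exact (Function.RCLike.hasTemperateGrowth_ofReal (𝕜 := ℂ)).comp this
  have : SchwartzMap.fourierMultiplierCLM ℂ
      (fun x : Space N => (RCLike.ofReal (K := ℂ) ((‖·‖ ^ 2 : Space N → ℝ) x))) ψ ∈ 𝒵 N := by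
    intro n
    rw [fourier_multiplier hg]
    exact flat_mul hg.1 ((𝓕 ψ : 𝓢(Space N, ℂ)).smooth (⊤ : ℕ∞)) hψ n
  have h2 := (𝒵 N).smul_mem ((-(2 * Real.pi) ^ 2 : ℝ) : ℂ) this
  rwa [Complex.coe_smul] at h2

/-- The Laplacian `ψ ↦ Δψ` on test functions in `𝒵(ℝ^N)`. -/
def lapTest (N : ℕ) : 𝒵 N →L[ℂ] 𝒵 N :=
  ((LineDeriv.laplacianCLM ℂ (Space N) 𝓢(Space N, ℂ)).comp (𝒵 N).subtypeL).codRestrict (𝒵 N)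
    (fun ψ => laplacian_mem ψ.1 ψ.2)

/-- The Laplacian of `f ∈ 𝒵'(ℝ^N)`: `⟨Δf, ψ⟩ = ⟨f, Δψ⟩`. -/
def lap {N : ℕ} (f : 𝒵' N) : 𝒵' N := f.comp (lapTest N)

/-- A Littlewood-Paley function: radial, supported in `{3/4 ≤ |ξ| ≤ 8/3}`, with
`∑_{q ∈ ℤ} φ(2^{-q} ξ) = 1` for `ξ ≠ 0`. -/
structure IsLittlewoodPaley {N : ℕ} (φ : 𝓢(Space N, ℂ)) : Prop where
  radial : ∀ ξ η : Space N, ‖ξ‖ = ‖η‖ → φ ξ = φ η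
  supp : ∀ ξ : Space N, φ ξ ≠ 0 → 3 / 4 ≤ ‖ξ‖ ∧ ‖ξ‖ ≤ 8 / 3
  sum_eq_one : ∀ ξ : Space N, ξ ≠ 0 → HasSum (fun q : ℤ => φ (((2 : ℝ) ^ (-q)) • ξ)) 1

/-- The symbol of `φ(2^{-q} D)`, `D = -i∇`. Mathlib's Fourier transform uses the kernel
`exp(-2πi x·ξ)`, so that `D` has the symbol `2πξ`. -/
def symbol {N : ℕ} (φ : 𝓢(Space N, ℂ)) (q : ℤ) (ξ : Space N) : ℂ :=
  φ (((2 : ℝ) ^ (-q)) • ((2 * Real.pi) • ξ))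

theorem symbol_growth {N : ℕ} (φ : 𝓢(Space N, ℂ)) (q : ℤ) :
    (symbol φ q).HasTemperateGrowth :=
  φ.hasTemperateGrowth.comp
    (((2 : ℝ) ^ (-q) • (2 * Real.pi) • ContinuousLinearMap.id ℝ (Space N)).hasTemperateGrowth)

theorem symbol_flat {N : ℕ} {φ : 𝓢(Space N, ℂ)} (hφ : IsLittlewoodPaley φ) (q : ℤ) (n : ℕ) :
    iteratedFDeriv ℝ n (symbol φ q) 0 = 0 := by
  have hc : Continuous fun ξ : Space N => ‖((2 : ℝ) ^ (-q)) • ((2 * Real.pi) • ξ)‖ := by fun_prop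
  have h : symbol φ q =ᶠ[𝓝 0] 0 := by
    have := hc.continuousAt.eventually_lt (x₀ := (0 : Space N)) (g := fun _ => (3 / 4 : ℝ))
      continuousAt_const (by simp)
    filter_upwards [this] with ξ hξ
    by_contra h0
    exact absurd (hφ.supp _ h0).1 (not_le.mpr hξ)
  have := (h.iteratedFDeriv ℝ n).eq_of_nhds
  rw [this, iteratedFDeriv_zero]
  rfl

theorem block_mem {N : ℕ} {φ : 𝓢(Space N, ℂ)} (hφ : IsLittlewoodPaley φ) (q : ℤ)
    (ψ : 𝓢(Space N, ℂ)) : SchwartzMap.fourierMultiplierCLM ℂ (symbol φ q) ψ ∈ 𝒵 N := by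
  intro n
  rw [fourier_multiplier (symbol_growth φ q)]
  have := flat_mul ((𝓕 ψ : 𝓢(Space N, ℂ)).smooth (⊤ : ℕ∞)) (symbol_growth φ q).1
    (symbol_flat hφ q) n
  simpa only [mul_comm] using this

/-- `ψ ↦ φ(2^{-q} D) ψ` as a map from `𝓢(ℝ^N)` to `𝒵(ℝ^N)`. -/
def blockTest {N : ℕ} {φ : 𝓢(Space N, ℂ)} (hφ : IsLittlewoodPaley φ) (q : ℤ) :
    𝓢(Space N, ℂ) →L[ℂ] 𝒵 N :=
  (SchwartzMap.fourierMultiplierCLM ℂ (symbol φ q)).codRestrict (𝒵 N) (block_mem hφ q)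

/-- The homogeneous frequency localization `Δ̇_q f = φ(2^{-q} D) f` of `f ∈ 𝒵'(ℝ^N)`, a tempered
distribution: `⟨Δ̇_q f, ψ⟩ = ⟨f, φ(2^{-q} D) ψ⟩` (`φ` is even, because it is radial). -/
def block {N : ℕ} {φ : 𝓢(Space N, ℂ)} (hφ : IsLittlewoodPaley φ) (q : ℤ) (f : 𝒵' N) :
    𝓢(Space N, ℂ) →L[ℂ] ℂ :=
  f.comp (blockTest hφ q)

/-- The `L^p` norm of a tempered distribution: the `L^p` norm of the function that represents it,
and `∞` if it is not represented by a function in `L^p`. -/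
def distLpNorm {N : ℕ} (p : ℝ≥0∞) (u : 𝓢(Space N, ℂ) →L[ℂ] ℂ) : ℝ≥0∞ :=
  ⨅ (g : Space N → ℂ) (_ : MemLp g p volume) (_ : ∀ ψ : 𝓢(Space N, ℂ), u ψ = ∫ x, ψ x * g x),
    eLpNorm g p volume

section Norms

variable {N : ℕ} {φ : 𝓢(Space N, ℂ)} (hφ : IsLittlewoodPaley φ)

/-- The norm of `Ḃ^s_{p,1}`. -/
def besovNorm (p : ℝ≥0∞) (s : ℝ) (f : 𝒵' N) : ℝ≥0∞ :=
  ∑' j : ℤ, (2 : ℝ≥0∞) ^ ((j : ℝ) * s) * distLpNorm p (block hφ j f)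

/-- The high-frequency norm `‖f‖^h` of `Ḃ^s_{p,1}`, with threshold `k₀`. -/
def besovNormHigh (k₀ : ℤ) (p : ℝ≥0∞) (s : ℝ) (f : 𝒵' N) : ℝ≥0∞ :=
  ∑' j : Set.Ici k₀, (2 : ℝ≥0∞) ^ ((j : ℝ) * s) * distLpNorm p (block hφ j f)

/-- The time interval `[0, T]`, which is `[0, ∞)` for `T = ∞`. -/
def timeInterval (T : ℝ≥0∞) : Set ℝ := {t | 0 ≤ t ∧ ENNReal.ofReal t ≤ T}

/-- The norm of `Δ̇_j f` in `L^ρ(0, T; L^p)`. -/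
def blockTimeNorm (T ρ p : ℝ≥0∞) (j : ℤ) (f : ℝ → 𝒵' N) : ℝ≥0∞ :=
  eLpNorm (fun t => distLpNorm p (block hφ j (f t))) ρ (volume.restrict (timeInterval T))

/-- The norm of the Chemin-Lerner space `L̃^ρ_T(Ḃ^s_{p,1})`. -/
def clNorm (T ρ p : ℝ≥0∞) (s : ℝ) (f : ℝ → 𝒵' N) : ℝ≥0∞ :=
  ∑' j : ℤ, (2 : ℝ≥0∞) ^ ((j : ℝ) * s) * blockTimeNorm hφ T ρ p j f

/-- The high-frequency norm `‖f‖^h` of `L̃^ρ_T(Ḃ^s_{p,1})`, with threshold `k₀`. -/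
def clNormHigh (k₀ : ℤ) (T ρ p : ℝ≥0∞) (s : ℝ) (f : ℝ → 𝒵' N) : ℝ≥0∞ :=
  ∑' j : Set.Ici k₀, (2 : ℝ≥0∞) ^ ((j : ℝ) * s) * blockTimeNorm hφ T ρ p j f

/-- Membership in `L̃^ρ_T(Ḃ^s_{p,1})`: (weak) measurability in time, and a finite norm. -/
structure MemCL (T ρ p : ℝ≥0∞) (s : ℝ) (f : ℝ → 𝒵' N) : Prop where
  measurable_pairing : ∀ ψ : 𝒵 N,
    AEMeasurable (fun t => f t ψ) (volume.restrict (timeInterval T))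
  measurable_norm : ∀ j : ℤ,
    AEMeasurable (fun t => distLpNorm p (block hφ j (f t))) (volume.restrict (timeInterval T))
  norm_lt_top : clNorm hφ T ρ p s f < ∞

/-- Membership in `C̃_T(Ḃ^s_{p,1}) = L̃^∞_T(Ḃ^s_{p,1}) ∩ C([0,T]; Ḃ^s_{p,1})`. -/
structure MemCLCont (T p : ℝ≥0∞) (s : ℝ) (f : ℝ → 𝒵' N) : Prop where
  memCL : MemCL hφ T ∞ p s f
  mem_besov : ∀ t ∈ timeInterval T, besovNorm hφ p s (f t) < ∞
  continuous : ∀ t ∈ timeInterval T,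
    Tendsto (fun t' => besovNorm hφ p s (f t' - f t)) (𝓝[timeInterval T] t) (𝓝 0)

end Norms

/-- `u` solves `∂_t u = R` on `[0, T]` with `u(0) = u₀`, in `𝒵'(ℝ^N)`: for every test function `ψ`
the function `t ↦ ⟨u(t), ψ⟩` is the primitive of `t ↦ ⟨R(t), ψ⟩` with initial value `⟨u₀, ψ⟩`. -/
def SolvesEvolution {N : ℕ} (T : ℝ≥0∞) (u₀ : 𝒵' N) (R u : ℝ → 𝒵' N) : Prop :=
  ∀ t ∈ timeInterval T, ∀ ψ : 𝒵 N,
    IntervalIntegrable (fun τ => R τ ψ) volume 0 t ∧ u t ψ = u₀ ψ + ∫ τ in (0 : ℝ)..t, R τ ψ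

/-- `(a, v)` is a solution on `[0, T]` of
`∂_t a + Δv = F`, `∂_t v - νΔv - Δa = G`, `(a, v)|_{t=0} = (a₀, v₀)`. -/
structure IsSolution {N : ℕ} (ν : ℝ) (T : ℝ≥0∞) (a₀ v₀ : 𝒵' N) (F G a v : ℝ → 𝒵' N) : Prop where
  eq_a : SolvesEvolution T a₀ (fun t => F t - lap (v t)) a
  eq_v : SolvesEvolution T v₀ (fun t => G t + (ν : ℂ) • lap (v t) + lap (a t)) v

end CoupledSystem

end

/-! The system is parabolic. At frequency ξ its matrix has the eigenvalues -μ|ξ|² and -(ν-μ)|ξ|²,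
where μ² - νμ + 1 = 0, and ν > 0 forces both real parts of μ and ν - μ to be positive
(`exists_complex_viscosity`). Put w = v + μa. Since μ(ν-μ) = 1, the system becomes ∂_t w = (ν-μ)Δw +
G + μF and ∂_t a = μΔa + F - Δw. This form is triangular, not diagonal, so the double root at ν = 2
needs no separate treatment. Everything reduces to the scalar equation ∂_t u = κΔu + H with Re κ >
0.

On the annulus |ξ| ~ 2^j the kernel of exp(κtΔ) has L¹ norm at most C exp(-c 4^j t), with C and c
independent of j by scaling (`exists_kernelNorm_heatSym_le`). Duhamel's formula and Young's
inequality in time (`eLpNorm_duhamel_le`) then bound each block of u in L^{ρ₁} by the same block of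
the data, with the powers of 2^j that the lemma predicts (`exists_heat_wellposed`). The term Δw
costs 4^j, which is exactly what the smoothing of w gains, so F - Δw is no worse than F. Blocks are
never mixed in the estimates: summing over j ≥ k₀ gives the high-frequency inequality, and it holds
for any pair of exponents ρ' ≤ ρ₁, also where its right-hand side is infinite.

The rest makes this rigorous for functionals on 𝒵. All operators act on the test function, and
bounds against the L^q norm of the test function are turned back into L^p norms by duality, using
that a block reproduces itself under convolution with a Schwartz kernel
(`distLpNorm_le_of_forall_le`). Frequency blocks of a test function in 𝒵 decay faster than any power
of 2^{|j|} in both directions, so the Duhamel blocks can be summed to an element of 𝒵' for every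
regularity s, and the sum solves the equation (`exists_heat_solution`). Continuity in time comes
from integrability of the right-hand side block by block and dominated convergence in j.

For uniqueness, the Laplacian is bounded on each block, so the difference of two solutions satisfies
a linear ODE with bounded coefficients there; iterating the integral equation bounds it by B (Kt)^n
/ n! for every n (`eq_zero_of_solvesEvolution`). -/

namespace CoupledSystem

/-! ### Hölder, Schur and interpolation inequalities for nonnegative functions. -/

section Schur

variable {α β : Type*} [MeasurableSpace α] [MeasurableSpace β] {μ : Measure α} {ν : Measure β}

/-- Hölder's inequality after splitting k = k^{1/r'} k^{1/r}; equivalently, Jensen's inequality for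
the measure k dμ. -/
theorem lintegral_mul_rpow_le {k h : α → ℝ≥0∞} (hk : AEMeasurable k μ) (hh : AEMeasurable h μ)
    {r : ℝ} (hr : 1 ≤ r) :
    (∫⁻ x, k x * h x ∂μ) ^ r ≤ (∫⁻ x, k x ∂μ) ^ (r - 1) * ∫⁻ x, k x * h x ^ r ∂μ := by
  rcases hr.eq_or_lt with rfl | hr
  · simp
  have hr0 : 0 < r := by linarith
  have hc : (r.conjExponent).HolderConjugate r := (Real.HolderConjugate.conjExponent hr).symm
  have hc0 : 0 < r.conjExponent := hc.pos
  have key := ENNReal.lintegral_mul_le_Lp_mul_Lq μ hc (f := fun x => k x ^ (1 / r.conjExponent))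
    (g := fun x => k x ^ (1 / r) * h x) (hk.pow_const _) ((hk.pow_const _).mul hh)
  have e1 : ∀ x, ((fun x => k x ^ (1 / r.conjExponent)) * fun x => k x ^ (1 / r) * h x) x
      = k x * h x := by
    intro x
    simp only [Pi.mul_apply]
    rw [← mul_assoc, ← ENNReal.rpow_add_of_nonneg _ _ (by positivity) (by positivity)]
    have := hc.inv_add_inv_eq_one
    rw [one_div, one_div, this, ENNReal.rpow_one]
  have e2 : ∀ x, (k x ^ (1 / r.conjExponent)) ^ r.conjExponent = k x := by
    intro x
    rw [← ENNReal.rpow_mul, one_div, inv_mul_cancel₀ hc0.ne', ENNReal.rpow_one]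
  have e3 : ∀ x, (k x ^ (1 / r) * h x) ^ r = k x * h x ^ r := by
    intro x
    rw [ENNReal.mul_rpow_of_nonneg _ _ hr0.le, ← ENNReal.rpow_mul, one_div,
      inv_mul_cancel₀ hr0.ne', ENNReal.rpow_one]
  simp only [e1, e2, e3] at key
  have h2 := ENNReal.rpow_le_rpow key hr0.le
  refine h2.trans (le_of_eq ?_)
  rw [ENNReal.mul_rpow_of_nonneg _ _ hr0.le, ← ENNReal.rpow_mul, ← ENNReal.rpow_mul]
  congr 2
  · have := hc.inv_add_inv_eq_one
    have h3 : (r.conjExponent)⁻¹ = 1 - r⁻¹ := by linarith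
    rw [one_div, h3]
    field_simp
  · rw [one_div, inv_mul_cancel₀ hr0.ne', ENNReal.rpow_one]

theorem eLpNorm_ennreal_eq {f : α → ℝ≥0∞} {q : ℝ≥0∞} (h0 : q ≠ 0) (ht : q ≠ ∞) :
    eLpNorm f q μ = (∫⁻ x, f x ^ q.toReal ∂μ) ^ (1 / q.toReal) := by
  simp [eLpNorm_eq_lintegral_rpow_enorm_toReal h0 ht]

theorem eLpNorm_top_le_of_ae {f : α → ℝ≥0∞} {B : ℝ≥0∞} (h : ∀ᵐ x ∂μ, f x ≤ B) :
    eLpNorm f ∞ μ ≤ B := by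
  rw [eLpNorm_exponent_top, eLpNormEssSup_eq_essSup_enorm]
  exact essSup_le_of_ae_le _ h

/-- **Schur's test**. -/
theorem eLpNorm_lintegral_mul_le [SFinite μ] [SFinite ν] {K : α → β → ℝ≥0∞}
    (hK : Measurable (Function.uncurry K)) {h : β → ℝ≥0∞} (hh : AEMeasurable h ν) {A : ℝ≥0∞}
    (h1 : ∀ x, ∫⁻ y, K x y ∂ν ≤ A) (h2 : ∀ y, ∫⁻ x, K x y ∂μ ≤ A) {q : ℝ≥0∞} (hq : 1 ≤ q) :
    eLpNorm (fun x => ∫⁻ y, K x y * h y ∂ν) q μ ≤ A * eLpNorm h q ν := by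
  have hKx : ∀ x, Measurable (K x) := fun x => hK.comp measurable_prodMk_left
  rcases eq_or_ne q ∞ with rfl | ht
  · refine eLpNorm_top_le_of_ae (ae_of_all _ fun x => ?_)
    have hb : ∀ᵐ y ∂ν, h y ≤ eLpNorm h ∞ ν := by
      rw [eLpNorm_exponent_top]
      simpa using enorm_ae_le_eLpNormEssSup h ν
    calc ∫⁻ y, K x y * h y ∂ν ≤ ∫⁻ y, K x y * eLpNorm h ∞ ν ∂ν := by
          refine lintegral_mono_ae ?_
          filter_upwards [hb] with y hy
          gcongr
      _ = (∫⁻ y, K x y ∂ν) * eLpNorm h ∞ ν := lintegral_mul_const _ (hKx x)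
      _ ≤ _ := by gcongr; exact h1 x
  have h0 : q ≠ 0 := (one_pos.trans_le hq).ne'
  have hr : 1 ≤ q.toReal := by
    simpa using (ENNReal.toReal_le_toReal ENNReal.one_ne_top ht).2 hq
  set r := q.toReal
  have hr0 : 0 < r := by linarith
  have main : ∫⁻ x, (∫⁻ y, K x y * h y ∂ν) ^ r ∂μ ≤ A ^ r * ∫⁻ y, h y ^ r ∂ν := by
    obtain ⟨g, hg, hgh⟩ := hh
    have e : ∀ x, ∫⁻ y, K x y * h y ∂ν = ∫⁻ y, K x y * g y ∂ν := fun x =>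
      lintegral_congr_ae (by filter_upwards [hgh] with y hy; rw [hy])
    have e' : ∫⁻ y, h y ^ r ∂ν = ∫⁻ y, g y ^ r ∂ν :=
      lintegral_congr_ae (by filter_upwards [hgh] with y hy; rw [hy])
    simp only [e, e']
    calc ∫⁻ x, (∫⁻ y, K x y * g y ∂ν) ^ r ∂μ
        ≤ ∫⁻ x, A ^ (r - 1) * ∫⁻ y, K x y * g y ^ r ∂ν ∂μ := by
          refine lintegral_mono fun x => ?_
          refine (lintegral_mul_rpow_le (hKx x).aemeasurable hg.aemeasurable hr).trans ?_
          gcongr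
          exact h1 x
      _ = A ^ (r - 1) * ∫⁻ x, ∫⁻ y, K x y * g y ^ r ∂ν ∂μ := by
          rw [lintegral_const_mul]
          exact Measurable.lintegral_prod_right' (f := fun z : α × β => K z.1 z.2 * g z.2 ^ r)
            (hK.mul ((hg.comp measurable_snd).pow_const r))
      _ = A ^ (r - 1) * ∫⁻ y, ∫⁻ x, K x y * g y ^ r ∂μ ∂ν := by
          rw [lintegral_lintegral_swap]
          exact (hK.mul ((hg.comp measurable_snd).pow_const r)).aemeasurable
      _ ≤ A ^ (r - 1) * ∫⁻ y, A * g y ^ r ∂ν := by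
          gcongr with y
          rw [lintegral_mul_const _ (f := fun x => K x y) (hK.comp measurable_prodMk_right)]
          gcongr
          exact h2 y
      _ = A ^ r * ∫⁻ y, g y ^ r ∂ν := by
          rw [lintegral_const_mul _ (hg.pow_const r), ← mul_assoc]
          congr 1
          nth_rewrite 2 [← ENNReal.rpow_one A]
          rw [← ENNReal.rpow_add_of_nonneg _ _ (by linarith) zero_le_one]
          congr 1; ring
  rw [eLpNorm_ennreal_eq h0 ht, eLpNorm_ennreal_eq h0 ht]
  refine (ENNReal.rpow_le_rpow main (by positivity)).trans (le_of_eq ?_)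
  rw [ENNReal.mul_rpow_of_nonneg _ _ (by positivity), ← ENNReal.rpow_mul, mul_one_div_cancel hr0.ne',
    ENNReal.rpow_one]

/-- Interpolation of L^{q₁} between L^∞ and L^q. Here a plays the role of the time scale 1/c of a
damped integral, and the two hypotheses are the bounds that such an integral satisfies. -/
theorem eLpNorm_le_of_le_of_le {f : α → ℝ≥0∞} {q q₁ : ℝ≥0∞} (hq : 1 ≤ q) (hqq : q ≤ q₁)
    {a X : ℝ≥0∞} (ha0 : a ≠ 0) (hat : a ≠ ∞)
    (h1 : ∀ᵐ x ∂μ, f x ≤ a ^ (1 - q⁻¹.toReal) * X) (h2 : eLpNorm f q μ ≤ a * X) :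
    eLpNorm f q₁ μ ≤ a ^ (1 - q⁻¹.toReal + q₁⁻¹.toReal) * X := by
  rcases eq_or_ne X ∞ with rfl | hX
  · rw [ENNReal.mul_top (ENNReal.rpow_pos ha0.bot_lt hat).ne']
    exact le_top
  rcases eq_or_ne q₁ ∞ with rfl | ht1
  · simpa using eLpNorm_top_le_of_ae h1
  have ht : q ≠ ∞ := ne_top_of_le_ne_top ht1 hqq
  have h0 : q ≠ 0 := (one_pos.trans_le hq).ne'
  have h01 : q₁ ≠ 0 := (one_pos.trans_le (hq.trans hqq)).ne'
  have hr : 1 ≤ q.toReal := by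
    simpa using (ENNReal.toReal_le_toReal ENNReal.one_ne_top ht).2 hq
  have hrr : q.toReal ≤ q₁.toReal := (ENNReal.toReal_le_toReal ht ht1).2 hqq
  rw [eLpNorm_ennreal_eq h0 ht] at h2
  rw [eLpNorm_ennreal_eq h01 ht1]
  rw [ENNReal.toReal_inv] at h1 ⊢
  rw [ENNReal.toReal_inv]
  set r := q.toReal
  set r₁ := q₁.toReal
  have hr0 : 0 < r := by linarith
  have hr10 : 0 < r₁ := by linarith
  have h3 : ∫⁻ x, f x ^ r ∂μ ≤ (a * X) ^ r := by
    have := ENNReal.rpow_le_rpow h2 hr0.le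
    rwa [← ENNReal.rpow_mul, one_div_mul_cancel hr0.ne', ENNReal.rpow_one] at this
  have h4 : ∫⁻ x, f x ^ r₁ ∂μ ≤ (a ^ (1 - r⁻¹) * X) ^ (r₁ - r) * (a * X) ^ r := by
    calc ∫⁻ x, f x ^ r₁ ∂μ ≤ ∫⁻ x, (a ^ (1 - r⁻¹) * X) ^ (r₁ - r) * f x ^ r ∂μ := by
          refine lintegral_mono_ae ?_
          filter_upwards [h1] with x hx
          calc f x ^ r₁ = f x ^ (r₁ - r) * f x ^ r := by
                rw [← ENNReal.rpow_add_of_nonneg _ _ (by linarith) hr0.le]; congr 1; ring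
            _ ≤ _ := by gcongr
      _ ≤ (a ^ (1 - r⁻¹) * X) ^ (r₁ - r) * ∫⁻ x, f x ^ r ∂μ := by
          have hi : (a ^ (1 - r⁻¹) * X) ^ (r₁ - r) ≠ ∞ :=
            ENNReal.rpow_ne_top_of_nonneg (by linarith)
              (ENNReal.mul_ne_top (ENNReal.rpow_ne_top_of_ne_zero ha0 hat) hX)
          rw [lintegral_const_mul' _ _ hi]
      _ ≤ _ := by gcongr
  refine (ENNReal.rpow_le_rpow h4 (by positivity)).trans (le_of_eq ?_)
  rw [ENNReal.mul_rpow_of_nonneg _ _ (by positivity), ENNReal.mul_rpow_of_nonneg _ _ (by linarith),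
    ENNReal.mul_rpow_of_nonneg _ _ hr0.le, ENNReal.mul_rpow_of_nonneg _ _ (by positivity),
    ENNReal.mul_rpow_of_nonneg _ _ (by positivity), ← ENNReal.rpow_mul, ← ENNReal.rpow_mul,
    ← ENNReal.rpow_mul, ← ENNReal.rpow_mul, ← ENNReal.rpow_mul, mul_mul_mul_comm,
    ← ENNReal.rpow_add _ _ ha0 hat, ← ENNReal.rpow_add_of_nonneg]
  · congr 1
    · congr 1; field_simp; ring
    · convert ENNReal.rpow_one X using 2; field_simp; ring
  · apply mul_nonneg (by linarith); positivity
  · positivity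

end Schur

/-! ### Exponentially damped integrals in time. -/

theorem measurableSet_timeInterval (T : ℝ≥0∞) : MeasurableSet (timeInterval T) :=
  measurableSet_Ici.inter
    (measurableSet_le (by fun_prop : Measurable fun t : ℝ => ENNReal.ofReal t) measurable_const)

theorem Icc_subset_timeInterval {T : ℝ≥0∞} {t : ℝ} (ht : t ∈ timeInterval T) :
    Icc 0 t ⊆ timeInterval T := fun _ hs =>
  ⟨hs.1, (ENNReal.ofReal_le_ofReal hs.2).trans ht.2⟩

section Time

/-- The kernel of the Duhamel integral with damping rate `c`. -/
noncomputable def expKernel (c t s : ℝ) : ℝ≥0∞ :=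
  (Ici 0).indicator (fun r => ENNReal.ofReal (Real.exp (-(c * r)))) (t - s)

/-- The Duhamel integral of `h` with damping rate `c`. -/
noncomputable def duhamel (c : ℝ) (h : ℝ → ℝ≥0∞) (t : ℝ) : ℝ≥0∞ :=
  ∫⁻ s in Ioc 0 t, ENNReal.ofReal (Real.exp (-(c * (t - s)))) * h s

theorem measurable_expKernel (c : ℝ) : Measurable (Function.uncurry (expKernel c)) := by
  have : Measurable ((Ici (0 : ℝ)).indicator (fun r => ENNReal.ofReal (Real.exp (-(c * r))))) :=
    Measurable.indicator (by fun_prop) measurableSet_Ici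
  exact this.comp (measurable_fst.sub measurable_snd)

theorem lintegral_exp_neg {c : ℝ} (hc : 0 < c) :
    ∫⁻ r, (Ici (0 : ℝ)).indicator (fun r => ENNReal.ofReal (Real.exp (-(c * r)))) r
      = ENNReal.ofReal c⁻¹ := by
  rw [lintegral_indicator measurableSet_Ici, setLIntegral_congr Ioi_ae_eq_Ici.symm]
  have hi : IntegrableOn (fun r => Real.exp (-(c * r))) (Ioi 0) := by
    simpa using integrableOn_exp_mul_Ioi (neg_neg_of_pos hc) 0
  rw [← ofReal_integral_eq_lintegral_ofReal hi (ae_of_all _ fun r => (Real.exp_pos _).le)]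
  have := integral_exp_mul_Ioi (neg_neg_of_pos hc) 0
  simp only [neg_mul, mul_zero, Real.exp_zero] at this
  rw [this]
  congr 1
  field_simp

variable {c : ℝ} {S : Set ℝ}

theorem lintegral_expKernel_left (hc : 0 < c) (t : ℝ) :
    ∫⁻ s in S, expKernel c t s ≤ ENNReal.ofReal c⁻¹ := by
  refine (setLIntegral_le_lintegral _ _).trans ?_
  rw [← lintegral_exp_neg hc]
  exact (lintegral_sub_left_eq_self
    ((Ici (0 : ℝ)).indicator (fun r => ENNReal.ofReal (Real.exp (-(c * r))))) t).le

theorem lintegral_expKernel_right (hc : 0 < c) (s : ℝ) :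
    ∫⁻ t in S, expKernel c t s ≤ ENNReal.ofReal c⁻¹ := by
  refine (setLIntegral_le_lintegral _ _).trans ?_
  rw [← lintegral_exp_neg hc]
  exact (lintegral_sub_right_eq_self
    ((Ici (0 : ℝ)).indicator (fun r => ENNReal.ofReal (Real.exp (-(c * r))))) s).le

theorem expKernel_le_one (hc : 0 < c) (t s : ℝ) : expKernel c t s ≤ 1 := by
  unfold expKernel
  by_cases h : t - s ∈ Ici (0 : ℝ)
  · rw [indicator_of_mem h, ENNReal.ofReal_le_one, Real.exp_le_one_iff]
    have := mul_nonneg hc.le h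
    linarith
  · rw [indicator_of_notMem h]; exact zero_le_one

theorem duhamel_le (hS : ∀ t ∈ S, Icc 0 t ⊆ S) {h : ℝ → ℝ≥0∞} {t : ℝ} (ht : t ∈ S) :
    duhamel c h t ≤ ∫⁻ s in S, expKernel c t s * h s := by
  calc duhamel c h t = ∫⁻ s in Ioc 0 t, expKernel c t s * h s := by
        refine setLIntegral_congr_fun measurableSet_Ioc fun s hs => ?_
        simp only [expKernel]
        rw [indicator_of_mem (by simpa using hs.2)]
    _ ≤ _ := lintegral_mono_set (Ioc_subset_Icc_self.trans (hS t ht))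

variable {h : ℝ → ℝ≥0∞} {q : ℝ≥0∞}

/-- The kernel has mass at most 1/c and values at most 1; Hölder's inequality uses the mass for the
power 1 - 1/q and the pointwise bound for the rest. -/
theorem duhamel_le_eLpNorm (hc : 0 < c) (hS : ∀ t ∈ S, Icc 0 t ⊆ S)
    (hh : AEMeasurable h (volume.restrict S)) (hq : 1 ≤ q) {t : ℝ} (ht : t ∈ S) :
    duhamel c h t ≤ ENNReal.ofReal c⁻¹ ^ (1 - q⁻¹.toReal) * eLpNorm h q (volume.restrict S) := by
  refine (duhamel_le hS ht).trans ?_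
  have hK : Measurable (expKernel c t) := (measurable_expKernel c).comp measurable_prodMk_left
  rcases eq_or_ne q ∞ with rfl | hqt
  · simp only [ENNReal.inv_top, ENNReal.toReal_zero, sub_zero, ENNReal.rpow_one]
    have hb : ∀ᵐ y ∂(volume.restrict S), h y ≤ eLpNorm h ∞ (volume.restrict S) := by
      rw [eLpNorm_exponent_top]
      simpa using enorm_ae_le_eLpNormEssSup h (volume.restrict S)
    calc ∫⁻ s in S, expKernel c t s * h s
        ≤ ∫⁻ s in S, expKernel c t s * eLpNorm h ∞ (volume.restrict S) := by
          refine lintegral_mono_ae ?_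
          filter_upwards [hb] with y hy
          gcongr
      _ = (∫⁻ s in S, expKernel c t s) * eLpNorm h ∞ (volume.restrict S) :=
          lintegral_mul_const _ hK
      _ ≤ _ := by gcongr; exact lintegral_expKernel_left hc t
  have h0 : q ≠ 0 := (one_pos.trans_le hq).ne'
  have hr : 1 ≤ q.toReal := by
    simpa using (ENNReal.toReal_le_toReal ENNReal.one_ne_top hqt).2 hq
  rw [eLpNorm_ennreal_eq h0 hqt, ENNReal.toReal_inv]
  set r := q.toReal
  have hr0 : 0 < r := by linarith
  have h1 := lintegral_mul_rpow_le hK.aemeasurable hh hr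
  have h2 : (∫⁻ s in S, expKernel c t s * h s) ^ r
      ≤ ENNReal.ofReal c⁻¹ ^ (r - 1) * ∫⁻ s in S, h s ^ r := by
    refine h1.trans (mul_le_mul' (ENNReal.rpow_le_rpow (lintegral_expKernel_left hc t)
      (by linarith)) (lintegral_mono fun s => ?_))
    exact mul_le_of_le_one_left zero_le (expKernel_le_one hc t s)
  have h3 := ENNReal.rpow_le_rpow h2 (inv_nonneg.2 hr0.le)
  rw [← ENNReal.rpow_mul, mul_inv_cancel₀ hr0.ne', ENNReal.rpow_one,
    ENNReal.mul_rpow_of_nonneg _ _ (inv_nonneg.2 hr0.le), ← ENNReal.rpow_mul] at h3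
  rwa [one_div, show 1 - r⁻¹ = (r - 1) * r⁻¹ by field_simp]

/-- Young's inequality L^q → L^{q₁} for the exponential kernel, interpolated between the pointwise
bound and Schur's test. The power of 1/c is the gain of 2 - 2/q + 2/q₁ derivatives once c ~ 4^j. -/
theorem eLpNorm_duhamel_le (hc : 0 < c) (hSm : MeasurableSet S) (hS : ∀ t ∈ S, Icc 0 t ⊆ S)
    (hh : AEMeasurable h (volume.restrict S)) (hq : 1 ≤ q) {q₁ : ℝ≥0∞} (hqq : q ≤ q₁) :
    eLpNorm (duhamel c h) q₁ (volume.restrict S) ≤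
      ENNReal.ofReal c⁻¹ ^ (1 - q⁻¹.toReal + q₁⁻¹.toReal) * eLpNorm h q (volume.restrict S) := by
  refine eLpNorm_le_of_le_of_le hq hqq (by simpa using hc) ENNReal.ofReal_ne_top ?_ ?_
  · filter_upwards [self_mem_ae_restrict hSm] with t ht
    exact duhamel_le_eLpNorm hc hS hh hq ht
  · refine le_trans (eLpNorm_mono_enorm_ae ?_)
      (eLpNorm_lintegral_mul_le (measurable_expKernel c) hh (lintegral_expKernel_left hc)
        (lintegral_expKernel_right hc) hq)
    filter_upwards [self_mem_ae_restrict hSm] with t ht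
    simpa using duhamel_le hS ht

theorem eLpNorm_exp_le (hc : 0 < c) (hSm : MeasurableSet S) (hS : S ⊆ Ici 0)
    {q₁ : ℝ≥0∞} (hq : 1 ≤ q₁) :
    eLpNorm (fun t => ENNReal.ofReal (Real.exp (-(c * t)))) q₁ (volume.restrict S) ≤
      ENNReal.ofReal c⁻¹ ^ q₁⁻¹.toReal := by
  have hle : ∀ᵐ t ∂(volume.restrict S), ENNReal.ofReal (Real.exp (-(c * t)))
      = (Ici (0 : ℝ)).indicator (fun r => ENNReal.ofReal (Real.exp (-(c * r)))) t := by
    filter_upwards [self_mem_ae_restrict hSm] with t ht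
    rw [indicator_of_mem (hS ht)]
  -- With q = 1 and X = 1 the two hypotheses are exp ≤ 1 and total mass at most 1/c.
  have := eLpNorm_le_of_le_of_le (μ := volume.restrict S) (q := 1) (q₁ := q₁)
    (f := fun t => ENNReal.ofReal (Real.exp (-(c * t)))) le_rfl hq (a := ENNReal.ofReal c⁻¹)
    (X := 1) (by simpa using hc) ENNReal.ofReal_ne_top ?_ ?_
  · simpa using this
  · filter_upwards [self_mem_ae_restrict hSm] with t ht
    have := mul_nonneg hc.le (hS ht)
    simpa using this
  · rw [eLpNorm_one_eq_lintegral_enorm]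
    simp only [enorm_eq_self, mul_one]
    rw [lintegral_congr_ae hle, ← lintegral_exp_neg hc]
    exact setLIntegral_le_lintegral _ _

end Time

/-! ### Young's inequality and translates of Schwartz functions in L^q. -/

section Convolution

variable {N : ℕ}

/-- Young's inequality `L¹ * L^q → L^q`. -/
theorem eLpNorm_integral_mul_sub_le {h k : Space N → ℂ} (hh : AEStronglyMeasurable h volume)
    (hk : Continuous k) {q : ℝ≥0∞} (hq : 1 ≤ q) :
    eLpNorm (fun x => ∫ y, h y * k (x - y)) q volume ≤
      eLpNorm k 1 volume * eLpNorm h q volume := by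
  have hK : Measurable (Function.uncurry fun x y : Space N => ‖k (x - y)‖ₑ) := by
    have : Continuous fun z : Space N × Space N => k (z.1 - z.2) := by fun_prop
    exact this.measurable.enorm
  have hs := eLpNorm_lintegral_mul_le (μ := volume) (ν := volume) hK (h := fun y => ‖h y‖ₑ)
    hh.enorm (A := eLpNorm k 1 volume) (fun x => ?_) (fun y => ?_) hq
  · refine (eLpNorm_mono_enorm (fun x => ?_)).trans (hs.trans_eq ?_)
    · refine (enorm_integral_le_lintegral_enorm _).trans ?_
      simp [enorm_mul, mul_comm]
    · rw [eLpNorm_enorm]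
  · rw [eLpNorm_one_eq_lintegral_enorm]
    exact (lintegral_sub_left_eq_self (fun z => ‖k z‖ₑ) x).le
  · rw [eLpNorm_one_eq_lintegral_enorm]
    exact (lintegral_sub_right_eq_self (fun z => ‖k z‖ₑ) y).le

theorem convolution_mul_apply (ψ k : 𝓢(Space N, ℂ)) (x : Space N) :
    SchwartzMap.convolution (ContinuousLinearMap.mul ℂ ℂ) ψ k x = ∫ y, ψ y * k (x - y) := by
  rw [SchwartzMap.convolution_apply]
  rfl

theorem eLpNorm_convolution_le (ψ k : 𝓢(Space N, ℂ)) {q : ℝ≥0∞} (hq : 1 ≤ q) :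
    eLpNorm (SchwartzMap.convolution (ContinuousLinearMap.mul ℂ ℂ) ψ k) q volume ≤
      eLpNorm k 1 volume * eLpNorm ψ q volume := by
  have : (SchwartzMap.convolution (ContinuousLinearMap.mul ℂ ℂ) ψ k : Space N → ℂ)
      = fun x => ∫ y, ψ y * k (x - y) := funext (convolution_mul_apply ψ k)
  rw [this]
  exact eLpNorm_integral_mul_sub_le ψ.continuous.aestronglyMeasurable k.continuous hq

theorem fourierMultiplier_eq_convolution (g ψ : 𝓢(Space N, ℂ)) :
    SchwartzMap.fourierMultiplierCLM ℂ g ψ =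
      SchwartzMap.convolution (ContinuousLinearMap.mul ℂ ℂ) ψ (𝓕⁻ g) := by
  have h := SchwartzMap.fourier_convolution (ContinuousLinearMap.mul ℂ ℂ) ψ (𝓕⁻ g)
  rw [FourierTransform.fourier_fourierInv_eq] at h
  have h2 : SchwartzMap.smulLeftCLM ℂ g (𝓕 ψ)
      = SchwartzMap.pairing (ContinuousLinearMap.mul ℂ ℂ) (𝓕 ψ) g := by
    ext x
    rw [SchwartzMap.smulLeftCLM_apply_apply g.hasTemperateGrowth, SchwartzMap.pairing_apply_apply]
    simp [mul_comm]
  rw [SchwartzMap.fourierMultiplierCLM_apply, h2, ← h, FourierTransform.fourierInv_fourier_eq]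

/-- Translates of a Schwartz function. -/
noncomputable abbrev translate (y : Space N) : 𝓢(Space N, ℂ) →L[ℂ] 𝓢(Space N, ℂ) :=
  SchwartzMap.compSubConstCLM ℂ y

theorem eLpNorm_translate (k : 𝓢(Space N, ℂ)) (y : Space N) (q : ℝ≥0∞) :
    eLpNorm (translate y k) q volume = eLpNorm k q volume := by
  have : (translate y k : Space N → ℂ) = k ∘ fun x => x - y := rfl
  rw [this]
  exact eLpNorm_comp_measurePreserving k.continuous.aestronglyMeasurable
    (measurePreserving_sub_right volume y)

/-- The mean value inequality along the segment from z to y, with the weight |x|^n distributed over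
x - w and w. It makes translation continuous in L^q by Schwartz seminorms alone, which covers q = ∞,
where density arguments fail. -/
theorem norm_translate_sub_le (k : 𝓢(Space N, ℂ)) (n : ℕ) (z : Space N) :
    ∃ C, 0 ≤ C ∧ ∀ y, ‖y - z‖ ≤ 1 →
      ∀ x, ‖x‖ ^ n * ‖(translate y k - translate z k) x‖ ≤ C * ‖y - z‖ := by
  set p := SchwartzMap.seminorm ℝ n 1 k
  set p0 := SchwartzMap.seminorm ℝ 0 1 k
  have hp : 0 ≤ p := apply_nonneg _ _
  have hp0 : 0 ≤ p0 := apply_nonneg _ _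
  refine ⟨2 ^ n * (p + (‖z‖ + 1) ^ n * p0), by positivity, fun y hy x => ?_⟩
  have hb : ∀ w ∈ segment ℝ z y, ‖w - z‖ ≤ 1 := fun w hw => by
    have := (convex_closedBall z (1 : ℝ)).segment_subset (x := z) (y := y) (by simp)
      (by simpa [dist_eq_norm] using hy) hw
    simpa [dist_eq_norm] using this
  have hd : ∀ w ∈ segment ℝ z y, ‖x‖ ^ n * ‖fderiv ℝ k (x - w)‖
      ≤ 2 ^ n * (p + (‖z‖ + 1) ^ n * p0) := by
    intro w hw
    have h1 : ‖x‖ ^ n ≤ 2 ^ n * (‖x - w‖ ^ n + ‖w‖ ^ n) := by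
      have h2 : ‖x‖ ≤ 2 * max ‖x - w‖ ‖w‖ := by
        have : ‖x‖ ≤ ‖x - w‖ + ‖w‖ := by simpa using norm_add_le (x - w) w
        linarith [le_max_left ‖x - w‖ ‖w‖, le_max_right ‖x - w‖ ‖w‖]
      calc ‖x‖ ^ n ≤ (2 * max ‖x - w‖ ‖w‖) ^ n := by gcongr
        _ = 2 ^ n * max ‖x - w‖ ‖w‖ ^ n := mul_pow _ _ _
        _ ≤ _ := by
          gcongr
          rcases max_cases ‖x - w‖ ‖w‖ with ⟨h, _⟩ | ⟨h, _⟩ <;> rw [h]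
          · have : 0 ≤ ‖w‖ ^ n := by positivity
            linarith
          · have : 0 ≤ ‖x - w‖ ^ n := by positivity
            linarith
    have h3 : ‖w‖ ≤ ‖z‖ + 1 := by
      have : ‖w‖ ≤ ‖w - z‖ + ‖z‖ := by simpa using norm_add_le (w - z) z
      linarith [hb w hw]
    have h4 := SchwartzMap.le_seminorm ℝ n 1 k (x - w)
    have h5 := SchwartzMap.le_seminorm ℝ 0 1 k (x - w)
    rw [norm_iteratedFDeriv_one] at h4 h5
    rw [pow_zero, one_mul] at h5
    calc ‖x‖ ^ n * ‖fderiv ℝ k (x - w)‖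
        ≤ 2 ^ n * (‖x - w‖ ^ n + ‖w‖ ^ n) * ‖fderiv ℝ k (x - w)‖ := by gcongr
      _ = 2 ^ n * (‖x - w‖ ^ n * ‖fderiv ℝ k (x - w)‖ + ‖w‖ ^ n * ‖fderiv ℝ k (x - w)‖) := by ring
      _ ≤ _ := by gcongr
  have hder : ∀ w ∈ segment ℝ z y, HasFDerivWithinAt (fun w => ((‖x‖ ^ n : ℝ)) • k (x - w))
      (((‖x‖ ^ n : ℝ)) • -(fderiv ℝ k (x - w))) (segment ℝ z y) w := by
    intro w _
    have h1 : HasFDerivAt (fun w : Space N => x - w) (-(ContinuousLinearMap.id ℝ (Space N))) w :=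
      (hasFDerivAt_id w).const_sub x
    have h2 := (k.hasFDerivAt (x - w)).comp w h1
    have h3 := (h2.const_smul ((‖x‖ ^ n : ℝ))).hasFDerivWithinAt (s := segment ℝ z y)
    exact h3.congr_fderiv (by ext v; simp)
  have := (convex_segment z y).norm_image_sub_le_of_norm_hasFDerivWithin_le
    (C := 2 ^ n * (p + (‖z‖ + 1) ^ n * p0)) hder (fun w hw => by
      rw [norm_smul, norm_neg, norm_pow, norm_norm]; exact hd w hw)
    (left_mem_segment ℝ z y) (right_mem_segment ℝ z y)
  rw [← smul_sub, norm_smul, norm_pow, norm_norm] at this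
  exact this

theorem continuous_toLp_translate (k : 𝓢(Space N, ℂ)) (q : ℝ≥0∞) [Fact (1 ≤ q)] :
    Continuous fun y => (translate y k).toLp q (volume : Measure (Space N)) := by
  rw [continuous_iff_continuousAt]
  intro z
  obtain ⟨m, C, hC, hb⟩ := SchwartzMap.norm_toLp_le_seminorm ℝ ℂ q (volume : Measure (Space N))
  choose D hD0 hD using fun n => norm_translate_sub_le k n z
  have key : ∀ y, ‖y - z‖ ≤ 1 → ‖(translate y k).toLp q (volume : Measure (Space N))
      - (translate z k).toLp q (volume : Measure (Space N))‖
      ≤ C * (∑ n ∈ Finset.range (m + 1), D n) * ‖y - z‖ := by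
    intro y hy
    have e : (translate y k).toLp q (volume : Measure (Space N))
      - (translate z k).toLp q (volume : Measure (Space N))
      = (translate y k - translate z k).toLp q (volume : Measure (Space N)) := rfl
    rw [e, mul_assoc]
    refine (hb _).trans ?_
    gcongr
    have h0 : 0 ≤ ∑ n ∈ Finset.range (m + 1), D n := Finset.sum_nonneg fun n _ => hD0 n
    refine Seminorm.finset_sup_apply_le (by positivity) ?_
    rintro ⟨i, j⟩ hi
    have hi' := Finset.mem_Iic.1 hi
    have hj : j = 0 := Nat.le_zero.1 hi'.2
    subst hj
    have h1 : D i ≤ ∑ n ∈ Finset.range (m + 1), D n :=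
      Finset.single_le_sum (f := D) (fun n _ => hD0 n) (Finset.mem_range.2 (Nat.lt_succ_of_le hi'.1))
    have h2 : SchwartzMap.seminorm ℝ i 0 (translate y k - translate z k) ≤ D i * ‖y - z‖ := by
      refine SchwartzMap.seminorm_le_bound ℝ _ _ _ (by have := hD0 i; positivity) fun x => ?_
      rw [norm_iteratedFDeriv_zero]
      exact hD i y hy x
    exact h2.trans (by gcongr)
  rw [ContinuousAt, tendsto_iff_norm_sub_tendsto_zero]
  have hlim : Tendsto (fun y => C * (∑ n ∈ Finset.range (m + 1), D n) * ‖y - z‖) (𝓝 z) (𝓝 0) := by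
    have : Continuous fun y => C * (∑ n ∈ Finset.range (m + 1), D n) * ‖y - z‖ := by fun_prop
    simpa using this.tendsto z
  refine squeeze_zero' (Eventually.of_forall fun _ => norm_nonneg _) ?_ hlim
  filter_upwards [Metric.closedBall_mem_nhds z one_pos] with y hy
  exact key y (by simpa [dist_eq_norm] using hy)

/-- The `L^q`-valued integral of translates is the convolution. -/
theorem integral_smul_toLp_translate (k : 𝓢(Space N, ℂ)) (q : ℝ≥0∞) [hq : Fact (1 ≤ q)]
    {h : Space N → ℂ} (hh : Integrable h) :
    Integrable (fun y => h y • (translate y k).toLp q (volume : Measure (Space N))) ∧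
    ((∫ y, h y • (translate y k).toLp q (volume : Measure (Space N)) : Lp ℂ q volume) :
      Space N → ℂ) =ᵐ[volume] fun x => ∫ y, h y * k (x - y) := by
  have hint : Integrable (fun y => h y • (translate y k).toLp q (volume : Measure (Space N))) := by
    have hb : ∀ y, ‖(translate y k).toLp q (volume : Measure (Space N))‖
        ≤ ‖k.toLp q (volume : Measure (Space N))‖ := fun y => by
      rw [SchwartzMap.norm_toLp, SchwartzMap.norm_toLp, eLpNorm_translate]
    exact hh.smul_bdd _ (continuous_toLp_translate k q).aestronglyMeasurable (ae_of_all _ hb)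
  refine ⟨hint, ?_⟩
  have hprod : Integrable (fun z : Space N × Space N => h z.2 * k (z.1 - z.2))
      (volume.prod volume) := by
    have := hh.convolution_integrand (ContinuousLinearMap.mul ℝ ℂ)
      (k.integrable (μ := volume))
    simpa using this
  -- Both sides are locally integrable, so it suffices to test against smooth compactly supported g.
  -- Testing is a continuous functional on L^q and passes under the Bochner integral; Fubini then
  -- gives the pointwise convolution.
  refine ae_eq_of_integral_contDiff_smul_eq ((Lp.memLp _).locallyIntegrable hq.out)
    hprod.integral_prod_left.locallyIntegrable ?_
  intro g hg hgs
  have hg₁ : HasCompactSupport (Complex.ofRealCLM ∘ g) := hgs.comp_left rfl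
  have hg₂ : ContDiff ℝ (⊤ : ℕ∞) (Complex.ofRealCLM ∘ g) := by fun_prop
  set η : 𝓢(Space N, ℂ) := hg₁.toSchwartzMap hg₂
  have hη : ∀ x, η x = (g x : ℂ) := fun x => rfl
  let ev : Lp ℂ q (volume : Measure (Space N)) →L[ℂ] ℂ :=
    (PointwiseConvergenceCLM.evalCLM (RingHom.id ℂ) ℂ η).comp
      (Lp.toTemperedDistributionCLM ℂ (volume : Measure (Space N)) q)
  have hev : ∀ f : Lp ℂ q (volume : Measure (Space N)), ev f = ∫ x, g x • f x := by
    intro f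
    change Lp.toTemperedDistribution f η = _
    rw [Lp.toTemperedDistribution_apply]
    simp [hη]
  rw [← hev, ← ev.integral_comp_comm hint]
  have e1 : ∀ y, ev (h y • (translate y k).toLp q volume) = ∫ x, g x • (h y * k (x - y)) := by
    intro y
    rw [hev]
    refine integral_congr_ae ?_
    filter_upwards [(translate y k).coeFn_toLp q (volume : Measure (Space N)),
      Lp.coeFn_smul (h y) ((translate y k).toLp q (volume : Measure (Space N)))] with x hx hx'
    rw [hx', Pi.smul_apply, hx]
    rfl
  simp only [e1]
  rw [integral_integral_swap]
  · refine integral_congr_ae (ae_of_all _ fun x => ?_)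
    exact integral_smul _ _
  · have hb : Integrable (fun z : Space N × Space N => g z.1 • (h z.2 * k (z.1 - z.2)))
        (volume.prod volume) := by
      obtain ⟨c, hc⟩ := hgs.exists_bound_of_continuous hg.continuous
      exact hprod.bdd_smul (C := c) (hg.continuous.comp continuous_fst).aestronglyMeasurable
        (ae_of_all _ fun z => hc z.1)
    exact hb.swap

end Convolution

/-! ### The L^p norm of a distribution by duality with L^q. -/

section Duality

variable {N : ℕ} {p q : ℝ≥0∞}

theorem distLpNorm_le {u : 𝓢(Space N, ℂ) →L[ℂ] ℂ} {g : Space N → ℂ} (hg : MemLp g p volume)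
    (h : ∀ ψ : 𝓢(Space N, ℂ), u ψ = ∫ x, ψ x * g x) : distLpNorm p u ≤ eLpNorm g p volume :=
  iInf_le_of_le g (iInf_le_of_le hg (iInf_le_of_le h le_rfl))

theorem exists_of_distLpNorm_lt {u : 𝓢(Space N, ℂ) →L[ℂ] ℂ} {A : ℝ≥0∞} (h : distLpNorm p u < A) :
    ∃ g : Space N → ℂ, MemLp g p volume ∧ (∀ ψ : 𝓢(Space N, ℂ), u ψ = ∫ x, ψ x * g x) ∧
      eLpNorm g p volume < A := by
  simp only [distLpNorm, iInf_lt_iff] at h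
  obtain ⟨g, h1, h2, h3⟩ := h
  exact ⟨g, h1, h2, h3⟩

theorem integrable_schwartz_mul [ENNReal.HolderConjugate p q] {g : Space N → ℂ}
    (hg : MemLp g p volume) (ψ : 𝓢(Space N, ℂ)) : Integrable (fun x => ψ x * g x) := by
  have : ENNReal.HolderTriple q p 1 := ENNReal.HolderTriple.symm
  exact memLp_one_iff_integrable.1 (hg.mul (ψ.memLp q volume))

theorem enorm_integral_mul_le [ENNReal.HolderConjugate p q] {g : Space N → ℂ}
    (hg : MemLp g p volume) (ψ : 𝓢(Space N, ℂ)) :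
    ‖∫ x, ψ x * g x‖ₑ ≤ eLpNorm g p volume * eLpNorm ψ q volume := by
  have : ENNReal.HolderTriple q p 1 := ENNReal.HolderTriple.symm
  refine (enorm_integral_le_lintegral_enorm _).trans ?_
  rw [← eLpNorm_one_eq_lintegral_enorm, mul_comm]
  have := eLpNorm_smul_le_mul_eLpNorm (p := q) (q := p) (r := 1) (φ := ψ) hg.1
    ψ.continuous.aestronglyMeasurable
  simp only [smul_eq_mul] at this
  exact this

/-- **Hölder's inequality** for the pairing of a distribution with a test function. -/
theorem enorm_apply_le_distLpNorm [ENNReal.HolderConjugate p q] (u : 𝓢(Space N, ℂ) →L[ℂ] ℂ)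
    (ψ : 𝓢(Space N, ℂ)) : ‖u ψ‖ₑ ≤ distLpNorm p u * eLpNorm ψ q volume := by
  have hq0 : q ≠ 0 := by
    rintro rfl
    simpa using ENNReal.HolderConjugate.inv_add_inv_eq_one p 0
  -- If `distLpNorm p u` is infinite and ψ has norm 0, the right-hand side is ∞ · 0 = 0, so ψ = 0
  -- has to be proved first.
  rcases eq_or_ne (eLpNorm ψ q volume) 0 with h0 | h0
  · rw [eLpNorm_eq_zero_iff ψ.continuous.aestronglyMeasurable hq0] at h0
    have h1 : (ψ : Space N → ℂ) = 0 :=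
      (Continuous.ae_eq_iff_eq volume ψ.continuous continuous_zero).1 h0
    have : ψ = 0 := by ext x; simp [h1]
    simp [this]
  · rcases eq_or_ne (distLpNorm p u) ∞ with ht | ht
    · rw [ht, ENNReal.top_mul h0]; exact le_top
    have hψ : eLpNorm ψ q volume ≠ ∞ := (ψ.eLpNorm_lt_top q volume).ne
    refine (ENNReal.div_le_iff_le_mul (Or.inl h0) (Or.inl hψ)).1 ?_
    refine le_of_forall_gt fun A hA => ?_
    obtain ⟨g, hg, hu, hlt⟩ := exists_of_distLpNorm_lt hA
    refine lt_of_le_of_lt ?_ hlt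
    rw [ENNReal.div_le_iff_le_mul (Or.inl h0) (Or.inl hψ), hu]
    exact enorm_integral_mul_le hg ψ

theorem distLpNorm_zero : distLpNorm p (0 : 𝓢(Space N, ℂ) →L[ℂ] ℂ) = 0 := by
  refine le_antisymm ((distLpNorm_le (g := 0) MemLp.zero' (by simp)).trans (by simp)) zero_le

theorem distLpNorm_smul_le (c : ℂ) (u : 𝓢(Space N, ℂ) →L[ℂ] ℂ) :
    distLpNorm p (c • u) ≤ ‖c‖ₑ * distLpNorm p u := by
  rcases eq_or_ne c 0 with rfl | hc
  · have : (0 : ℂ) • u = 0 := by ext; simp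
    rw [this, distLpNorm_zero]
    exact zero_le
  have hc0 : ‖c‖ₑ ≠ 0 := by simpa using hc
  rw [mul_comm]
  refine (ENNReal.div_le_iff_le_mul (Or.inl hc0) (Or.inl enorm_ne_top)).1 ?_
  refine le_of_forall_gt fun A hA => ?_
  obtain ⟨g, hg, hu, hlt⟩ := exists_of_distLpNorm_lt hA
  refine lt_of_le_of_lt ?_ hlt
  rw [ENNReal.div_le_iff_le_mul (Or.inl hc0) (Or.inl enorm_ne_top), mul_comm,
    ← eLpNorm_const_smul]
  refine distLpNorm_le (hg.const_smul c) fun ψ => ?_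
  rw [smul_apply, hu, smul_eq_mul, ← integral_const_mul]
  congr 1 with x
  simp; ring

theorem distLpNorm_add_le (hp : 1 ≤ p) (u v : 𝓢(Space N, ℂ) →L[ℂ] ℂ) :
    distLpNorm p (u + v) ≤ distLpNorm p u + distLpNorm p v := by
  have : ENNReal.HolderConjugate p p.conjExponent := .conjExponent hp
  refine ENNReal.le_of_forall_pos_le_add fun ε hε hlt => ?_
  have hε' : (0 : ℝ≥0∞) < ε / 2 := by simpa using hε.ne'
  obtain ⟨hu, hv⟩ := ENNReal.add_lt_top.1 hlt
  obtain ⟨g, hg, hgu, hg'⟩ := exists_of_distLpNorm_lt (ENNReal.lt_add_right hu.ne hε'.ne')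
  obtain ⟨k, hk, hkv, hk'⟩ := exists_of_distLpNorm_lt (ENNReal.lt_add_right hv.ne hε'.ne')
  calc distLpNorm p (u + v) ≤ eLpNorm (g + k) p volume := by
        refine distLpNorm_le (hg.add hk) fun ψ => ?_
        rw [add_apply, hgu, hkv,
          ← integral_add (integrable_schwartz_mul (q := p.conjExponent) hg ψ)
            (integrable_schwartz_mul (q := p.conjExponent) hk ψ)]
        simp [mul_add]
    _ ≤ eLpNorm g p volume + eLpNorm k p volume := eLpNorm_add_le hg.1 hk.1 hp
    _ ≤ (distLpNorm p u + ε / 2) + (distLpNorm p v + ε / 2) := add_le_add hg'.le hk'.le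
    _ = _ := by rw [add_add_add_comm, ENNReal.add_halves]

theorem distLpNorm_neg (u : 𝓢(Space N, ℂ) →L[ℂ] ℂ) : distLpNorm p (-u) = distLpNorm p u := by
  have h : ∀ u : 𝓢(Space N, ℂ) →L[ℂ] ℂ, distLpNorm p (-u) ≤ distLpNorm p u := fun u => by
    have := distLpNorm_smul_le (p := p) (-1) u
    rw [show (-1 : ℂ) • u = -u by ext; simp] at this
    simpa using this
  refine le_antisymm (h u) ?_
  simpa using h (-u)

theorem distLpNorm_sub_le (hp : 1 ≤ p) (u v : 𝓢(Space N, ℂ) →L[ℂ] ℂ) :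
    distLpNorm p (u - v) ≤ distLpNorm p u + distLpNorm p v := by
  rw [sub_eq_add_neg, ← distLpNorm_neg v]
  exact distLpNorm_add_le hp _ _

/-- A distribution that is bounded for the `L^q` norm of the test function extends to `L^q`. -/
theorem exists_extension_toLp [Fact (1 ≤ q)] (u : 𝓢(Space N, ℂ) →L[ℂ] ℂ) (A : ℝ≥0)
    (hA : ∀ ψ, ‖u ψ‖ₑ ≤ A * eLpNorm ψ q volume) :
    ∃ U : Lp ℂ q (volume : Measure (Space N)) →L[ℂ] ℂ,
      (∀ ψ : 𝓢(Space N, ℂ), U (ψ.toLp q volume) = u ψ) ∧ ‖U‖ ≤ A := by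
  have hA' : ∀ ψ : 𝓢(Space N, ℂ), ‖u ψ‖ ≤ A * ‖ψ.toLp q (volume : Measure (Space N))‖ := by
    intro ψ
    have h := ENNReal.toReal_mono (ENNReal.mul_ne_top ENNReal.coe_ne_top
      (ψ.eLpNorm_lt_top q volume).ne) (hA ψ)
    rw [SchwartzMap.norm_toLp]
    simpa using h
  let Lq : 𝓢(Space N, ℂ) →ₗ[ℂ] Lp ℂ q (volume : Measure (Space N)) :=
    (SchwartzMap.toLpCLM ℂ ℂ q volume).toLinearMap
  have hinj : Function.Injective Lq := SchwartzMap.injective_toLp q volume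
  let e := LinearEquiv.ofInjective Lq hinj
  let f : LinearMap.range Lq →L[ℂ] ℂ :=
    (u.toLinearMap ∘ₗ e.symm.toLinearMap).mkContinuous A (fun x => by
      obtain ⟨ψ, rfl⟩ := e.surjective x
      simpa only [LinearMap.comp_apply, LinearEquiv.coe_coe, LinearEquiv.symm_apply_apply] using! hA' ψ)
  -- Hahn-Banach instead of extension by density, because Schwartz functions are not dense in L^q
  -- when q = ∞, that is, when p = 1.
  obtain ⟨U, hU, hn⟩ := exists_extension_norm_eq _ f
  refine ⟨U, fun ψ => ?_, hn.trans_le (LinearMap.mkContinuous_norm_le _ A.2 _)⟩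
  have := hU (e ψ)
  have h2 : f (e ψ) = u ψ := by simp [f]
  rw [h2] at this
  exact this

theorem integral_mul_apply_translate [Fact (1 ≤ q)] {u : 𝓢(Space N, ℂ) →L[ℂ] ℂ}
    {U : Lp ℂ q (volume : Measure (Space N)) →L[ℂ] ℂ}
    (hU : ∀ ψ : 𝓢(Space N, ℂ), U (ψ.toLp q volume) = u ψ) (k : 𝓢(Space N, ℂ))
    {h : Space N → ℂ} (hh : Integrable h) :
    ∫ y, h y * u (translate y k) =
      U (∫ y, h y • (translate y k).toLp q (volume : Measure (Space N))) := by
  rw [← U.integral_comp_comm (integral_smul_toLp_translate k q hh).1]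
  congr 1 with y
  rw [map_smul, hU, smul_eq_mul]

/-- The pairing of h with y ↦ u(k(· - y)) is U applied to h * k, and Young's inequality bounds h * k
in L^q. This is the hypothesis that the converse of Hölder's inequality asks for. -/
theorem enorm_integral_mul_translate_le [hq : Fact (1 ≤ q)] {u : 𝓢(Space N, ℂ) →L[ℂ] ℂ} {A : ℝ≥0}
    {U : Lp ℂ q (volume : Measure (Space N)) →L[ℂ] ℂ}
    (hU : ∀ ψ : 𝓢(Space N, ℂ), U (ψ.toLp q volume) = u ψ) (hUA : ‖U‖ ≤ A) (k : 𝓢(Space N, ℂ))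
    {h : Space N → ℂ} (hh : Integrable h) :
    ‖∫ y, h y * u (translate y k)‖ₑ ≤ A * (eLpNorm k 1 volume * eLpNorm h q volume) := by
  rw [integral_mul_apply_translate hU k hh]
  refine (U.le_opENorm _).trans ?_
  gcongr
  · rw [← ofReal_norm, ← ENNReal.ofReal_coe_nnreal]
    exact ENNReal.ofReal_le_ofReal hUA
  · rw [Lp.enorm_def, eLpNorm_congr_ae (integral_smul_toLp_translate k q hh).2]
    exact eLpNorm_integral_mul_sub_le hh.1 k.continuous hq.out

/-- The test function that realizes the `L^r` norm of `g` on `s`. -/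
noncomputable def dualTest (s : Set (Space N)) (r : ℝ) (g : Space N → ℂ) (y : Space N) : ℂ :=
  s.indicator (fun y => (starRingEnd ℂ) (g y) * ((‖g y‖ ^ (r - 2) : ℝ) : ℂ)) y

theorem measurable_dualTest {s : Set (Space N)} (hs : MeasurableSet s) (r : ℝ)
    {g : Space N → ℂ} (hg : Measurable g) : Measurable (dualTest s r g) := by
  refine Measurable.indicator ?_ hs
  have h1 : Measurable fun y => (starRingEnd ℂ) (g y) := Complex.continuous_conj.measurable.comp hg
  exact h1.mul (Complex.measurable_ofReal.comp (hg.norm.pow_const (r - 2)))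

theorem norm_dualTest_le (s : Set (Space N)) (r : ℝ) (g : Space N → ℂ)
    (y : Space N) : ‖dualTest s r g y‖ ≤ s.indicator (fun y => ‖g y‖ ^ (r - 1)) y := by
  by_cases hy : y ∈ s
  · rw [dualTest, indicator_of_mem hy, indicator_of_mem hy, norm_mul, RCLike.norm_conj,
      Complex.norm_real, Real.norm_of_nonneg (by positivity)]
    rcases eq_or_ne (g y) 0 with h0 | h0
    · simp only [h0, norm_zero, zero_mul]; positivity
    · have : 0 < ‖g y‖ := norm_pos_iff.2 h0
      have h2 := Real.rpow_add this 1 (r - 2)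
      rw [Real.rpow_one] at h2
      rw [← h2]
      apply le_of_eq; congr 1; ring
  · simp [dualTest, hy]

theorem dualTest_mul (s : Set (Space N)) {r : ℝ} (hr : 0 < r) (g : Space N → ℂ) (y : Space N) :
    dualTest s r g y * g y = ((s.indicator (fun y => ‖g y‖ ^ r) y : ℝ) : ℂ) := by
  by_cases hy : y ∈ s
  · rw [dualTest, indicator_of_mem hy, indicator_of_mem hy]
    rcases eq_or_ne (g y) 0 with h0 | h0
    · simp [h0, Real.zero_rpow hr.ne']
    · have : 0 < ‖g y‖ := norm_pos_iff.2 h0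
      rw [mul_right_comm, ← Complex.normSq_eq_conj_mul_self, Complex.normSq_eq_norm_sq,
        ← Complex.ofReal_mul, ← Real.rpow_natCast, ← Real.rpow_add this]
      congr 2; push_cast; ring
  · simp [dualTest, hy]

/-- Converse of Hölder's inequality for bounded functions. -/
theorem eLpNorm_le_of_dualTest [ENNReal.HolderConjugate p q] (hp : 1 ≤ p) (hpt : p ≠ ∞)
    {g : Space N → ℂ} (hg : Measurable g) {M : ℝ} (hM : ∀ y, ‖g y‖ ≤ M) {A : ℝ≥0∞}
    (h : ∀ k : Space N → ℂ, Integrable k → ‖∫ y, k y * g y‖ₑ ≤ A * eLpNorm k q volume) :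
    eLpNorm g p volume ≤ A := by
  have hp0 : p ≠ 0 := (one_pos.trans_le hp).ne'
  have hr : 1 ≤ p.toReal := by
    simpa using (ENNReal.toReal_le_toReal ENNReal.one_ne_top hpt).2 hp
  have hconj := ENNReal.HolderConjugate.inv_add_inv_eq_one p q
  rw [eLpNorm_eq_lintegral_rpow_enorm_toReal hp0 hpt]
  set r := p.toReal with hrdef
  have hr0 : 0 < r := by linarith
  -- On sets of finite measure the bounded g has a finite integral I, which permits the division I ≤
  -- A I^{1-1/r} ⟹ I^{1/r} ≤ A below.
  suffices hs : ∀ s, MeasurableSet s → volume s ≠ ∞ → ∫⁻ y in s, ‖g y‖ₑ ^ r ≤ A ^ r by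
    have := lintegral_le_of_forall_fin_meas_le (A ^ r) hs
    have h2 := ENNReal.rpow_le_rpow this (by positivity : 0 ≤ 1 / r)
    rwa [← ENNReal.rpow_mul, mul_one_div_cancel hr0.ne', ENNReal.rpow_one] at h2
  intro s hs hsf
  have hM0 : 0 ≤ M := (norm_nonneg _).trans (hM 0)
  set I := ∫⁻ y in s, ‖g y‖ₑ ^ r with hI
  have hIt : I ≠ ∞ := by
    refine ne_top_of_le_ne_top (ENNReal.mul_ne_top
      (ENNReal.rpow_ne_top_of_nonneg hr0.le (ENNReal.ofReal_ne_top (r := M))) hsf) ?_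
    rw [← setLIntegral_const]
    refine lintegral_mono fun y => ?_
    gcongr
    rw [← ofReal_norm]
    exact ENNReal.ofReal_le_ofReal (hM y)
  have hki : Integrable (dualTest s r g) := by
    refine Integrable.mono' (g := s.indicator fun _ => M ^ (r - 1)) ?_
      (measurable_dualTest hs r hg).aestronglyMeasurable (ae_of_all _ fun y => ?_)
    · exact (integrable_indicator_iff hs).2 (integrableOn_const hsf)
    · refine (norm_dualTest_le s r g y).trans (indicator_le_indicator ?_)
      exact Real.rpow_le_rpow (norm_nonneg _) (hM y) (by linarith)
  have hkI : ‖∫ y, dualTest s r g y * g y‖ₑ = I := by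
    simp only [dualTest_mul s hr0 g]
    rw [integral_complex_ofReal, ← ofReal_norm, Complex.norm_real,
      integral_indicator hs, Real.norm_of_nonneg (integral_nonneg fun y => by positivity),
      ofReal_integral_eq_lintegral_ofReal]
    · refine lintegral_congr fun y => ?_
      rw [← ENNReal.ofReal_rpow_of_nonneg (norm_nonneg _) hr0.le, ofReal_norm]
    · refine IntegrableOn.of_bound hsf.lt_top (hg.norm.pow_const r).aestronglyMeasurable (M ^ r)
        (ae_of_all _ fun y => ?_)
      rw [Real.norm_of_nonneg (by positivity)]
      exact Real.rpow_le_rpow (norm_nonneg _) (hM y) hr0.le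
    · exact ae_of_all _ fun y => by positivity
  have hkq : eLpNorm (dualTest s r g) q volume ≤ I ^ (1 - r⁻¹) := by
    have hb : ∀ y, ‖dualTest s r g y‖ₑ ≤ s.indicator (fun y => ‖g y‖ₑ ^ (r - 1)) y := by
      intro y
      have h1 := norm_dualTest_le s r g y
      by_cases hy : y ∈ s
      · rw [indicator_of_mem hy] at h1 ⊢
        rw [← ofReal_norm, ← ofReal_norm, ENNReal.ofReal_rpow_of_nonneg (norm_nonneg _)
          (by linarith)]
        exact ENNReal.ofReal_le_ofReal h1
      · simp [dualTest, hy]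
    have hinv : p⁻¹ = ENNReal.ofReal r⁻¹ := by
      rw [ENNReal.ofReal_inv_of_pos hr0, ENNReal.ofReal_toReal hpt]
    rcases eq_or_ne q ∞ with rfl | hqt
    · have hp1 : p = 1 := by simpa using hconj
      have hr1 : r = 1 := by rw [hrdef, hp1]; simp
      rw [hr1]
      simp only [inv_one, sub_self, ENNReal.rpow_zero]
      rw [eLpNorm_exponent_top]
      refine essSup_le_of_ae_le _ (ae_of_all _ fun y => ?_)
      have := hb y
      rw [hr1] at this
      refine this.trans ?_
      by_cases hy : y ∈ s <;> simp [hy]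
    have hq0 : q ≠ 0 := by
      rintro rfl
      simp at hconj
    have hq' : r⁻¹ + q.toReal⁻¹ = 1 := by
      have := congrArg ENNReal.toReal hconj
      rwa [ENNReal.toReal_add (ENNReal.inv_ne_top.2 hp0) (ENNReal.inv_ne_top.2 hq0),
        ENNReal.toReal_inv, ENNReal.toReal_inv, ENNReal.toReal_one] at this
    have hq'0 : 0 < q.toReal := ENNReal.toReal_pos hq0 hqt
    rw [eLpNorm_eq_lintegral_rpow_enorm_toReal hq0 hqt, one_div,
      show 1 - r⁻¹ = q.toReal⁻¹ by linarith]
    refine ENNReal.rpow_le_rpow ?_ (by positivity)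
    rw [hI, ← lintegral_indicator hs]
    refine lintegral_mono fun y => ?_
    refine (ENNReal.rpow_le_rpow (hb y) hq'0.le).trans ?_
    by_cases hy : y ∈ s
    · rw [indicator_of_mem hy, indicator_of_mem hy, ← ENNReal.rpow_mul]
      apply le_of_eq
      congr 1
      field_simp at hq'
      linarith
    · simp [hy, hq'0]
  have := h _ hki
  rw [hkI] at this
  have h3 : I ≤ A * I ^ (1 - r⁻¹) := this.trans (by gcongr)
  rcases eq_or_ne I 0 with h0 | h0
  · rw [h0]; exact zero_le
  have h4 : I ^ r⁻¹ ≤ A := by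
    have h5 : I = I ^ r⁻¹ * I ^ (1 - r⁻¹) := by
      rw [← ENNReal.rpow_add _ _ h0 hIt]; simp
    have h6 : I ^ (1 - r⁻¹) ≠ 0 := (ENNReal.rpow_pos (pos_iff_ne_zero.2 h0) hIt).ne'
    have h7 : I ^ (1 - r⁻¹) ≠ ∞ := ENNReal.rpow_ne_top_of_ne_zero h0 hIt
    nth_rewrite 1 [h5] at h3
    exact (ENNReal.mul_le_mul_iff_left h6 h7).1 h3
  have h8 := ENNReal.rpow_le_rpow h4 hr0.le
  rwa [← ENNReal.rpow_mul, inv_mul_cancel₀ hr0.ne', ENNReal.rpow_one] at h8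

/-- A frequency localized distribution that is bounded for the `L^q` norm of the test function is
represented by a function in `L^p`. -/
theorem distLpNorm_le_of_forall_le [ENNReal.HolderConjugate p q] (hp : 1 ≤ p)
    {u : 𝓢(Space N, ℂ) →L[ℂ] ℂ} {A : ℝ≥0} (hA : ∀ ψ, ‖u ψ‖ₑ ≤ A * eLpNorm ψ q volume)
    (k : 𝓢(Space N, ℂ))
    (hk : ∀ ψ, u (SchwartzMap.convolution (ContinuousLinearMap.mul ℂ ℂ) ψ k) = u ψ) :
    distLpNorm p u ≤ A * eLpNorm k 1 volume := by
  have hq1 : 1 ≤ q := by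
    have := ENNReal.HolderConjugate.inv_add_inv_eq_one p q
    rw [← ENNReal.inv_le_one, ← this]
    exact le_add_self
  have : Fact (1 ≤ q) := ⟨hq1⟩
  obtain ⟨U, hU, hUA⟩ := exists_extension_toLp u A hA
  -- Since u(ψ) = u(ψ * k) and ψ * k is a superposition of translates of k with weights ψ(y), the
  -- density of u is the value of u on these translates.
  set g : Space N → ℂ := fun y => u (translate y k) with hg
  have hgc : Continuous g := by
    have : g = fun y => U ((translate y k).toLp q volume) := by
      ext y; rw [hU]
    rw [this]
    exact U.continuous.comp (continuous_toLp_translate k q)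
  have hgb : ∀ y, ‖g y‖ₑ ≤ A * eLpNorm k q volume := fun y => by
    have := hA (translate y k)
    rwa [eLpNorm_translate] at this
  have hrep : ∀ ψ : 𝓢(Space N, ℂ), u ψ = ∫ x, ψ x * g x := by
    intro ψ
    rw [hg, integral_mul_apply_translate hU k ψ.integrable, ← hk ψ, ← hU]
    congr 1
    refine Lp.ext ?_
    refine (SchwartzMap.coeFn_toLp _ q _).trans
      (EventuallyEq.trans ?_ (integral_smul_toLp_translate k q ψ.integrable).2.symm)
    exact Eventually.of_forall fun x => convolution_mul_apply ψ k x
  have hnorm : eLpNorm g p volume ≤ A * eLpNorm k 1 volume := by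
    rcases eq_or_ne p ∞ with rfl | hpt
    · have hq : q = 1 := by
        have := ENNReal.HolderConjugate.inv_add_inv_eq_one ∞ q
        simpa using this
      rw [eLpNorm_exponent_top]
      refine essSup_le_of_ae_le _ (ae_of_all _ fun y => ?_)
      rw [← hq]
      exact hgb y
    · have hkq : A * eLpNorm k q volume ≠ ∞ :=
        ENNReal.mul_ne_top ENNReal.coe_ne_top (k.eLpNorm_lt_top q volume).ne
      refine eLpNorm_le_of_dualTest (q := q) hp hpt hgc.measurable
        (M := (A * eLpNorm k q volume).toReal) (fun y => ?_)
        fun h hh => ?_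
      · have := ENNReal.toReal_mono hkq (hgb y)
        simpa using this
      · rw [mul_assoc]
        exact enorm_integral_mul_translate_le hU hUA k hh
  refine (distLpNorm_le ⟨hgc.aestronglyMeasurable, ?_⟩ hrep).trans hnorm
  exact hnorm.trans_lt (ENNReal.mul_lt_top ENNReal.coe_lt_top (k.eLpNorm_lt_top 1 volume))

end Duality

/-! ### Fourier multipliers m(2^{-j} D) and their kernels. -/

section Multiplier

variable {N : ℕ}

/-- The dilation `m ↦ m(a ·)` of Schwartz functions. -/
noncomputable def dilation (a : ℝ) (ha : a ≠ 0) : 𝓢(Space N, ℂ) →L[ℂ] 𝓢(Space N, ℂ) :=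
  SchwartzMap.compCLMOfContinuousLinearEquiv ℂ (ContinuousLinearEquiv.smulLeft (Units.mk0 a ha))

@[simp]
theorem dilation_apply (a : ℝ) (ha : a ≠ 0) (m : 𝓢(Space N, ℂ)) (ξ : Space N) :
    dilation a ha m ξ = m (a • ξ) := rfl

/-- The `L¹` norm of the convolution kernel with symbol `m`. -/
noncomputable def kernelNorm (m : 𝓢(Space N, ℂ)) : ℝ≥0∞ :=
  eLpNorm (𝓕⁻ m : 𝓢(Space N, ℂ)) 1 volume

theorem kernelNorm_lt_top (m : 𝓢(Space N, ℂ)) : kernelNorm m < ∞ :=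
  SchwartzMap.eLpNorm_lt_top _ _ _

theorem fourierInv_dilation (a : ℝ) (ha : a ≠ 0) (m : 𝓢(Space N, ℂ)) (x : Space N) :
    (𝓕⁻ (dilation a ha m) : 𝓢(Space N, ℂ)) x =
      |(a ^ N)⁻¹| • (𝓕⁻ m : 𝓢(Space N, ℂ)) (a⁻¹ • x) := by
  rw [SchwartzMap.fourierInv_coe, SchwartzMap.fourierInv_coe, Real.fourierInv_eq',
    Real.fourierInv_eq']
  have h := Measure.integral_comp_smul (volume : Measure (Space N))
    (fun v : Space N => Complex.exp ((2 * Real.pi * inner ℝ v (a⁻¹ • x) : ℝ) * Complex.I) • m v) a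
  rw [finrank_euclideanSpace_fin] at h
  rw [← h]
  congr 1 with v
  rw [dilation_apply]
  congr 4
  rw [inner_smul_left, inner_smul_right]
  simp [mul_inv_cancel_left₀ ha]

/-- Dilating the symbol rescales the kernel in a way that preserves its L¹ norm. This is why every
multiplier bound is uniform in the frequency 2^j. -/
theorem kernelNorm_dilation (a : ℝ) (ha : a ≠ 0) (m : 𝓢(Space N, ℂ)) :
    kernelNorm (dilation a ha m) = kernelNorm m := by
  unfold kernelNorm
  rw [eLpNorm_one_eq_lintegral_enorm, eLpNorm_one_eq_lintegral_enorm,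
    ← ofReal_integral_norm_eq_lintegral_enorm (SchwartzMap.integrable _),
    ← ofReal_integral_norm_eq_lintegral_enorm (SchwartzMap.integrable _)]
  congr 1
  simp only [fourierInv_dilation, norm_smul, norm_abs_eq_norm]
  rw [integral_const_mul, Measure.integral_comp_smul (volume : Measure (Space N))
    (fun x => ‖(𝓕⁻ m : 𝓢(Space N, ℂ)) x‖) a⁻¹, finrank_euclideanSpace_fin, smul_eq_mul, ← mul_assoc]
  have : ‖(a ^ N)⁻¹‖ * |(a⁻¹ ^ N)⁻¹| = 1 := by
    rw [Real.norm_eq_abs, ← abs_mul, inv_pow, inv_inv, inv_mul_cancel₀ (pow_ne_zero _ ha), abs_one]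
  rw [this, one_mul]

/-- Continuity of the inverse Fourier transform from 𝓢 to L¹; it turns bounds on finitely many
derivatives of a symbol into operator bounds. -/
theorem exists_kernelNorm_le : ∃ (s : Finset (ℕ × ℕ)) (C : ℝ), 0 ≤ C ∧ ∀ m : 𝓢(Space N, ℂ),
    kernelNorm m ≤ ENNReal.ofReal (C * (s.sup (schwartzSeminormFamily ℝ (Space N) ℂ)) m) := by
  let L : 𝓢(Space N, ℂ) →L[ℝ] Lp ℂ 1 (volume : Measure (Space N)) :=
    (SchwartzMap.toLpCLM ℝ ℂ 1 volume).comp (FourierTransform.fourierInvCLM ℝ 𝓢(Space N, ℂ))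
  have hc : Continuous ((normSeminorm ℝ (Lp ℂ 1 (volume : Measure (Space N)))).comp
      L.toLinearMap) := continuous_norm.comp L.continuous
  obtain ⟨s, C, -, h⟩ := Seminorm.bound_of_continuous
    (schwartz_withSeminorms ℝ (Space N) ℂ) _ hc
  refine ⟨s, C, C.2, fun m => ?_⟩
  have h1 := h m
  have h2 : ((normSeminorm ℝ (Lp ℂ 1 (volume : Measure (Space N)))).comp L.toLinearMap) m
      = (kernelNorm m).toReal := SchwartzMap.norm_toLp
  rw [h2] at h1
  rw [← ENNReal.ofReal_toReal (kernelNorm_lt_top m).ne]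
  exact ENNReal.ofReal_le_ofReal h1

theorem two_zpow_two_pi_ne_zero (j : ℤ) : (2 : ℝ) ^ (-j) * (2 * Real.pi) ≠ 0 := by positivity

/-- `symbol m j` as a Schwartz function, linear in `m`. -/
noncomputable def symbolS (j : ℤ) : 𝓢(Space N, ℂ) →L[ℂ] 𝓢(Space N, ℂ) :=
  dilation ((2 : ℝ) ^ (-j) * (2 * Real.pi)) (two_zpow_two_pi_ne_zero j)

theorem coe_symbolS (j : ℤ) (m : 𝓢(Space N, ℂ)) : (symbolS j m : Space N → ℂ) = symbol m j := by
  ext ξ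
  simp [symbolS, symbol, mul_smul]

/-- The Fourier multiplier `m(2^{-j} D)`. -/
noncomputable def mulOp (j : ℤ) (m : 𝓢(Space N, ℂ)) : 𝓢(Space N, ℂ) →L[ℂ] 𝓢(Space N, ℂ) :=
  SchwartzMap.fourierMultiplierCLM ℂ (symbol m j)

theorem fourier_mulOp (j : ℤ) (m ψ : 𝓢(Space N, ℂ)) (ξ : Space N) :
    (𝓕 (mulOp j m ψ) : 𝓢(Space N, ℂ)) ξ = symbol m j ξ * (𝓕 ψ : 𝓢(Space N, ℂ)) ξ :=
  congrFun (fourier_multiplier (symbol_growth m j) ψ) ξ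

theorem ext_fourier {f g : 𝓢(Space N, ℂ)}
    (h : ∀ ξ, (𝓕 f : 𝓢(Space N, ℂ)) ξ = (𝓕 g : 𝓢(Space N, ℂ)) ξ) : f = g := by
  have : (𝓕 f : 𝓢(Space N, ℂ)) = 𝓕 g := SchwartzMap.ext h
  rw [← FourierTransform.fourierInv_fourier_eq f (F := 𝓢(Space N, ℂ)), this,
    FourierTransform.fourierInv_fourier_eq]

theorem mulOp_eq_convolution (j : ℤ) (m ψ : 𝓢(Space N, ℂ)) :
    mulOp j m ψ = SchwartzMap.convolution (ContinuousLinearMap.mul ℂ ℂ) ψ (𝓕⁻ (symbolS j m)) := by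
  rw [← fourierMultiplier_eq_convolution, coe_symbolS, mulOp]

theorem eLpNorm_kernel (j : ℤ) (m : 𝓢(Space N, ℂ)) :
    eLpNorm (𝓕⁻ (symbolS j m) : 𝓢(Space N, ℂ)) 1 volume = kernelNorm m :=
  kernelNorm_dilation _ _ m

/-- **Bernstein-Young**: the multiplier `m(2^{-j} D)` is bounded on `L^q` uniformly in `j`. -/
theorem eLpNorm_mulOp_le (j : ℤ) (m ψ : 𝓢(Space N, ℂ)) {q : ℝ≥0∞} (hq : 1 ≤ q) :
    eLpNorm (mulOp j m ψ) q volume ≤ kernelNorm m * eLpNorm ψ q volume := by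
  rw [mulOp_eq_convolution, ← eLpNorm_kernel j m]
  exact eLpNorm_convolution_le _ _ hq

/-- `m ↦ m(2^{-j} D) ψ` as a continuous linear map. -/
noncomputable def mulOpSymbol (j : ℤ) (ψ : 𝓢(Space N, ℂ)) : 𝓢(Space N, ℂ) →L[ℂ] 𝓢(Space N, ℂ) :=
  (SchwartzMap.convolution (ContinuousLinearMap.mul ℂ ℂ) ψ).comp
    ((FourierTransform.fourierInvCLM ℂ 𝓢(Space N, ℂ)).comp (symbolS j))

theorem mulOpSymbol_apply (j : ℤ) (m ψ : 𝓢(Space N, ℂ)) : mulOpSymbol j ψ m = mulOp j m ψ :=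
  (mulOp_eq_convolution j m ψ).symm

theorem mulOp_comm (i j : ℤ) (m m' ψ : 𝓢(Space N, ℂ)) :
    mulOp i m (mulOp j m' ψ) = mulOp j m' (mulOp i m ψ) := by
  refine ext_fourier fun ξ => ?_
  simp only [fourier_mulOp]
  ring

/-- The Laplacian of Schwartz functions. -/
noncomputable abbrev lapS : 𝓢(Space N, ℂ) →L[ℂ] 𝓢(Space N, ℂ) :=
  LineDeriv.laplacianCLM ℂ (Space N) 𝓢(Space N, ℂ)

theorem hasTemperateGrowth_normSq :
    (fun x : Space N => (RCLike.ofReal (K := ℂ) ((‖·‖ ^ 2 : Space N → ℝ) x))).HasTemperateGrowth := by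
  have : (‖·‖ ^ 2 : Space N → ℝ).HasTemperateGrowth := by fun_prop
  exact (Function.RCLike.hasTemperateGrowth_ofReal (𝕜 := ℂ)).comp this

theorem fourier_lapS (ψ : 𝓢(Space N, ℂ)) (ξ : Space N) :
    (𝓕 (lapS ψ) : 𝓢(Space N, ℂ)) ξ =
      -((2 * Real.pi) ^ 2 * ‖ξ‖ ^ 2 : ℝ) * (𝓕 ψ : 𝓢(Space N, ℂ)) ξ := by
  rw [lapS, SchwartzMap.laplacianCLM_eq, SchwartzMap.laplacian_eq_fourierMultiplierCLM,
    ← SchwartzMap.fourierMultiplierCLM_ofReal ℂ (by fun_prop), ← Complex.coe_smul,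
    FourierTransform.fourier_smul]
  have h := congrFun (fourier_multiplier (hasTemperateGrowth_normSq (N := N)) ψ) ξ
  rw [smul_apply, h]
  simp
  ring

theorem lapS_mulOp (j : ℤ) (m ψ : 𝓢(Space N, ℂ)) : lapS (mulOp j m ψ) = mulOp j m (lapS ψ) := by
  refine ext_fourier fun ξ => ?_
  simp only [fourier_mulOp, fourier_lapS]
  ring

/-- The symbol `-|η|² m(η)`. -/
noncomputable def lapSymbol : 𝓢(Space N, ℂ) →L[ℂ] 𝓢(Space N, ℂ) :=
  -SchwartzMap.smulLeftCLM ℂ (fun x : Space N => (RCLike.ofReal (K := ℂ) ((‖·‖ ^ 2 : Space N → ℝ) x)))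

theorem lapSymbol_apply (m : 𝓢(Space N, ℂ)) (η : Space N) :
    lapSymbol m η = -((‖η‖ ^ 2 : ℝ) * m η) := by
  have := SchwartzMap.smulLeftCLM_apply_apply (hasTemperateGrowth_normSq (N := N)) m η
  rw [lapSymbol, neg_apply, neg_apply, this]
  simp

/-- In the variable η = 2^{-j} · 2πξ the symbol -|2πξ|² of the Laplacian is -4^j |η|², so Δ costs a
factor 4^j on a block. -/
theorem mulOp_lapS (j : ℤ) (m ψ : 𝓢(Space N, ℂ)) :
    mulOp j m (lapS ψ) = ((4 : ℝ) ^ j : ℂ) • mulOp j (lapSymbol m) ψ := by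
  refine ext_fourier fun ξ => ?_
  rw [FourierTransform.fourier_smul, smul_apply]
  simp only [fourier_mulOp, fourier_lapS, symbol, lapSymbol_apply, smul_eq_mul]
  have h : (4 : ℝ) ^ j * ‖(2 : ℝ) ^ (-j) • (2 * Real.pi) • ξ‖ ^ 2
      = (2 * Real.pi) ^ 2 * ‖ξ‖ ^ 2 := by
    rw [norm_smul, norm_smul, norm_zpow, Real.norm_of_nonneg (by positivity : (0:ℝ) ≤ 2 * Real.pi),
      mul_pow, mul_pow, Real.norm_ofNat, ← zpow_natCast, ← zpow_mul, show (4 : ℝ) = 2 ^ (2 : ℤ) by norm_num,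
      ← zpow_mul, ← mul_assoc, ← zpow_add₀ two_ne_zero]
    simp only [Nat.cast_ofNat]
    rw [show 2 * j + -j * 2 = 0 by ring, zpow_zero, one_mul]
  have h' := congrArg (fun x : ℝ => (x : ℂ)) h
  rw [← h]
  push_cast
  ring

end Multiplier

/-! ### The fattened Littlewood-Paley function, equal to 1 on the support of φ. -/

section Fat

variable {N : ℕ} {φ : 𝓢(Space N, ℂ)}

/-- The sum of three neighbouring Littlewood-Paley functions. -/
noncomputable def fat (φ : 𝓢(Space N, ℂ)) : 𝓢(Space N, ℂ) :=
  dilation 2 two_ne_zero φ + φ + dilation (1 / 2) (by norm_num) φ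

theorem fat_apply (φ : 𝓢(Space N, ℂ)) (η : Space N) :
    fat φ η = φ ((2 : ℝ) • η) + φ η + φ ((1 / 2 : ℝ) • η) := rfl

theorem symbol_ne_zero_norm (hφ : IsLittlewoodPaley φ) {j : ℤ} {ξ : Space N}
    (h : symbol φ j ξ ≠ 0) :
    3 / 4 * (2 : ℝ) ^ j ≤ ‖(2 * Real.pi) • ξ‖ ∧ ‖(2 * Real.pi) • ξ‖ ≤ 8 / 3 * (2 : ℝ) ^ j := by
  have h1 := hφ.supp _ h
  have h2 : (0 : ℝ) < 2 ^ j := by positivity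
  rw [norm_smul, Real.norm_of_nonneg (by positivity), zpow_neg, inv_mul_eq_div] at h1
  rw [le_div_iff₀ h2, div_le_iff₀ h2] at h1
  exact h1

/-- The annuli are disjoint: 8/3 · 2^i < 3/4 · 2^{i+2}. -/
theorem symbol_mul_symbol_eq_zero (hφ : IsLittlewoodPaley φ) {i j : ℤ} (h : i + 2 ≤ j)
    (ξ : Space N) : symbol φ i ξ * symbol φ j ξ = 0 := by
  by_contra h0
  obtain ⟨hi, hj⟩ := mul_ne_zero_iff.1 h0
  have h1 := (symbol_ne_zero_norm hφ hi).2
  have h2 := (symbol_ne_zero_norm hφ hj).1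
  have h3 : (2 : ℝ) ^ (i + 2) ≤ 2 ^ j := zpow_le_zpow_right₀ one_le_two h
  rw [zpow_add₀ two_ne_zero] at h3
  have h4 : (0 : ℝ) < 2 ^ i := by positivity
  norm_num at h3
  linarith

theorem symbol_mul_symbol_eq_zero' (hφ : IsLittlewoodPaley φ) {i j : ℤ}
    (h : i ∉ ({j - 1, j, j + 1} : Finset ℤ)) (ξ : Space N) :
    symbol φ i ξ * symbol φ j ξ = 0 := by
  simp only [Finset.mem_insert, Finset.mem_singleton, not_or] at h
  rcases le_or_gt (i + 2) j with h1 | h1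
  · exact symbol_mul_symbol_eq_zero hφ h1 ξ
  · rw [mul_comm]
    exact symbol_mul_symbol_eq_zero hφ (by omega) ξ

theorem symbol_fat (φ : 𝓢(Space N, ℂ)) (j : ℤ) (ξ : Space N) :
    symbol (fat φ) j ξ = ∑ i ∈ ({j - 1, j, j + 1} : Finset ℤ), symbol φ i ξ := by
  rw [Finset.sum_insert (by simp; omega), Finset.sum_insert (by simp), Finset.sum_singleton]
  have h1 : (2 : ℝ) ^ (-(j - 1)) = 2 * 2 ^ (-j) := by
    rw [neg_sub, sub_eq_add_neg, zpow_add₀ two_ne_zero, zpow_one]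
  have h2 : (2 : ℝ) ^ (-(j + 1)) = 1 / 2 * 2 ^ (-j) := by
    rw [neg_add, zpow_add₀ two_ne_zero, zpow_neg_one]; ring
  simp only [symbol, fat_apply, h1, h2, mul_smul, add_assoc]

theorem hasSum_symbol (hφ : IsLittlewoodPaley φ) {ξ : Space N} (hξ : ξ ≠ 0) :
    HasSum (fun q : ℤ => symbol φ q ξ) 1 :=
  hφ.sum_eq_one _ (smul_ne_zero (by positivity) hξ)

/-- Where the j-th symbol is nonzero only its two neighbours can be nonzero too, so those three
terms carry the whole partition of unity. -/
theorem symbol_fat_mul (hφ : IsLittlewoodPaley φ) (j : ℤ) (ξ : Space N) :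
    symbol (fat φ) j ξ * symbol φ j ξ = symbol φ j ξ := by
  rcases eq_or_ne (symbol φ j ξ) 0 with h0 | h0
  · simp [h0]
  have hξ : ξ ≠ 0 := by
    rintro rfl
    have := (symbol_ne_zero_norm hφ h0).1
    have h4 : (0 : ℝ) < 2 ^ j := by positivity
    simp at this
    linarith
  have hs : HasSum (fun q : ℤ => symbol φ q ξ)
      (∑ i ∈ ({j - 1, j, j + 1} : Finset ℤ), symbol φ i ξ) := by
    refine hasSum_sum_of_ne_finset_zero fun i hi => ?_
    have := symbol_mul_symbol_eq_zero' hφ hi ξ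
    exact (mul_eq_zero.1 this).resolve_right h0
  rw [symbol_fat, hs.unique (hasSum_symbol hφ hξ), one_mul]

theorem fat_ne_zero_norm (hφ : IsLittlewoodPaley φ) {η : Space N} (h : fat φ η ≠ 0) :
    9 / 64 ≤ ‖η‖ ^ 2 ∧ ‖η‖ ^ 2 ≤ 256 / 9 := by
  -- The annulus of φ widened by a factor 2 on each side; squared, because symbols are handled as
  -- functions of |η|².
  suffices 3 / 8 ≤ ‖η‖ ∧ ‖η‖ ≤ 16 / 3 by
    constructor <;> nlinarith
  by_contra hc
  apply h
  have key : ∀ a : ℝ, 1 / 2 ≤ a → a ≤ 2 → φ (a • η) = 0 := by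
    intro a h1 h2
    by_contra h0
    have := hφ.supp _ h0
    rw [norm_smul, Real.norm_of_nonneg (by linarith)] at this
    apply hc
    have := norm_nonneg η
    constructor <;> nlinarith
  have h1 := key 1 (by norm_num) (by norm_num)
  rw [one_smul] at h1
  rw [fat_apply, h1, key 2 (by norm_num) le_rfl, key (1 / 2) le_rfl (by norm_num)]
  simp

theorem mulOp_fat (φ ψ : 𝓢(Space N, ℂ)) (j : ℤ) :
    mulOp j (fat φ) ψ = ∑ i ∈ ({j - 1, j, j + 1} : Finset ℤ), mulOp i φ ψ := by
  refine ext_fourier fun ξ => ?_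
  rw [FourierTransform.fourier_sum]
  simp only [_root_.sum_apply, fourier_mulOp, symbol_fat, Finset.sum_mul]

theorem mulOp_fat_block (hφ : IsLittlewoodPaley φ) (ψ : 𝓢(Space N, ℂ)) (j : ℤ) :
    mulOp j φ (mulOp j (fat φ) ψ) = mulOp j φ ψ := by
  refine ext_fourier fun ξ => ?_
  simp only [fourier_mulOp]
  rw [← mul_assoc, mul_comm (symbol φ j ξ), symbol_fat_mul hφ]

end Fat

/-! ### Schwartz seminorms of radial multiples g(|η|²) χ(η). -/

section Radial

variable {N : ℕ} {χ : 𝓢(Space N, ℂ)}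

/-- The Schwartz function `g(|η|²) χ(η)`, for `χ` of compact support. -/
noncomputable def radMul (hχ : HasCompactSupport χ) (g : ℝ → ℂ) (hg : ContDiff ℝ (⊤ : ℕ∞) g) :
    𝓢(Space N, ℂ) :=
  HasCompactSupport.toSchwartzMap (f := fun η => g (‖η‖ ^ 2) * χ η)
    (HasCompactSupport.mul_left hχ)
    ((hg.comp (contDiff_norm_sq ℝ)).mul (χ.smooth (⊤ : ℕ∞)))

theorem radMul_apply (hχ : HasCompactSupport χ) (g : ℝ → ℂ) (hg : ContDiff ℝ (⊤ : ℕ∞) g)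
    (η : Space N) : radMul hχ g hg η = g (‖η‖ ^ 2) * χ η := rfl

theorem exists_norm_iteratedFDeriv_normSq_le (b : ℝ) (n : ℕ) :
    ∃ D : ℝ, 1 ≤ D ∧ ∀ i ≤ n, ∀ x : Space N, ‖x‖ ^ 2 ≤ b →
      ‖iteratedFDeriv ℝ i (fun x : Space N => ‖x‖ ^ 2) x‖ ≤ D := by
  have h : ∀ i : ℕ, ∃ D : ℝ, ∀ x : Space N, ‖x‖ ^ 2 ≤ b →
      ‖iteratedFDeriv ℝ i (fun x : Space N => ‖x‖ ^ 2) x‖ ≤ D := by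
    intro i
    have hc : Continuous (iteratedFDeriv ℝ i (fun x : Space N => ‖x‖ ^ 2)) :=
      (contDiff_norm_sq ℝ (n := (⊤ : ℕ∞))).continuous_iteratedFDeriv (by exact_mod_cast le_top)
    obtain ⟨D, hD⟩ := (isCompact_closedBall (0 : Space N) (Real.sqrt b)).exists_bound_of_continuousOn
      hc.continuousOn
    refine ⟨D, fun x hx => hD x ?_⟩
    rw [mem_closedBall_zero_iff]
    exact Real.le_sqrt_of_sq_le hx
  choose D hD using h
  refine ⟨1 + ∑ i ∈ Finset.range (n + 1), |D i|, ?_, fun i hi x hx => ?_⟩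
  · have := Finset.sum_nonneg (s := Finset.range (n + 1)) (f := fun i => |D i|) fun i _ => abs_nonneg _
    linarith
  · have := Finset.single_le_sum (s := Finset.range (n + 1)) (f := fun i => |D i|)
      (fun i _ => abs_nonneg _) (Finset.mem_range.2 (Nat.lt_succ_of_le hi))
    have h2 := hD i x hx
    have h3 := le_abs_self (D i)
    linarith

/-- Leibniz' rule and the chain rule bound derivatives of the product on the shell by those of g on
[a, b]; off the shell the product vanishes locally. The constant does not depend on g, which permits
families of g with a parameter such as time. -/
theorem exists_seminorm_radMul_le (hχ : HasCompactSupport χ) {a b : ℝ}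
    (hab : ∀ η, χ η ≠ 0 → a ≤ ‖η‖ ^ 2 ∧ ‖η‖ ^ 2 ≤ b) (k n : ℕ) :
    ∃ C : ℝ, 0 ≤ C ∧ ∀ (g : ℝ → ℂ) (hg : ContDiff ℝ (⊤ : ℕ∞) g) (A : ℝ), 0 ≤ A →
      (∀ i ≤ n, ∀ r ∈ Icc a b, ‖iteratedDeriv i g r‖ ≤ A) →
      SchwartzMap.seminorm ℝ k n (radMul hχ g hg) ≤ C * A := by
  obtain ⟨D, hD1, hD⟩ := exists_norm_iteratedFDeriv_normSq_le (N := N) b n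
  refine ⟨∑ i ∈ Finset.range (n + 1), (n.choose i : ℝ) * (i.factorial * D ^ i) *
    SchwartzMap.seminorm ℝ k (n - i) χ, ?_, fun g hg A hA hgA => ?_⟩
  · refine Finset.sum_nonneg fun i _ => ?_
    have : 0 ≤ SchwartzMap.seminorm ℝ k (n - i) χ := apply_nonneg _ _
    positivity
  have hC0 : 0 ≤ (∑ i ∈ Finset.range (n + 1), (n.choose i : ℝ) * (i.factorial * D ^ i) *
    SchwartzMap.seminorm ℝ k (n - i) χ) * A := by
    refine mul_nonneg (Finset.sum_nonneg fun i _ => ?_) hA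
    have : 0 ≤ SchwartzMap.seminorm ℝ k (n - i) χ := apply_nonneg _ _
    positivity
  refine SchwartzMap.seminorm_le_bound ℝ k n _ hC0 fun x => ?_
  by_cases hx : a ≤ ‖x‖ ^ 2 ∧ ‖x‖ ^ 2 ≤ b
  · have hsq : ContDiff ℝ (⊤ : ℕ∞) fun x : Space N => ‖x‖ ^ 2 := contDiff_norm_sq ℝ
    have h1 := norm_iteratedFDeriv_mul_le (n := n) (N := ((⊤ : ℕ∞) : WithTop ℕ∞))
      (hg.comp hsq) (χ.smooth (⊤ : ℕ∞)) x (by exact_mod_cast le_top)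
    have h2 : ∀ i ≤ n, ‖iteratedFDeriv ℝ i (g ∘ fun x : Space N => ‖x‖ ^ 2) x‖
        ≤ i.factorial * A * D ^ i := by
      intro i hi
      refine norm_iteratedFDeriv_comp_le hg hsq (by exact_mod_cast le_top) x
        (fun l hl => ?_) (fun l hl1 hl => ?_)
      · rw [norm_iteratedFDeriv_eq_norm_iteratedDeriv]
        exact hgA l (hl.trans hi) _ hx
      · exact (hD l (hl.trans hi) x hx.2).trans (le_self_pow₀ hD1 (by omega))
    calc ‖x‖ ^ k * ‖iteratedFDeriv ℝ n (radMul hχ g hg) x‖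
        ≤ ‖x‖ ^ k * ∑ i ∈ Finset.range (n + 1), (n.choose i : ℝ) *
            ‖iteratedFDeriv ℝ i (g ∘ fun x : Space N => ‖x‖ ^ 2) x‖ *
            ‖iteratedFDeriv ℝ (n - i) χ x‖ := by
          gcongr
          exact h1
      _ = ∑ i ∈ Finset.range (n + 1), (n.choose i : ℝ) *
            ‖iteratedFDeriv ℝ i (g ∘ fun x : Space N => ‖x‖ ^ 2) x‖ *
            (‖x‖ ^ k * ‖iteratedFDeriv ℝ (n - i) χ x‖) := by
          rw [Finset.mul_sum]
          exact Finset.sum_congr rfl fun i _ => by ring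
      _ ≤ ∑ i ∈ Finset.range (n + 1), (n.choose i : ℝ) * (i.factorial * A * D ^ i) *
            SchwartzMap.seminorm ℝ k (n - i) χ := by
          refine Finset.sum_le_sum fun i hi => ?_
          have := h2 i (Nat.lt_succ_iff.1 (Finset.mem_range.1 hi))
          have h3 := SchwartzMap.le_seminorm ℝ k (n - i) χ x
          gcongr
      _ = _ := by
          rw [Finset.sum_mul]
          exact Finset.sum_congr rfl fun i _ => by ring
  · have hopen : IsOpen {y : Space N | ¬ (a ≤ ‖y‖ ^ 2 ∧ ‖y‖ ^ 2 ≤ b)} := by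
      have hc : Continuous fun y : Space N => ‖y‖ ^ 2 := by fun_prop
      have h1 : IsClosed {y : Space N | a ≤ ‖y‖ ^ 2 ∧ ‖y‖ ^ 2 ≤ b} :=
        (isClosed_le continuous_const hc).inter (isClosed_le hc continuous_const)
      exact h1.isOpen_compl
    have h0 : (radMul hχ g hg : Space N → ℂ) =ᶠ[𝓝 x] 0 := by
      filter_upwards [hopen.mem_nhds hx] with y hy
      rw [radMul_apply]
      have : χ y = 0 := by
        by_contra h
        exact hy (hab y h)
      simp [this]
    have h1 := (h0.iteratedFDeriv ℝ n).eq_of_nhds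
    rw [h1, iteratedFDeriv_zero]
    simpa using hC0

theorem exists_sup_seminorm_radMul_le (hχ : HasCompactSupport χ) {a b : ℝ}
    (hab : ∀ η, χ η ≠ 0 → a ≤ ‖η‖ ^ 2 ∧ ‖η‖ ^ 2 ≤ b) (s : Finset (ℕ × ℕ)) :
    ∃ (C : ℝ) (n : ℕ), 0 ≤ C ∧ ∀ (g : ℝ → ℂ) (hg : ContDiff ℝ (⊤ : ℕ∞) g) (A : ℝ), 0 ≤ A →
      (∀ i ≤ n, ∀ r ∈ Icc a b, ‖iteratedDeriv i g r‖ ≤ A) →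
      (s.sup (schwartzSeminormFamily ℝ (Space N) ℂ)) (radMul hχ g hg) ≤ C * A := by
  choose C hC0 hC using fun kn : ℕ × ℕ => exists_seminorm_radMul_le hχ hab kn.1 kn.2
  refine ⟨∑ i ∈ s, C i, s.sup Prod.snd, Finset.sum_nonneg fun i _ => hC0 i, fun g hg A hA h => ?_⟩
  have hS : 0 ≤ ∑ i ∈ s, C i := Finset.sum_nonneg fun i _ => hC0 i
  refine Seminorm.finset_sup_apply_le (by positivity) fun kn hkn => ?_
  refine (hC kn g hg A hA fun i hi => h i (hi.trans (Finset.le_sup (f := Prod.snd) hkn))).trans ?_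
  gcongr
  exact Finset.single_le_sum (f := C) (fun i _ => hC0 i) hkn

end Radial

/-! ### Derivatives of complex exponentials on a compact interval. -/

section ExpDeriv

theorem contDiff_cexp_mul (z : ℂ) : ContDiff ℝ (⊤ : ℕ∞) fun r : ℝ => Complex.exp (z * r) :=
  (contDiff_const.mul Complex.ofRealCLM.contDiff).cexp

theorem hasDerivAt_cexp_mul (z : ℂ) (r : ℝ) :
    HasDerivAt (fun r : ℝ => Complex.exp (z * r)) (z * Complex.exp (z * r)) r := by
  have h := (((hasDerivAt_id (r : ℂ)).const_mul z).cexp).comp_ofReal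
  simpa [mul_comm] using h

theorem iteratedDeriv_cexp_mul (z : ℂ) (i : ℕ) :
    iteratedDeriv i (fun r : ℝ => Complex.exp (z * r)) = fun r : ℝ => z ^ i * Complex.exp (z * r) := by
  induction i with
  | zero => simp
  | succ i ih =>
    rw [iteratedDeriv_succ, ih]
    ext r
    rw [((hasDerivAt_cexp_mul z r).const_mul (z ^ i)).deriv]
    ring

/-- The second-order Taylor remainder is quadratic in z together with all its r-derivatives: b², 2b
and 3 come from derivatives of order 0, 1 and at least 2. -/
theorem norm_iteratedDeriv_cexp_remainder_le {z : ℂ} {b r : ℝ} (hz : ‖z‖ ≤ 1) (hzb : ‖z‖ * b ≤ 1)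
    (hr : 0 ≤ r) (hrb : r ≤ b) (i : ℕ) :
    ‖iteratedDeriv i (fun r : ℝ => Complex.exp (z * r) - 1 - z * r) r‖ ≤
      (b ^ 2 + 2 * b + 3) * ‖z‖ ^ 2 := by
  have hb : 0 ≤ b := hr.trans hrb
  have hz0 := norm_nonneg z
  have hzr : ‖z * r‖ ≤ ‖z‖ * b := by
    rw [norm_mul, Complex.norm_real, Real.norm_of_nonneg hr]
    gcongr
  have hzr1 : ‖z * r‖ ≤ 1 := hzr.trans hzb
  have hz2 : 0 ≤ ‖z‖ ^ 2 := by positivity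
  have d1 : deriv (fun r : ℝ => Complex.exp (z * r) - 1 - z * r)
      = fun r : ℝ => z * (Complex.exp (z * r) - 1) := by
    ext x
    have h1 : HasDerivAt (fun r : ℝ => z * (r : ℂ)) z x := by
      simpa using (Complex.ofRealCLM.hasDerivAt (x := x)).const_mul z
    refine (((hasDerivAt_cexp_mul z x).sub_const 1).sub h1).deriv.trans ?_
    ring
  have d2 : deriv (fun r : ℝ => z * (Complex.exp (z * r) - 1))
      = fun r : ℝ => z ^ 2 * Complex.exp (z * r) := by
    ext x
    rw [(((hasDerivAt_cexp_mul z x).sub_const 1).const_mul z).deriv]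
    ring
  rcases i with _ | _ | i
  · rw [iteratedDeriv_zero]
    refine (Complex.norm_exp_sub_one_sub_id_le hzr1).trans ?_
    calc ‖z * r‖ ^ 2 ≤ (‖z‖ * b) ^ 2 := by gcongr
      _ ≤ _ := by nlinarith
  · rw [iteratedDeriv_succ', iteratedDeriv_zero, d1, norm_mul]
    have := Complex.norm_exp_sub_one_le hzr1
    calc ‖z‖ * ‖Complex.exp (z * r) - 1‖ ≤ ‖z‖ * (2 * (‖z‖ * b)) := by gcongr; linarith
      _ ≤ _ := by nlinarith
  · rw [iteratedDeriv_succ', iteratedDeriv_succ', d1, d2]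
    rw [iteratedDeriv_const_mul_field, iteratedDeriv_cexp_mul, norm_mul, norm_mul, norm_pow, norm_pow]
    have h1 : ‖Complex.exp (z * r)‖ ≤ 3 := by
      refine (Complex.norm_exp_le_exp_norm _).trans ((Real.exp_le_exp.2 hzr1).trans ?_)
      exact Real.exp_one_lt_three.le
    have h2 : ‖z‖ ^ i ≤ 1 := pow_le_one₀ hz0 hz
    calc ‖z‖ ^ 2 * (‖z‖ ^ i * ‖Complex.exp (z * r)‖) ≤ ‖z‖ ^ 2 * (1 * 3) := by gcongr
      _ ≤ _ := by nlinarith [mul_nonneg hb hz2, mul_nonneg (sq_nonneg b) hz2]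

/-- Each derivative brings down a factor κτ. The available decay is exp(-2cτ); half of it absorbs
the powers of τ through (cτ)^i ≤ i! exp(cτ). -/
theorem norm_iteratedDeriv_cexp_le {κ : ℂ} {a c τ r : ℝ} (hc : 0 < c) (hκ : 2 * c ≤ κ.re * a)
    (hκ0 : 0 ≤ κ.re) (hτ : 0 ≤ τ) (hr : a ≤ r) (i : ℕ) :
    ‖iteratedDeriv i (fun r : ℝ => Complex.exp (-(κ * τ) * r)) r‖ ≤
      (‖κ‖ / c) ^ i * i.factorial * Real.exp (-(c * τ)) := by
  rw [iteratedDeriv_cexp_mul]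
  simp only [norm_mul, norm_pow, norm_neg, Complex.norm_real, Real.norm_of_nonneg hτ, Complex.norm_exp]
  have h1 : (-(κ * τ) * r).re = -(κ.re * τ * r) := by simp
  rw [h1]
  have h2 := Real.pow_div_factorial_le_exp (c * τ) (by positivity) i
  rw [div_le_iff₀ (by positivity)] at h2
  have h3 : 2 * (c * τ) ≤ κ.re * τ * r := by
    have : κ.re * a * τ ≤ κ.re * r * τ := by gcongr
    nlinarith
  calc (‖κ‖ * τ) ^ i * Real.exp (-(κ.re * τ * r))
      = (‖κ‖ / c) ^ i * (c * τ) ^ i * Real.exp (-(κ.re * τ * r)) := by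
        rw [← mul_pow]; congr 2; field_simp
    _ ≤ (‖κ‖ / c) ^ i * (Real.exp (c * τ) * i.factorial) * Real.exp (-(2 * (c * τ))) := by
        gcongr
    _ = _ := by
        rw [show -(2 * (c * τ)) = -(c * τ) + -(c * τ) by ring, Real.exp_add, Real.exp_neg]
        have := Real.exp_pos (c * τ)
        field_simp

end ExpDeriv

/-! ### The localized heat flow with complex viscosity. -/

section Heat

variable {N : ℕ} {φ : 𝓢(Space N, ℂ)}

theorem hasCompactSupport_of_norm_sq_le {χ : 𝓢(Space N, ℂ)} {b : ℝ}
    (h : ∀ η, χ η ≠ 0 → ‖η‖ ^ 2 ≤ b) : HasCompactSupport χ := by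
  refine HasCompactSupport.intro (isCompact_closedBall (0 : Space N) (Real.sqrt b)) fun x hx => ?_
  by_contra h0
  exact hx (mem_closedBall_zero_iff.2 (Real.le_sqrt_of_sq_le (h x h0)))

theorem fat_hasCompactSupport (hφ : IsLittlewoodPaley φ) : HasCompactSupport (fat φ) :=
  hasCompactSupport_of_norm_sq_le fun _ h => (fat_ne_zero_norm hφ h).2

/-- The symbol `exp(-κ τ |η|²)`, localized to the annulus where `fat φ` lives. -/
noncomputable def heatSym (hφ : IsLittlewoodPaley φ) (κ : ℂ) (τ : ℝ) : 𝓢(Space N, ℂ) :=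
  radMul (fat_hasCompactSupport hφ) (fun r : ℝ => Complex.exp (-(κ * τ) * r)) (contDiff_cexp_mul _)

theorem heatSym_apply (hφ : IsLittlewoodPaley φ) (κ : ℂ) (τ : ℝ) (η : Space N) :
    heatSym hφ κ τ η = Complex.exp (-(κ * τ) * (‖η‖ ^ 2 : ℝ)) * fat φ η := rfl

theorem heatSym_zero (hφ : IsLittlewoodPaley φ) (κ : ℂ) : heatSym hφ κ 0 = fat φ := by
  ext η
  simp [heatSym_apply]

theorem heatSym_ne_zero_norm (hφ : IsLittlewoodPaley φ) {κ : ℂ} {τ : ℝ} {η : Space N}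
    (h : heatSym hφ κ τ η ≠ 0) : 9 / 64 ≤ ‖η‖ ^ 2 ∧ ‖η‖ ^ 2 ≤ 256 / 9 :=
  fat_ne_zero_norm hφ (right_ne_zero_of_mul h)

theorem exists_kernelNorm_heatSym_le (hφ : IsLittlewoodPaley φ) {κ : ℂ} (hκ : 0 < κ.re) :
    ∃ C c : ℝ, 0 < C ∧ 0 < c ∧ ∀ τ : ℝ, 0 ≤ τ →
      kernelNorm (heatSym hφ κ τ) ≤ ENNReal.ofReal (C * Real.exp (-(c * τ))) := by
  obtain ⟨s, C₀, hC₀, h⟩ := exists_kernelNorm_le (N := N)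
  obtain ⟨C₁, n, hC₁, h₁⟩ := exists_sup_seminorm_radMul_le (fat_hasCompactSupport hφ)
    (fun η h => fat_ne_zero_norm hφ h) s
  -- 9/64 is the least value of |η|² on the support of `fat φ`; half of the decay rate is given up
  -- to control the derivatives of the symbol.
  set c : ℝ := κ.re * (9 / 64) / 2 with hcdef
  have hc : 0 < c := by positivity
  set B : ℝ := ∑ i ∈ Finset.range (n + 1), (‖κ‖ / c) ^ i * i.factorial with hB
  have hB0 : 0 ≤ B := Finset.sum_nonneg fun i _ => by positivity
  refine ⟨C₀ * (C₁ * B) + 1, c, by positivity, hc, fun τ hτ => (h _).trans ?_⟩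
  apply ENNReal.ofReal_le_ofReal
  have h2 := h₁ _ (contDiff_cexp_mul (-(κ * τ))) (B * Real.exp (-(c * τ))) (by positivity)
    (fun i hi r hr => ?_)
  · calc C₀ * _ ≤ C₀ * (C₁ * (B * Real.exp (-(c * τ)))) := by gcongr; exact h2
      _ = C₀ * (C₁ * B) * Real.exp (-(c * τ)) := by ring
      _ ≤ _ := by gcongr; linarith
  · refine (norm_iteratedDeriv_cexp_le hc (by rw [hcdef]; linarith) hκ.le hτ hr.1 i).trans ?_
    gcongr
    exact Finset.single_le_sum (f := fun i => (‖κ‖ / c) ^ i * (i.factorial : ℝ))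
      (fun i _ => by positivity) (Finset.mem_range.2 (Nat.lt_succ_of_le hi))

theorem exists_seminorm_heatSym_remainder_le (hφ : IsLittlewoodPaley φ) (κ : ℂ) (τ : ℝ)
    (s : Finset (ℕ × ℕ)) : ∃ C δ : ℝ, 0 < δ ∧ ∀ h : ℝ, |h| ≤ δ →
      (s.sup (schwartzSeminormFamily ℝ (Space N) ℂ))
        (heatSym hφ κ (τ + h) - heatSym hφ κ τ - (h : ℂ) • κ • lapSymbol (heatSym hφ κ τ))
      ≤ C * h ^ 2 := by
  have hcs : HasCompactSupport (heatSym hφ κ τ) :=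
    hasCompactSupport_of_norm_sq_le fun _ h => (heatSym_ne_zero_norm hφ h).2
  obtain ⟨C, n, hC, h₁⟩ := exists_sup_seminorm_radMul_le hcs
    (fun η h => heatSym_ne_zero_norm hφ h) s
  set b : ℝ := 256 / 9
  set δ : ℝ := (1 + ‖κ‖)⁻¹ * b⁻¹ with hδ
  have hκ := norm_nonneg κ
  refine ⟨C * ((b ^ 2 + 2 * b + 3) * ‖κ‖ ^ 2), δ, by positivity, fun h hh => ?_⟩
  have hz : ‖-(κ * h)‖ * b ≤ 1 := by
    rw [norm_neg, norm_mul, Complex.norm_real, Real.norm_eq_abs]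
    calc ‖κ‖ * |h| * b ≤ (1 + ‖κ‖) * δ * b := by gcongr; linarith
      _ = 1 := by
        have : b ≠ 0 := by norm_num [b]
        rw [hδ]; field_simp
  have hz1 : ‖-(κ * h)‖ ≤ 1 := by
    have : (1 : ℝ) ≤ b := by norm_num [b]
    nlinarith [norm_nonneg (-(κ * h))]
  -- The symbol at time τ factors out of the increment: what remains is the Taylor remainder of
  -- exp(-κ h r) at r = |η|².
  have hg : ContDiff ℝ (⊤ : ℕ∞) fun r : ℝ => Complex.exp (-(κ * h) * r) - 1 - -(κ * h) * r :=
    ((contDiff_cexp_mul _).sub contDiff_const).sub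
      (contDiff_const.mul Complex.ofRealCLM.contDiff)
  have key := h₁ _ hg ((b ^ 2 + 2 * b + 3) * ‖-(κ * h)‖ ^ 2) (by positivity) fun i hi r hr =>
    norm_iteratedDeriv_cexp_remainder_le hz1 hz (by linarith [hr.1]) hr.2 i
  have e : heatSym hφ κ (τ + h) - heatSym hφ κ τ - (h : ℂ) • κ • lapSymbol (heatSym hφ κ τ)
      = radMul hcs _ hg := by
    ext η
    rw [radMul_apply]
    simp only [sub_apply, smul_apply, lapSymbol_apply, heatSym_apply,
      smul_eq_mul]
    have : Complex.exp (-(κ * ((τ + h : ℝ) : ℂ)) * (‖η‖ ^ 2 : ℝ))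
        = Complex.exp (-(κ * h) * (‖η‖ ^ 2 : ℝ)) * Complex.exp (-(κ * τ) * (‖η‖ ^ 2 : ℝ)) := by
      rw [← Complex.exp_add]
      congr 1
      push_cast
      ring
    rw [this]
    ring
  rw [e]
  refine key.trans (le_of_eq ?_)
  rw [norm_neg, norm_mul, Complex.norm_real, Real.norm_eq_abs, mul_pow, sq_abs]
  ring

/-- A functional u on 𝓢 is controlled by finitely many seminorms, in each of which the remainder is
O(h²). -/
theorem hasDerivAt_heatSym (hφ : IsLittlewoodPaley φ) (κ : ℂ) (τ : ℝ) (u : 𝓢(Space N, ℂ) →L[ℂ] ℂ) :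
    HasDerivAt (fun τ : ℝ => u (heatSym hφ κ τ)) (κ * u (lapSymbol (heatSym hφ κ τ))) τ := by
  have hc : Continuous ((normSeminorm ℝ ℂ).comp (u.restrictScalars ℝ).toLinearMap) :=
    continuous_norm.comp u.continuous
  obtain ⟨s, C, -, hu⟩ := Seminorm.bound_of_continuous
    (schwartz_withSeminorms ℝ (Space N) ℂ) _ hc
  obtain ⟨C', δ, hδ, h⟩ := exists_seminorm_heatSym_remainder_le hφ κ τ s
  rw [hasDerivAt_iff_isLittleO_nhds_zero]
  refine Asymptotics.IsBigO.trans_isLittleO (g := fun h : ℝ => h ^ 2) ?_ ?_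
  · refine Asymptotics.IsBigO.of_bound (C * C') ?_
    filter_upwards [Metric.ball_mem_nhds (0 : ℝ) hδ] with t ht
    rw [mem_ball_zero_iff, Real.norm_eq_abs] at ht
    have h1 := hu (heatSym hφ κ (τ + t) - heatSym hφ κ τ - (t : ℂ) • κ • lapSymbol (heatSym hφ κ τ))
    have h2 : ‖u (heatSym hφ κ (τ + t) - heatSym hφ κ τ
        - (t : ℂ) • κ • lapSymbol (heatSym hφ κ τ))‖ ≤ C * _ := h1
    have h3 : u (heatSym hφ κ (τ + t)) - u (heatSym hφ κ τ)
        - t • (κ * u (lapSymbol (heatSym hφ κ τ))) =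
        u (heatSym hφ κ (τ + t) - heatSym hφ κ τ - (t : ℂ) • κ • lapSymbol (heatSym hφ κ τ)) := by
      simp
    rw [h3, Real.norm_of_nonneg (by positivity), mul_assoc]
    exact h2.trans (mul_le_mul_of_nonneg_left (h t ht.le) C.2)
  · have := Asymptotics.isLittleO_pow_pow (𝕜 := ℝ) (one_lt_two : 1 < 2)
    simpa using this

theorem continuous_heatSym (hφ : IsLittlewoodPaley φ) (κ : ℂ) : Continuous (heatSym hφ κ) := by
  rw [continuous_iff_continuousAt]
  intro τ
  have h0 : Tendsto (fun h : ℝ => heatSym hφ κ (τ + h) - heatSym hφ κ τ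
      - (h : ℂ) • κ • lapSymbol (heatSym hφ κ τ)) (𝓝 0) (𝓝 0) := by
    rw [(schwartz_withSeminorms ℝ (Space N) ℂ).tendsto_nhds]
    intro i ε hε
    obtain ⟨C, δ, hδ, h⟩ := exists_seminorm_heatSym_remainder_le hφ κ τ {i}
    have h1 : Tendsto (fun h : ℝ => C * h ^ 2) (𝓝 0) (𝓝 0) := by
      have : Continuous fun h : ℝ => C * h ^ 2 := by fun_prop
      simpa using this.tendsto 0
    filter_upwards [Metric.ball_mem_nhds (0 : ℝ) hδ, h1.eventually_lt_const hε] with t ht ht2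
    rw [mem_ball_zero_iff, Real.norm_eq_abs] at ht
    have := h t ht.le
    rw [Finset.sup_singleton] at this
    rw [sub_zero]
    exact this.trans_lt ht2
  have h1 : Tendsto (fun h : ℝ => (h : ℂ) • κ • lapSymbol (heatSym hφ κ τ)) (𝓝 0) (𝓝 0) := by
    have : Continuous fun h : ℝ => (h : ℂ) • κ • lapSymbol (heatSym hφ κ τ) := by fun_prop
    simpa using this.tendsto 0
  have h2 := (h0.add h1).add_const (heatSym hφ κ τ)
  simp only [sub_add_cancel, add_zero, zero_add] at h2
  have h3 : Tendsto (fun t : ℝ => t - τ) (𝓝 τ) (𝓝 0) := by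
    have : Continuous fun t : ℝ => t - τ := by fun_prop
    simpa using this.tendsto τ
  have := h2.comp h3
  simp only [Function.comp_def, add_sub_cancel] at this
  exact this

/-- The localized heat flow `exp(κ t Δ)` at frequency `2^j`. -/
noncomputable def heatOp (hφ : IsLittlewoodPaley φ) (κ : ℂ) (j : ℤ) (t : ℝ) :
    𝓢(Space N, ℂ) →L[ℂ] 𝓢(Space N, ℂ) :=
  mulOp j (heatSym hφ κ ((4 : ℝ) ^ j * t))

theorem heatOp_zero (hφ : IsLittlewoodPaley φ) (κ : ℂ) (j : ℤ) :
    heatOp hφ κ j 0 = mulOp j (fat φ) := by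
  rw [heatOp, mul_zero, heatSym_zero]

theorem continuous_heatOp (hφ : IsLittlewoodPaley φ) (κ : ℂ) (j : ℤ) (ψ : 𝓢(Space N, ℂ)) :
    Continuous fun t => heatOp hφ κ j t ψ := by
  simp only [heatOp, ← mulOpSymbol_apply]
  exact (mulOpSymbol j ψ).continuous.comp ((continuous_heatSym hφ κ).comp (by fun_prop))

theorem hasDerivAt_heatOp (hφ : IsLittlewoodPaley φ) (κ : ℂ) (j : ℤ) (ψ : 𝓢(Space N, ℂ))
    (u : 𝓢(Space N, ℂ) →L[ℂ] ℂ) (t : ℝ) :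
    HasDerivAt (fun t => u (heatOp hφ κ j t ψ)) (u (heatOp hφ κ j t (κ • lapS ψ))) t := by
  have h1 := hasDerivAt_heatSym hφ κ ((4 : ℝ) ^ j * t) (u.comp (mulOpSymbol j ψ))
  have h2 : HasDerivAt (fun t : ℝ => (4 : ℝ) ^ j * t) ((4 : ℝ) ^ j) t := by
    simpa using (hasDerivAt_id t).const_mul ((4 : ℝ) ^ j)
  have h3 := h1.scomp t h2
  simp only [Function.comp_def, ContinuousLinearMap.comp_apply, mulOpSymbol_apply] at h3
  have e : u (heatOp hφ κ j t (κ • lapS ψ)) =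
      (4 : ℝ) ^ j • (κ * u (mulOp j (lapSymbol (heatSym hφ κ ((4 : ℝ) ^ j * t))) ψ)) := by
    simp only [heatOp, map_smul, mulOp_lapS]
    simp
    ring
  rw [e]
  exact h3

theorem heatOp_mulOp (hφ : IsLittlewoodPaley φ) (κ : ℂ) (i j : ℤ) (t : ℝ) (m ψ : 𝓢(Space N, ℂ)) :
    heatOp hφ κ j t (mulOp i m ψ) = mulOp i m (heatOp hφ κ j t ψ) :=
  mulOp_comm _ _ _ _ _

theorem symbol_heatSym_mul (hφ : IsLittlewoodPaley φ) (κ : ℂ) (j : ℤ) (t : ℝ) (ξ : Space N) :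
    symbol (heatSym hφ κ ((4 : ℝ) ^ j * t)) j ξ =
      Complex.exp (-(κ * t) * (‖(2 * Real.pi) • ξ‖ ^ 2 : ℝ)) * symbol (fat φ) j ξ := by
  simp only [symbol, heatSym_apply]
  congr 2
  have h : (4 : ℝ) ^ j * ‖(2 : ℝ) ^ (-j) • (2 * Real.pi) • ξ‖ ^ 2 = ‖(2 * Real.pi) • ξ‖ ^ 2 := by
    rw [norm_smul _ ((2 * Real.pi) • ξ), norm_zpow, mul_pow, Real.norm_ofNat, ← zpow_natCast,
      ← zpow_mul, show (4 : ℝ) = 2 ^ (2 : ℤ) by norm_num, ← zpow_mul, ← mul_assoc,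
      ← zpow_add₀ two_ne_zero]
    simp only [Nat.cast_ofNat]
    rw [show 2 * j + -j * 2 = 0 by ring, zpow_zero, one_mul]
  rw [← h]
  push_cast
  ring

/-- The fat cutoffs are absorbed by the blocks, and both sides have the symbol φ_i φ_j
exp(-κt|2πξ|²), symmetric in i and j. This makes the separately defined Duhamel blocks the blocks of
a single distribution. -/
theorem mulOp_heatOp_swap (hφ : IsLittlewoodPaley φ) (κ : ℂ) (i j : ℤ) (t : ℝ) (ψ : 𝓢(Space N, ℂ)) :
    mulOp j φ (heatOp hφ κ j t (mulOp i φ ψ)) = mulOp i φ (heatOp hφ κ i t (mulOp j φ ψ)) := by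
  refine ext_fourier fun ξ => ?_
  simp only [heatOp, fourier_mulOp, symbol_heatSym_mul]
  have h1 := symbol_fat_mul hφ i ξ
  have h2 := symbol_fat_mul hφ j ξ
  calc _ = (symbol (fat φ) j ξ * symbol φ j ξ) * symbol φ i ξ *
        Complex.exp (-(κ * t) * (‖(2 * Real.pi) • ξ‖ ^ 2 : ℝ)) * (𝓕 ψ : 𝓢(Space N, ℂ)) ξ := by ring
    _ = (symbol (fat φ) i ξ * symbol φ i ξ) * symbol φ j ξ *
        Complex.exp (-(κ * t) * (‖(2 * Real.pi) • ξ‖ ^ 2 : ℝ)) * (𝓕 ψ : 𝓢(Space N, ℂ)) ξ := by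
          rw [h1, h2]; ring
    _ = _ := by ring

theorem mulOp_mulOp_eq_zero (hφ : IsLittlewoodPaley φ) {i j : ℤ}
    (h : i ∉ ({j - 1, j, j + 1} : Finset ℤ)) (ψ : 𝓢(Space N, ℂ)) :
    mulOp i φ (mulOp j φ ψ) = 0 := by
  refine ext_fourier fun ξ => ?_
  rw [fourier_mulOp, fourier_mulOp, ← mul_assoc, symbol_mul_symbol_eq_zero' hφ h, zero_mul,
    FourierTransform.fourier_zero]
  rfl

end Heat

/-! ### Vanishing to infinite order at the origin. -/

section Flat

/-- Taylor's estimate at 0 with all lower terms zero: each use of the mean value inequality trades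
one derivative for a factor |x|. -/
theorem norm_iteratedFDeriv_le_of_flat {E F : Type*} [NormedAddCommGroup E] [NormedSpace ℝ E]
    [NormedAddCommGroup F] [NormedSpace ℝ F] {g : E → F} (hg : ContDiff ℝ (⊤ : ℕ∞) g)
    (h0 : ∀ n, iteratedFDeriv ℝ n g 0 = 0) {B : ℝ} (M n : ℕ)
    (hB : ∀ x, ‖iteratedFDeriv ℝ (n + M) g x‖ ≤ B) (x : E) :
    ‖iteratedFDeriv ℝ n g x‖ ≤ ‖x‖ ^ M * B := by
  induction M generalizing n x with
  | zero => simpa using hB x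
  | succ M ih =>
    have hd : Differentiable ℝ (iteratedFDeriv ℝ n g) :=
      hg.differentiable_iteratedFDeriv (by exact_mod_cast ENat.natCast_lt_top n)
    have hB0 : 0 ≤ B := (norm_nonneg _).trans (hB 0)
    have h1 := (convex_closedBall (0 : E) ‖x‖).norm_image_sub_le_of_norm_fderiv_le
      (f := iteratedFDeriv ℝ n g) (C := ‖x‖ ^ M * B) (𝕜 := ℝ) (x := 0) (y := x)
      (fun y _ => hd y) (fun y hy => by
        rw [norm_fderiv_iteratedFDeriv]
        have := ih (n + 1) (fun z => by rw [add_assoc, add_comm 1 M]; exact hB z) y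
        rw [mem_closedBall_zero_iff] at hy
        exact this.trans (by gcongr)) (by simp) (by simp)
    rw [h0, sub_zero, sub_zero] at h1
    exact h1.trans (le_of_eq (by ring))

end Flat

/-! ### Rapid decay of the frequency blocks of a test function in 𝒵. -/

section Decay

variable {N : ℕ} {m : 𝓢(Space N, ℂ)}

theorem norm_iteratedFDeriv_symbol_le (m : 𝓢(Space N, ℂ)) (j : ℤ) (i : ℕ) (ξ : Space N) :
    ‖iteratedFDeriv ℝ i (symbol m j) ξ‖ ≤
      ((2 : ℝ) ^ (-j) * (2 * Real.pi)) ^ i * SchwartzMap.seminorm ℝ 0 i m := by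
  have e : symbol m j = fun ξ => m (((2 : ℝ) ^ (-j) * (2 * Real.pi)) • ξ) := by
    ext ξ; simp [symbol, mul_smul]
  rw [e, iteratedFDeriv_comp_const_smul _ (m.smooth i)]
  rw [norm_smul, norm_pow, Real.norm_of_nonneg (by positivity)]
  gcongr
  simpa using SchwartzMap.le_seminorm ℝ 0 i m (((2 : ℝ) ^ (-j) * (2 * Real.pi)) • ξ)

/-- On the shell |ξ| ~ 1/t. For t ≥ 1 (low frequency) flatness of g at 0 supplies the factor t^{-M};
for t ≤ 1 (high frequency) Schwartz decay supplies t^M. The prefactor t^i comes from i derivatives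
of the rescaled cutoff. -/
theorem pow_mul_norm_iteratedFDeriv_le_of_flat {g : 𝓢(Space N, ℂ)}
    (h0 : ∀ n, iteratedFDeriv ℝ n g 0 = 0) {α β t : ℝ} (hα : 0 < α) (hβ : 1 ≤ β) (ht : 0 < t)
    (i k l M : ℕ) {ξ : Space N} (h1 : α ≤ t * ‖ξ‖) (h2 : t * ‖ξ‖ ≤ β) :
    t ^ i * (‖ξ‖ ^ k * ‖iteratedFDeriv ℝ l g ξ‖) ≤
      (β ^ (k + M + i) + α⁻¹ ^ M) * min t t⁻¹ ^ M *
        (SchwartzMap.seminorm ℝ 0 (l + (M + i)) g + SchwartzMap.seminorm ℝ (k + M) l g) := by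
  have s1 : 0 ≤ SchwartzMap.seminorm ℝ 0 (l + (M + i)) g := apply_nonneg _ _
  have s2 : 0 ≤ SchwartzMap.seminorm ℝ (k + M) l g := apply_nonneg _ _
  have hx : ‖ξ‖ ≤ β * t⁻¹ := by rw [← div_eq_mul_inv, le_div_iff₀ ht]; linarith
  rcases le_total 1 t with h | h
  · have h3 := norm_iteratedFDeriv_le_of_flat (g.smooth (⊤ : ℕ∞)) h0 (M + i) l
      (B := SchwartzMap.seminorm ℝ 0 (l + (M + i)) g)
      (fun x => by simpa using SchwartzMap.le_seminorm ℝ 0 (l + (M + i)) g x) ξ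
    rw [min_eq_right ((inv_le_one_of_one_le₀ h).trans h)]
    calc t ^ i * (‖ξ‖ ^ k * ‖iteratedFDeriv ℝ l g ξ‖)
        ≤ t ^ i * ((β * t⁻¹) ^ k * ((β * t⁻¹) ^ (M + i) * SchwartzMap.seminorm ℝ 0 (l + (M + i)) g)) := by
          gcongr
          exact h3.trans (by gcongr)
      _ = β ^ (k + M + i) * t⁻¹ ^ M * SchwartzMap.seminorm ℝ 0 (l + (M + i)) g * t⁻¹ ^ k := by
          rw [mul_pow, mul_pow, pow_add t⁻¹, inv_pow t i]
          field_simp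
          ring
      _ ≤ β ^ (k + M + i) * t⁻¹ ^ M * SchwartzMap.seminorm ℝ 0 (l + (M + i)) g * 1 := by
          gcongr
          exact pow_le_one₀ (by positivity) (inv_le_one_of_one_le₀ h)
      _ ≤ _ := by
          rw [mul_one]
          have : (0 : ℝ) ≤ α⁻¹ ^ M := by positivity
          gcongr <;> linarith
  · rw [min_eq_left (h.trans (one_le_inv₀ ht |>.2 h))]
    have h3 := SchwartzMap.le_seminorm ℝ (k + M) l g ξ
    have h4 : 1 ≤ α⁻¹ * t * ‖ξ‖ := by
      rw [mul_assoc, inv_mul_eq_div, le_div_iff₀ hα]; linarith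
    calc t ^ i * (‖ξ‖ ^ k * ‖iteratedFDeriv ℝ l g ξ‖)
        ≤ 1 * (‖ξ‖ ^ k * ‖iteratedFDeriv ℝ l g ξ‖) * (α⁻¹ * t * ‖ξ‖) ^ M := by
          exact (mul_le_mul_of_nonneg_right (pow_le_one₀ ht.le h) (by positivity)).trans
            (le_mul_of_one_le_right (by positivity) (one_le_pow₀ h4))
      _ = α⁻¹ ^ M * t ^ M * (‖ξ‖ ^ (k + M) * ‖iteratedFDeriv ℝ l g ξ‖) := by
          rw [mul_pow, mul_pow, pow_add]; ring
      _ ≤ α⁻¹ ^ M * t ^ M * SchwartzMap.seminorm ℝ (k + M) l g := by gcongr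
      _ ≤ _ := by
          have : (0 : ℝ) ≤ β ^ (k + M + i) := by positivity
          gcongr <;> linarith

theorem min_symbol_scale_le (j : ℤ) :
    min ((2 : ℝ) ^ (-j) * (2 * Real.pi)) ((2 : ℝ) ^ (-j) * (2 * Real.pi))⁻¹ ≤
      2 * Real.pi * (2 : ℝ) ^ (-|j|) := by
  have hpi := Real.pi_gt_three
  rcases le_total 0 j with h | h
  · rw [abs_of_nonneg h]
    exact (min_le_left _ _).trans (by rw [mul_comm])
  · rw [abs_of_nonpos h, neg_neg]
    refine (min_le_right _ _).trans ?_
    rw [mul_inv, zpow_neg, inv_inv, mul_comm]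
    gcongr
    rw [inv_le_comm₀ (by positivity) (by positivity)]
    exact (inv_le_one_of_one_le₀ (by linarith)).trans (by linarith)

theorem exists_seminorm_fourier_mulOp_le {α β : ℝ} (hα : 0 < α) (hβ : 1 ≤ β)
    (hm : ∀ η, m η ≠ 0 → α ≤ ‖η‖ ∧ ‖η‖ ≤ β) (M : ℕ) (k n : ℕ) :
    ∃ (C : ℝ) (s : Finset (ℕ × ℕ)), 0 ≤ C ∧ ∀ ψ ∈ 𝒵 N, ∀ j : ℤ,
      SchwartzMap.seminorm ℝ k n (𝓕 (mulOp j m ψ) : 𝓢(Space N, ℂ)) ≤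
        C * ((2 : ℝ) ^ (-|j|)) ^ M *
          (s.sup (schwartzSeminormFamily ℝ (Space N) ℂ)) (𝓕 ψ : 𝓢(Space N, ℂ)) := by
  set s : Finset (ℕ × ℕ) := insert (0, n + M) ((Finset.range (n + 1)).image fun i => (k + M, n - i))
    with hs
  set C₁ : ℝ := ∑ i ∈ Finset.range (n + 1), (n.choose i : ℝ) * SchwartzMap.seminorm ℝ 0 i m *
    ((β ^ (k + M + i) + α⁻¹ ^ M) * (2 * Real.pi) ^ M * 2) with hC₁
  have hsm : ∀ i, 0 ≤ SchwartzMap.seminorm ℝ 0 i m := fun i => apply_nonneg _ _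
  have hC₁0 : 0 ≤ C₁ := Finset.sum_nonneg fun i _ => by
    have := hsm i
    positivity
  refine ⟨C₁, s, hC₁0, fun ψ hψ j => ?_⟩
  set g : 𝓢(Space N, ℂ) := 𝓕 ψ with hg
  set Q := (s.sup (schwartzSeminormFamily ℝ (Space N) ℂ)) g with hQ
  have hQ0 : 0 ≤ Q := apply_nonneg _ _
  have hle : ∀ a ∈ s, SchwartzMap.seminorm ℝ a.1 a.2 g ≤ Q := fun a ha =>
    Seminorm.le_finset_sup_apply (p := schwartzSeminormFamily ℝ (Space N) ℂ) ha
  set t : ℝ := (2 : ℝ) ^ (-j) * (2 * Real.pi) with ht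
  have ht0 : 0 < t := by positivity
  have e : ((𝓕 (mulOp j m ψ) : 𝓢(Space N, ℂ)) : Space N → ℂ) = fun ξ => symbol m j ξ * g ξ :=
    funext fun ξ => fourier_mulOp j m ψ ξ
  refine SchwartzMap.seminorm_le_bound ℝ k n _ (by positivity) fun ξ => ?_
  rw [e]
  by_cases hx : α ≤ t * ‖ξ‖ ∧ t * ‖ξ‖ ≤ β
  · have h1 := norm_iteratedFDeriv_mul_le (n := n) (N := ((⊤ : ℕ∞) : WithTop ℕ∞))
      (symbol_growth m j).1 (g.smooth (⊤ : ℕ∞)) ξ (by exact_mod_cast le_top)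
    calc _ ≤ ‖ξ‖ ^ k * ∑ i ∈ Finset.range (n + 1), (n.choose i : ℝ) *
            ‖iteratedFDeriv ℝ i (symbol m j) ξ‖ * ‖iteratedFDeriv ℝ (n - i) g ξ‖ := by
          gcongr
      _ ≤ ‖ξ‖ ^ k * ∑ i ∈ Finset.range (n + 1), (n.choose i : ℝ) *
            (t ^ i * SchwartzMap.seminorm ℝ 0 i m) * ‖iteratedFDeriv ℝ (n - i) g ξ‖ := by
          gcongr with i hi
          exact norm_iteratedFDeriv_symbol_le m j i ξ
      _ = ∑ i ∈ Finset.range (n + 1), (n.choose i : ℝ) * SchwartzMap.seminorm ℝ 0 i m *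
            (t ^ i * (‖ξ‖ ^ k * ‖iteratedFDeriv ℝ (n - i) g ξ‖)) := by
          rw [Finset.mul_sum]
          exact Finset.sum_congr rfl fun i _ => by ring
      _ ≤ ∑ i ∈ Finset.range (n + 1), (n.choose i : ℝ) * SchwartzMap.seminorm ℝ 0 i m *
            ((β ^ (k + M + i) + α⁻¹ ^ M) * (2 * Real.pi * (2 : ℝ) ^ (-|j|)) ^ M * (Q + Q)) := by
          refine Finset.sum_le_sum fun i hi => ?_
          have := hsm i
          have hin : i ≤ n := Nat.lt_succ_iff.1 (Finset.mem_range.1 hi)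
          have h3 := pow_mul_norm_iteratedFDeriv_le_of_flat (g := g) hψ hα hβ ht0 i k (n - i) M
            hx.1 hx.2
          have h4 := min_symbol_scale_le j
          have h5 : SchwartzMap.seminorm ℝ 0 (n - i + (M + i)) g ≤ Q := by
            rw [show n - i + (M + i) = n + M by omega]
            exact hle (0, n + M) (Finset.mem_insert_self _ _)
          have h6 : SchwartzMap.seminorm ℝ (k + M) (n - i) g ≤ Q :=
            hle (k + M, n - i) (Finset.mem_insert_of_mem (Finset.mem_image_of_mem _ hi))
          have h7 : 0 ≤ min t t⁻¹ := by positivity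
          refine mul_le_mul_of_nonneg_left (h3.trans ?_) (by positivity)
          gcongr
      _ = _ := by
          rw [hC₁, Finset.sum_mul, Finset.sum_mul]
          refine Finset.sum_congr rfl fun i _ => ?_
          rw [mul_pow]
          ring
  · have hc : Continuous fun y : Space N => t * ‖y‖ := by fun_prop
    have hopen : IsOpen {y : Space N | ¬ (α ≤ t * ‖y‖ ∧ t * ‖y‖ ≤ β)} :=
      ((isClosed_le continuous_const hc).inter (isClosed_le hc continuous_const)).isOpen_compl
    have h0 : (fun ξ => symbol m j ξ * g ξ) =ᶠ[𝓝 ξ] 0 := by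
      filter_upwards [hopen.mem_nhds hx] with y hy
      have : symbol m j y = 0 := by
        by_contra h
        have h1 := hm _ h
        rw [norm_smul, norm_smul, ← mul_assoc, norm_zpow, Real.norm_ofNat,
          Real.norm_of_nonneg (by positivity : (0:ℝ) ≤ 2 * Real.pi)] at h1
        exact hy h1
      simp [this]
    rw [(h0.iteratedFDeriv ℝ n).eq_of_nhds, iteratedFDeriv_zero]
    simp only [Pi.zero_apply, norm_zero, mul_zero]
    positivity

theorem exists_sup_seminorm_fourier_mulOp_le {α β : ℝ} (hα : 0 < α) (hβ : 1 ≤ β)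
    (hm : ∀ η, m η ≠ 0 → α ≤ ‖η‖ ∧ ‖η‖ ≤ β) (M : ℕ) (s : Finset (ℕ × ℕ)) :
    ∃ (C : ℝ) (s' : Finset (ℕ × ℕ)), 0 ≤ C ∧ ∀ ψ ∈ 𝒵 N, ∀ j : ℤ,
      (s.sup (schwartzSeminormFamily ℝ (Space N) ℂ)) (𝓕 (mulOp j m ψ) : 𝓢(Space N, ℂ)) ≤
        C * ((2 : ℝ) ^ (-|j|)) ^ M *
          (s'.sup (schwartzSeminormFamily ℝ (Space N) ℂ)) (𝓕 ψ : 𝓢(Space N, ℂ)) := by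
  choose C S hC0 hC using fun kn : ℕ × ℕ =>
    exists_seminorm_fourier_mulOp_le hα hβ hm M kn.1 kn.2
  refine ⟨∑ i ∈ s, C i, s.biUnion S, Finset.sum_nonneg fun i _ => hC0 i, fun ψ hψ j => ?_⟩
  have h0 : 0 ≤ ∑ i ∈ s, C i := Finset.sum_nonneg fun i _ => hC0 i
  have h1 : ∀ s' : Finset (ℕ × ℕ), 0 ≤ (s'.sup (schwartzSeminormFamily ℝ (Space N) ℂ))
    (𝓕 ψ : 𝓢(Space N, ℂ)) := fun s' => apply_nonneg _ _
  have h2 := h1 (s.biUnion S)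
  refine Seminorm.finset_sup_apply_le (by positivity) fun kn hkn => ?_
  refine (hC kn ψ hψ j).trans ?_
  have h3 := h1 (S kn)
  have h4 : (S kn).sup (schwartzSeminormFamily ℝ (Space N) ℂ) ≤
      (s.biUnion S).sup (schwartzSeminormFamily ℝ (Space N) ℂ) :=
    Finset.sup_mono (Finset.subset_biUnion_of_mem S hkn)
  have h5 := Finset.single_le_sum (f := C) (fun i _ => hC0 i) hkn
  exact mul_le_mul (by gcongr) (h4 _) h3 (by positivity)

theorem continuous_sup_seminorm_fourier (s : Finset (ℕ × ℕ)) :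
    Continuous fun ψ : 𝓢(Space N, ℂ) =>
      (s.sup (schwartzSeminormFamily ℝ (Space N) ℂ)) (𝓕 ψ : 𝓢(Space N, ℂ)) := by
  have h : Continuous fun g : 𝓢(Space N, ℂ) =>
      (s.sup (schwartzSeminormFamily ℝ (Space N) ℂ)) g := by
    classical
    induction s using Finset.induction_on with
    | empty => exact continuous_const
    | insert a s _ ih =>
      simp only [Finset.sup_insert]
      exact ((schwartz_withSeminorms ℝ (Space N) ℂ).continuous_seminorm a).sup ih
  exact h.comp (FourierTransform.fourierCLM ℝ 𝓢(Space N, ℂ)).continuous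

theorem two_zpow_neg_abs_pow_le {σ : ℝ} {M : ℕ} (hM : |σ| ≤ M) (j : ℤ) :
    ((2 : ℝ) ^ (-|j|)) ^ M ≤ (2 : ℝ) ^ ((j : ℝ) * σ) := by
  rw [← Real.rpow_intCast, ← Real.rpow_natCast, ← Real.rpow_mul two_pos.le]
  refine Real.rpow_le_rpow_of_exponent_le one_le_two ?_
  push_cast
  have h1 : |(j : ℝ) * σ| ≤ |(j : ℝ)| * M := by
    rw [abs_mul]; gcongr
  have := neg_abs_le ((j : ℝ) * σ)
  linarith

/-- The frequency blocks of a test function in `𝒵` decay faster than any power of `2^{|j|}`. -/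
theorem exists_eLpNorm_mulOp_le_of_mem {α β : ℝ} (hα : 0 < α) (hβ : 1 ≤ β)
    (hm : ∀ η, m η ≠ 0 → α ≤ ‖η‖ ∧ ‖η‖ ≤ β) {q : ℝ≥0∞} (hq : 1 ≤ q) (σ : ℝ) :
    ∃ Q : 𝓢(Space N, ℂ) → ℝ, Continuous Q ∧ Q 0 = 0 ∧ ∀ ψ ∈ 𝒵 N, ∀ j : ℤ,
      eLpNorm (mulOp j m ψ) q volume ≤ (2 : ℝ≥0∞) ^ ((j : ℝ) * σ) * ENNReal.ofReal (Q ψ) := by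
  have : Fact (1 ≤ q) := ⟨hq⟩
  let L : 𝓢(Space N, ℂ) →L[ℝ] Lp ℂ q (volume : Measure (Space N)) :=
    (SchwartzMap.toLpCLM ℝ ℂ q volume).comp (FourierTransform.fourierInvCLM ℝ 𝓢(Space N, ℂ))
  have hc : Continuous ((normSeminorm ℝ (Lp ℂ q (volume : Measure (Space N)))).comp
      L.toLinearMap) := continuous_norm.comp L.continuous
  obtain ⟨s, C, -, h⟩ := Seminorm.bound_of_continuous
    (schwartz_withSeminorms ℝ (Space N) ℂ) _ hc
  -- M orders of decay in 2^{-|j|} dominate the weight 2^{jσ} for j of either sign.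
  obtain ⟨M, hM⟩ := exists_nat_ge |σ|
  obtain ⟨C', s', hC', h'⟩ := exists_sup_seminorm_fourier_mulOp_le hα hβ hm M s
  refine ⟨fun ψ => C * C' * (s'.sup (schwartzSeminormFamily ℝ (Space N) ℂ)) (𝓕 ψ : 𝓢(Space N, ℂ)),
    continuous_const.mul (continuous_sup_seminorm_fourier s'), ?_, fun ψ hψ j => ?_⟩
  · simp [FourierTransform.fourier_zero]
  · have h1 := h (𝓕 (mulOp j m ψ) : 𝓢(Space N, ℂ))
    have h2 : ((normSeminorm ℝ (Lp ℂ q (volume : Measure (Space N)))).comp L.toLinearMap)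
        (𝓕 (mulOp j m ψ) : 𝓢(Space N, ℂ)) = (eLpNorm (mulOp j m ψ) q volume).toReal := by
      have : L (𝓕 (mulOp j m ψ) : 𝓢(Space N, ℂ)) = (mulOp j m ψ).toLp q volume := by
        change SchwartzMap.toLpCLM ℝ ℂ q volume (𝓕⁻ (𝓕 (mulOp j m ψ))) = _
        rw [FourierTransform.fourierInv_fourier_eq]
        rfl
      change ‖L (𝓕 (mulOp j m ψ) : 𝓢(Space N, ℂ))‖ = _
      rw [this, SchwartzMap.norm_toLp]
    rw [h2] at h1
    rw [← ENNReal.ofReal_toReal ((mulOp j m ψ).memLp q volume).eLpNorm_ne_top]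
    have h3 : (2 : ℝ≥0∞) ^ ((j : ℝ) * σ) = ENNReal.ofReal ((2 : ℝ) ^ ((j : ℝ) * σ)) := by
      rw [← ENNReal.ofReal_rpow_of_pos two_pos]; simp
    rw [h3, ← ENNReal.ofReal_mul (by positivity)]
    apply ENNReal.ofReal_le_ofReal
    have h4 := h' ψ hψ j
    have h5 := two_zpow_neg_abs_pow_le hM j
    have h6 : 0 ≤ (s'.sup (schwartzSeminormFamily ℝ (Space N) ℂ)) (𝓕 ψ : 𝓢(Space N, ℂ)) :=
      apply_nonneg _ _
    have hC0 : (0 : ℝ) ≤ C := C.2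
    calc (eLpNorm (mulOp j m ψ) q volume).toReal ≤ C * _ := h1
      _ ≤ C * (C' * (2 : ℝ) ^ ((j : ℝ) * σ) *
          (s'.sup (schwartzSeminormFamily ℝ (Space N) ℂ)) (𝓕 ψ : 𝓢(Space N, ℂ))) := by
          gcongr
          exact h4.trans (by gcongr)
      _ = _ := by ring

theorem summable_two_zpow_neg_abs : Summable fun j : ℤ => ((2 : ℝ) ^ (-|j|)) ^ 1 := by
  have h : Summable fun n : ℕ => (1 / 2 : ℝ) ^ n := summable_geometric_two
  refine Summable.of_nat_of_neg ?_ ?_ <;>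
  · refine h.congr fun n => ?_
    simp

end Decay

/-! ### The Littlewood-Paley decomposition in 𝒵 and 𝒵'. -/

section Decomposition

variable {N : ℕ} {φ : 𝓢(Space N, ℂ)}

/-- Away from the origin the partition of unity is locally finite. The identity is needed on a whole
neighbourhood of x so that derivatives can be compared. -/
theorem exists_finset_symbol (hφ : IsLittlewoodPaley φ) {x : Space N} (hx : x ≠ 0) :
    ∃ G : Finset ℤ, ∀ᶠ y in 𝓝 x, ∀ G' : Finset ℤ, G ⊆ G' → ∑ j ∈ G', symbol φ j y = 1 := by
  have hx0 : 0 < ‖x‖ := norm_pos_iff.2 hx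
  have hpi := Real.pi_pos
  obtain ⟨n₁, hn₁⟩ := pow_unbounded_of_one_lt (4 / 3 * (2 * Real.pi * (2 * ‖x‖))) (one_lt_two : (1 : ℝ) < 2)
  obtain ⟨n₂, hn₂⟩ := pow_unbounded_of_one_lt (8 / 3 / (2 * Real.pi * (‖x‖ / 2)))
    (one_lt_two : (1 : ℝ) < 2)
  refine ⟨Finset.Icc (-(n₂ : ℤ)) n₁, ?_⟩
  have h1 : ∀ᶠ y in 𝓝 x, ‖x‖ / 2 < ‖y‖ := continuous_norm.continuousAt.eventually_const_lt (by linarith)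
  have h2 : ∀ᶠ y in 𝓝 x, ‖y‖ < 2 * ‖x‖ := continuous_norm.continuousAt.eventually_lt_const (by linarith)
  filter_upwards [h1, h2] with y hy1 hy2 G' hG'
  have hy : y ≠ 0 := by
    rintro rfl
    rw [norm_zero] at hy1
    linarith
  refine (hasSum_sum_of_ne_finset_zero fun j hj => ?_).unique (hasSum_symbol hφ hy)
  by_contra h0
  refine hj (hG' ?_)
  have h3 := symbol_ne_zero_norm hφ h0
  rw [norm_smul, Real.norm_of_nonneg (by positivity)] at h3
  rw [Finset.mem_Icc]
  constructor
  · by_contra hlt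
    push Not at hlt
    have h4 : (2 : ℝ) ^ j ≤ 2 ^ (-(n₂ : ℤ)) := zpow_le_zpow_right₀ one_le_two hlt.le
    rw [zpow_neg, zpow_natCast] at h4
    have h5 : (2 : ℝ) ^ n₂ * (2 ^ n₂)⁻¹ = 1 := mul_inv_cancel₀ (by positivity)
    rw [div_lt_iff₀ (by positivity)] at hn₂
    have h6 : 2 * Real.pi * (‖x‖ / 2) < 8 / 3 * ((2 : ℝ) ^ n₂)⁻¹ := by
      have : 2 * Real.pi * (‖x‖ / 2) < 2 * Real.pi * ‖y‖ := by gcongr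
      linarith
    have : (2 : ℝ) ^ n₂ * (2 * Real.pi * (‖x‖ / 2)) < 2 ^ n₂ * (8 / 3 * ((2 : ℝ) ^ n₂)⁻¹) := by gcongr
    nlinarith
  · by_contra hlt
    push Not at hlt
    have h4 : (2 : ℝ) ^ (n₁ : ℤ) ≤ 2 ^ j := zpow_le_zpow_right₀ one_le_two hlt.le
    rw [zpow_natCast] at h4
    have : 2 * Real.pi * ‖y‖ < 2 * Real.pi * (2 * ‖x‖) := by gcongr
    linarith

theorem mulOp_mem (hφ : IsLittlewoodPaley φ) (j : ℤ) (ψ : 𝓢(Space N, ℂ)) : mulOp j φ ψ ∈ 𝒵 N :=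
  block_mem hφ j ψ

/-- Near x ≠ 0 the error of the partial sum over F is a finite sum of blocks outside F, hence small;
at 0 every derivative of the error vanishes because the error lies in 𝒵. -/
theorem seminorm_sum_mulOp_sub_le (hφ : IsLittlewoodPaley φ) {ψ : 𝓢(Space N, ℂ)} (hψ : ψ ∈ 𝒵 N)
    (k n : ℕ) (F : Finset ℤ) {ε : ℝ} (hε : 0 ≤ ε) (h : ∀ G : Finset ℤ, Disjoint G F →
      ∑ j ∈ G, SchwartzMap.seminorm ℝ k n (𝓕 (mulOp j φ ψ) : 𝓢(Space N, ℂ)) ≤ ε) :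
    SchwartzMap.seminorm ℝ k n
      (∑ j ∈ F, (𝓕 (mulOp j φ ψ) : 𝓢(Space N, ℂ)) - (𝓕 ψ : 𝓢(Space N, ℂ))) ≤ ε := by
  classical
  refine SchwartzMap.seminorm_le_bound ℝ k n _ hε fun x => ?_
  rcases eq_or_ne x 0 with rfl | hx
  · have h1 : ∑ j ∈ F, mulOp j φ ψ - ψ ∈ 𝒵 N :=
      (𝒵 N).sub_mem ((𝒵 N).sum_mem fun j _ => mulOp_mem hφ j ψ) hψ
    have h2 := h1 n
    have e : (𝓕 (∑ j ∈ F, mulOp j φ ψ - ψ) : 𝓢(Space N, ℂ)) =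
        ∑ j ∈ F, (𝓕 (mulOp j φ ψ) : 𝓢(Space N, ℂ)) - (𝓕 ψ : 𝓢(Space N, ℂ)) := by
      rw [← FourierTransform.fourier_sum]
      exact map_sub (FourierTransform.fourierCLM ℂ 𝓢(Space N, ℂ)) _ _
    rw [e] at h2
    rw [h2]
    simpa using hε
  · obtain ⟨G, hG⟩ := exists_finset_symbol hφ hx
    set g : 𝓢(Space N, ℂ) := -∑ j ∈ G \ F, (𝓕 (mulOp j φ ψ) : 𝓢(Space N, ℂ)) with hg
    have h1 : ((∑ j ∈ F, (𝓕 (mulOp j φ ψ) : 𝓢(Space N, ℂ)) - (𝓕 ψ : 𝓢(Space N, ℂ)) :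
        𝓢(Space N, ℂ)) : Space N → ℂ) =ᶠ[𝓝 x] g := by
      filter_upwards [hG] with y hy
      have h2 := hy (F ∪ G) Finset.subset_union_right
      rw [← Finset.sum_sdiff (Finset.subset_union_left (s₁ := F) (s₂ := G)),
        Finset.union_sdiff_left] at h2
      simp only [hg, sub_apply, neg_apply, _root_.sum_apply, fourier_mulOp, ← Finset.sum_mul]
      linear_combination (𝓕 ψ : 𝓢(Space N, ℂ)) y * h2
    rw [(h1.iteratedFDeriv ℝ n).eq_of_nhds]
    refine (SchwartzMap.le_seminorm ℝ k n g x).trans ?_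
    rw [hg, map_neg_eq_map]
    refine le_trans ?_ (h (G \ F) Finset.sdiff_disjoint)
    exact Finset.le_sum_of_subadditive _ (map_zero _).le (fun a b => map_add_le_add _ a b) _ _

/-- The Littlewood-Paley decomposition of a test function in `𝒵`. -/
theorem hasSum_mulOp (hφ : IsLittlewoodPaley φ) {ψ : 𝓢(Space N, ℂ)} (hψ : ψ ∈ 𝒵 N) :
    HasSum (fun j : ℤ => mulOp j φ ψ) ψ := by
  have h : HasSum (fun j : ℤ => (𝓕 (mulOp j φ ψ) : 𝓢(Space N, ℂ))) (𝓕 ψ : 𝓢(Space N, ℂ)) := by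
    rw [HasSum, SummationFilter.unconditional_filter,
      (schwartz_withSeminorms ℝ (Space N) ℂ).tendsto_nhds]
    rintro ⟨k, n⟩ ε hε
    obtain ⟨C, s, hC, hb⟩ := exists_seminorm_fourier_mulOp_le (m := φ) (α := 3 / 4) (β := 8 / 3)
      (by norm_num) (by norm_num) hφ.supp 1 k n
    have hsum : Summable fun j : ℤ =>
        SchwartzMap.seminorm ℝ k n (𝓕 (mulOp j φ ψ) : 𝓢(Space N, ℂ)) := by
      refine Summable.of_nonneg_of_le (fun j => apply_nonneg _ _) (fun j => hb ψ hψ j) ?_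
      exact (summable_two_zpow_neg_abs.mul_left C).mul_right _
    obtain ⟨F₀, hF₀⟩ := summable_iff_vanishing_norm.1 hsum (ε / 2) (by linarith)
    filter_upwards [eventually_ge_atTop F₀] with F hF
    refine lt_of_le_of_lt (seminorm_sum_mulOp_sub_le hφ hψ k n F (ε := ε / 2) (by linarith)
      fun G hG => ?_) (by linarith)
    exact (le_abs_self _).trans (hF₀ G (hG.mono_right hF)).le
  have h2 := (FourierTransform.fourierInvCLM ℂ 𝓢(Space N, ℂ)).hasSum h
  have e : ∀ f : 𝓢(Space N, ℂ),
      FourierTransform.fourierInvCLM ℂ 𝓢(Space N, ℂ) (𝓕 f : 𝓢(Space N, ℂ)) = f := fun f => by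
    change 𝓕⁻ (𝓕 f) = f
    exact FourierTransform.fourierInv_fourier_eq f
  simpa only [e] using h2

theorem hasSum_blockTest (hφ : IsLittlewoodPaley φ) (ψ : 𝒵 N) :
    HasSum (fun j : ℤ => blockTest hφ j ψ) ψ := by
  have h := hasSum_mulOp hφ ψ.2
  exact (Topology.IsInducing.subtypeVal.hasSum_iff (g := (𝒵 N).subtype) (f := fun j : ℤ => blockTest hφ j ψ) (a := ψ)).1 h

theorem hasSum_block (hφ : IsLittlewoodPaley φ) (f : 𝒵' N) (ψ : 𝒵 N) :
    HasSum (fun j : ℤ => block hφ j f ψ) (f ψ) :=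
  f.hasSum (hasSum_blockTest hφ ψ)

theorem eq_zero_of_block_eq_zero (hφ : IsLittlewoodPaley φ) {f : 𝒵' N}
    (h : ∀ j, block hφ j f = 0) : f = 0 := by
  ext ψ
  have := hasSum_block hφ f ψ
  simp only [h] at this
  exact this.unique hasSum_zero

theorem exists_eLpNorm_fat_le (hφ : IsLittlewoodPaley φ) {q : ℝ≥0∞} (hq : 1 ≤ q) (σ : ℝ) :
    ∃ Q : 𝓢(Space N, ℂ) → ℝ, Continuous Q ∧ Q 0 = 0 ∧ ∀ ψ ∈ 𝒵 N, ∀ j : ℤ,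
      eLpNorm (mulOp j (fat φ) ψ) q volume ≤
        (2 : ℝ≥0∞) ^ ((j : ℝ) * σ) * ENNReal.ofReal (Q ψ) := by
  refine exists_eLpNorm_mulOp_le_of_mem (α := 3 / 8) (β := 16 / 3) (by norm_num) (by norm_num)
    (fun η h => ?_) hq σ
  have h1 := fat_ne_zero_norm hφ h
  have := norm_nonneg η
  constructor <;> nlinarith

end Decomposition

/-! ### Frequency localized functionals. -/

section Localized

variable {N : ℕ} {φ : 𝓢(Space N, ℂ)} {p q : ℝ≥0∞}

theorem coe_blockTest (hφ : IsLittlewoodPaley φ) (j : ℤ) (ψ : 𝓢(Space N, ℂ)) :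
    (blockTest hφ j ψ : 𝓢(Space N, ℂ)) = mulOp j φ ψ := rfl

theorem block_apply (hφ : IsLittlewoodPaley φ) (j : ℤ) (f : 𝒵' N) (ψ : 𝓢(Space N, ℂ)) :
    block hφ j f ψ = f (blockTest hφ j ψ) := rfl

theorem block_fat (hφ : IsLittlewoodPaley φ) (j : ℤ) (f : 𝒵' N) (ψ : 𝓢(Space N, ℂ)) :
    block hφ j f (mulOp j (fat φ) ψ) = block hφ j f ψ := by
  rw [block_apply, block_apply]
  congr 1
  exact Subtype.ext (mulOp_fat_block hφ ψ j)

theorem distLpNorm_le_of_localized [ENNReal.HolderConjugate p q] (hp : 1 ≤ p) {j : ℤ}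
    {u : 𝓢(Space N, ℂ) →L[ℂ] ℂ} (hu : ∀ ψ, u (mulOp j (fat φ) ψ) = u ψ) {A : ℝ≥0∞}
    (hA : ∀ ψ, ‖u ψ‖ₑ ≤ A * eLpNorm ψ q volume) (hAt : A ≠ ∞) :
    distLpNorm p u ≤ A * kernelNorm (fat φ) := by
  lift A to ℝ≥0 using hAt
  rw [← eLpNorm_kernel j]
  refine distLpNorm_le_of_forall_le hp hA _ fun ψ => ?_
  rw [← mulOp_eq_convolution, hu]

theorem one_le_of_holderConjugate [ENNReal.HolderConjugate p q] : 1 ≤ q := by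
  have := ENNReal.HolderConjugate.inv_add_inv_eq_one p q
  rw [← ENNReal.inv_le_one, ← this]
  exact le_add_self

end Localized

/-! ### Measurability of pairings with a moving test function. -/

section Pairing

/-- Weak measurability concerns one fixed test function at a time. Rounding the parameter down to
multiples of 1/(n+1) leaves countably many test functions, and continuity of each functional H x
gives the limit. -/
theorem aemeasurable_pairing {N : ℕ} {X : Type*} [MeasurableSpace X] {μ : Measure X} {H : X → 𝒵' N}
    (hH : ∀ ψ : 𝒵 N, AEMeasurable (fun x => H x ψ) μ) {Ψ : ℝ → 𝒵 N} (hΨ : Continuous Ψ)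
    {r : X → ℝ} (hr : Measurable r) : AEMeasurable (fun x => H x (Ψ (r x))) μ := by
  have hlim : ∀ x, Tendsto (fun n : ℕ => H x (Ψ (⌊((n : ℝ) + 1) * r x⌋ / ((n : ℝ) + 1)))) atTop
      (𝓝 (H x (Ψ (r x)))) := by
    intro x
    refine ((H x).continuous.comp hΨ).continuousAt.tendsto.comp ?_
    have h1 : Tendsto (fun n : ℕ => r x - 1 / ((n : ℝ) + 1)) atTop (𝓝 (r x)) := by
      simpa using tendsto_const_nhds.sub (tendsto_one_div_add_atTop_nhds_zero_nat (𝕜 := ℝ))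
    refine tendsto_of_tendsto_of_tendsto_of_le_of_le h1 tendsto_const_nhds (fun n => ?_) fun n => ?_
    · have hn : (0 : ℝ) < (n : ℝ) + 1 := by positivity
      have := Int.sub_one_lt_floor (((n : ℝ) + 1) * r x)
      simp only
      rw [le_div_iff₀ hn, sub_mul, one_div_mul_cancel hn.ne']
      linarith
    · have hn : (0 : ℝ) < (n : ℝ) + 1 := by positivity
      have := Int.floor_le (((n : ℝ) + 1) * r x)
      simp only
      rw [div_le_iff₀ hn]
      linarith
  refine aemeasurable_of_tendsto_metrizable_ae atTop (fun n => ?_) (ae_of_all _ hlim)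
  have hk := fun k : ℤ => hH (Ψ ((k : ℝ) / ((n : ℝ) + 1)))
  have hm : Measurable fun y : X × ℤ => (hk y.2).mk _ y.1 :=
    measurable_from_prod_countable_left fun k => (hk k).measurable_mk
  have hf : Measurable fun x => (x, ⌊((n : ℝ) + 1) * r x⌋) :=
    measurable_id.prodMk (Int.measurable_floor.comp (hr.const_mul _))
  refine ⟨_, hm.comp hf, ?_⟩
  filter_upwards [ae_all_iff.2 fun k => (hk k).ae_eq_mk] with x hx
  exact hx _

end Pairing

/-! ### Duhamel's formula on one frequency block. -/

section Duhamel

variable {N : ℕ} {φ : 𝓢(Space N, ℂ)} {p q : ℝ≥0∞} {κ : ℂ} {C c : ℝ}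

/-- Duhamel's formula for the block of frequency `2^j` of the solution of
`∂_t u = κ Δ u + H`, `u(0) = u₀`. -/
noncomputable def heatBlock (hφ : IsLittlewoodPaley φ) (κ : ℂ) (u₀ : 𝒵' N) (H : ℝ → 𝒵' N) (j : ℤ)
    (t : ℝ) (ψ : 𝓢(Space N, ℂ)) : ℂ :=
  block hφ j u₀ (heatOp hφ κ j t ψ) +
    ∫ s in Ioc 0 t, block hφ j (H s) (heatOp hφ κ j (t - s) ψ)

theorem eLpNorm_heatOp_le (hφ : IsLittlewoodPaley φ)
    (hC : ∀ τ : ℝ, 0 ≤ τ →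
      kernelNorm (heatSym hφ κ τ) ≤ ENNReal.ofReal (C * Real.exp (-(c * τ))))
    (hq : 1 ≤ q) (j : ℤ) {t : ℝ} (ht : 0 ≤ t) (ψ : 𝓢(Space N, ℂ)) :
    eLpNorm (heatOp hφ κ j t ψ) q volume ≤
      ENNReal.ofReal (C * Real.exp (-(c * 4 ^ j * t))) * eLpNorm ψ q volume := by
  refine (eLpNorm_mulOp_le j _ ψ hq).trans ?_
  have := hC ((4 : ℝ) ^ j * t) (by positivity)
  rw [← mul_assoc] at this
  gcongr

theorem enorm_block_heatOp_le [ENNReal.HolderConjugate p q] (hφ : IsLittlewoodPaley φ)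
    (hC : ∀ τ : ℝ, 0 ≤ τ →
      kernelNorm (heatSym hφ κ τ) ≤ ENNReal.ofReal (C * Real.exp (-(c * τ))))
    (j : ℤ) {t : ℝ} (ht : 0 ≤ t) (f : 𝒵' N) (ψ : 𝓢(Space N, ℂ)) :
    ‖block hφ j f (heatOp hφ κ j t ψ)‖ₑ ≤ distLpNorm p (block hφ j f) *
      (ENNReal.ofReal (C * Real.exp (-(c * 4 ^ j * t))) * eLpNorm ψ q volume) :=
  (enorm_apply_le_distLpNorm (p := p) (q := q) _ _).trans
    (mul_le_mul_right (eLpNorm_heatOp_le hφ hC (one_le_of_holderConjugate (p := p)) j ht ψ) _)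

variable {S : Set ℝ} {H : ℝ → 𝒵' N} {h : ℤ → ℝ → ℝ≥0∞} {t : ℝ}

/-- `H` is a weakly measurable function on `S`, whose frequency blocks are bounded in `L^p` by the
measurable functions `h j`. -/
structure IsMajorant (hφ : IsLittlewoodPaley φ) (p : ℝ≥0∞) (S : Set ℝ) (H : ℝ → 𝒵' N)
    (h : ℤ → ℝ → ℝ≥0∞) : Prop where
  pairing : ∀ ψ : 𝒵 N, AEMeasurable (fun t => H t ψ) (volume.restrict S)
  measurable : ∀ j, Measurable (h j)
  le : ∀ j, ∀ᵐ t ∂volume.restrict S, distLpNorm p (block hφ j (H t)) ≤ h j t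

theorem IsMajorant.mono_set {hφ : IsLittlewoodPaley φ} (hH : IsMajorant hφ p S H h) {S' : Set ℝ}
    (hS : S' ⊆ S) : IsMajorant hφ p S' H h where
  pairing ψ := (hH.pairing ψ).mono_set hS
  measurable := hH.measurable
  le j := ae_restrict_of_ae_restrict_of_subset hS (hH.le j)

theorem aemeasurable_block_heatOp {hφ : IsLittlewoodPaley φ} (hH : IsMajorant hφ p S H h) (j : ℤ)
    (ψ : 𝓢(Space N, ℂ)) : AEMeasurable (fun s => block hφ j (H s) (heatOp hφ κ j (t - s) ψ))
      (volume.restrict S) :=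
  aemeasurable_pairing hH.pairing (Ψ := fun r => blockTest hφ j (heatOp hφ κ j r ψ))
    ((blockTest hφ j).continuous.comp (continuous_heatOp hφ κ j ψ)) (r := fun s => t - s)
    (measurable_const.sub measurable_id)

theorem lintegral_block_heatOp_le [ENNReal.HolderConjugate p q] {hφ : IsLittlewoodPaley φ}
    (hC0 : 0 ≤ C)
    (hC : ∀ τ : ℝ, 0 ≤ τ →
      kernelNorm (heatSym hφ κ τ) ≤ ENNReal.ofReal (C * Real.exp (-(c * τ))))
    (hH : IsMajorant hφ p (Ioc 0 t) H h) (j : ℤ) (ψ : 𝓢(Space N, ℂ)) :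
    ∫⁻ s in Ioc 0 t, ‖block hφ j (H s) (heatOp hφ κ j (t - s) ψ)‖ₑ ≤
      ENNReal.ofReal C * duhamel (c * 4 ^ j) (h j) t * eLpNorm ψ q volume := by
  rw [duhamel, ← lintegral_const_mul', mul_comm, ← lintegral_const_mul']
  · refine lintegral_mono_ae ?_
    filter_upwards [hH.le j, ae_restrict_mem measurableSet_Ioc] with s hs hst
    refine (enorm_block_heatOp_le (p := p) (q := q) hφ hC j (sub_nonneg.2 hst.2) (H s) ψ).trans ?_
    rw [ENNReal.ofReal_mul hC0]
    calc _ ≤ h j s * (ENNReal.ofReal C * ENNReal.ofReal (Real.exp (-(c * 4 ^ j * (t - s)))) *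
          eLpNorm ψ q volume) := by gcongr
      _ = _ := by ring
  · exact (ψ.memLp q volume).eLpNorm_ne_top
  · exact ENNReal.ofReal_ne_top

theorem integrableOn_block_heatOp [ENNReal.HolderConjugate p q] {hφ : IsLittlewoodPaley φ}
    (hC0 : 0 ≤ C)
    (hC : ∀ τ : ℝ, 0 ≤ τ →
      kernelNorm (heatSym hφ κ τ) ≤ ENNReal.ofReal (C * Real.exp (-(c * τ))))
    (hH : IsMajorant hφ p (Ioc 0 t) H h) (j : ℤ) (hd : duhamel (c * 4 ^ j) (h j) t ≠ ∞)
    (ψ : 𝓢(Space N, ℂ)) :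
    IntegrableOn (fun s => block hφ j (H s) (heatOp hφ κ j (t - s) ψ)) (Ioc 0 t) := by
  refine ⟨(aemeasurable_block_heatOp hH j ψ).aestronglyMeasurable, ?_⟩
  refine (lintegral_block_heatOp_le (q := q) hC0 hC hH j ψ).trans_lt ?_
  exact (ENNReal.mul_ne_top (ENNReal.mul_ne_top ENNReal.ofReal_ne_top hd)
    (ψ.memLp q volume).eLpNorm_ne_top).lt_top

theorem enorm_heatBlock_le [ENNReal.HolderConjugate p q] {hφ : IsLittlewoodPaley φ}
    (hC0 : 0 ≤ C)
    (hC : ∀ τ : ℝ, 0 ≤ τ →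
      kernelNorm (heatSym hφ κ τ) ≤ ENNReal.ofReal (C * Real.exp (-(c * τ))))
    (hH : IsMajorant hφ p (Ioc 0 t) H h) (u₀ : 𝒵' N) (ht : 0 ≤ t) (j : ℤ) (ψ : 𝓢(Space N, ℂ)) :
    ‖heatBlock hφ κ u₀ H j t ψ‖ₑ ≤ ENNReal.ofReal C *
      (ENNReal.ofReal (Real.exp (-(c * 4 ^ j * t))) * distLpNorm p (block hφ j u₀) +
        duhamel (c * 4 ^ j) (h j) t) * eLpNorm ψ q volume := by
  have h1 := enorm_block_heatOp_le (p := p) (q := q) hφ hC j ht u₀ ψ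
  have h2 := (enorm_integral_le_lintegral_enorm _).trans
    (lintegral_block_heatOp_le (q := q) hC0 hC hH j ψ)
  refine (enorm_add_le _ _).trans ((add_le_add h1 h2).trans (le_of_eq ?_))
  rw [ENNReal.ofReal_mul hC0]
  ring

theorem heatBlock_fat (hφ : IsLittlewoodPaley φ) (κ : ℂ) (u₀ : 𝒵' N) (H : ℝ → 𝒵' N) (j : ℤ) (t : ℝ)
    (ψ : 𝓢(Space N, ℂ)) :
    heatBlock hφ κ u₀ H j t (mulOp j (fat φ) ψ) = heatBlock hφ κ u₀ H j t ψ := by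
  simp only [heatBlock, heatOp_mulOp, block_fat]

theorem block_heatOp_swap (hφ : IsLittlewoodPaley φ) (κ : ℂ) (f : 𝒵' N) (i j : ℤ) (t : ℝ)
    (ψ : 𝓢(Space N, ℂ)) :
    block hφ j f (heatOp hφ κ j t (mulOp i φ ψ)) = block hφ i f (heatOp hφ κ i t (mulOp j φ ψ)) := by
  rw [block_apply, block_apply]
  congr 1
  exact Subtype.ext (mulOp_heatOp_swap hφ κ i j t ψ)

theorem heatBlock_swap (hφ : IsLittlewoodPaley φ) (κ : ℂ) (u₀ : 𝒵' N) (H : ℝ → 𝒵' N) (i j : ℤ)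
    (t : ℝ) (ψ : 𝓢(Space N, ℂ)) :
    heatBlock hφ κ u₀ H j t (mulOp i φ ψ) = heatBlock hφ κ u₀ H i t (mulOp j φ ψ) := by
  simp only [heatBlock, block_heatOp_swap hφ κ _ i j]

theorem heatBlock_mulOp_eq_zero (hφ : IsLittlewoodPaley φ) (κ : ℂ) (u₀ : 𝒵' N) (H : ℝ → 𝒵' N)
    {i j : ℤ} (hij : j ∉ ({i - 1, i, i + 1} : Finset ℤ)) (t : ℝ) (ψ : 𝓢(Space N, ℂ)) :
    heatBlock hφ κ u₀ H j t (mulOp i φ ψ) = 0 := by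
  have key : ∀ (f : 𝒵' N) (r : ℝ), block hφ j f (heatOp hφ κ j r (mulOp i φ ψ)) = 0 := by
    intro f r
    have : blockTest hφ j (heatOp hφ κ j r (mulOp i φ ψ)) = 0 := by
      refine Subtype.ext ?_
      rw [coe_blockTest, heatOp_mulOp, mulOp_mulOp_eq_zero hφ hij]
      rfl
    rw [block_apply, this, map_zero]
  simp only [heatBlock, key, integral_zero, add_zero]

theorem heatBlock_add [ENNReal.HolderConjugate p q] {hφ : IsLittlewoodPaley φ} (hC0 : 0 ≤ C)
    (hC : ∀ τ : ℝ, 0 ≤ τ →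
      kernelNorm (heatSym hφ κ τ) ≤ ENNReal.ofReal (C * Real.exp (-(c * τ))))
    (hH : IsMajorant hφ p (Ioc 0 t) H h) (u₀ : 𝒵' N) (j : ℤ)
    (hd : duhamel (c * 4 ^ j) (h j) t ≠ ∞) (ψ ψ' : 𝓢(Space N, ℂ)) :
    heatBlock hφ κ u₀ H j t (ψ + ψ') = heatBlock hφ κ u₀ H j t ψ + heatBlock hφ κ u₀ H j t ψ' := by
  simp only [heatBlock, map_add]
  rw [integral_add (integrableOn_block_heatOp (q := q) hC0 hC hH j hd ψ)
    (integrableOn_block_heatOp (q := q) hC0 hC hH j hd ψ')]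
  ring

theorem heatBlock_smul (hφ : IsLittlewoodPaley φ) (κ : ℂ) (u₀ : 𝒵' N) (H : ℝ → 𝒵' N) (j : ℤ) (t : ℝ)
    (a : ℂ) (ψ : 𝓢(Space N, ℂ)) :
    heatBlock hφ κ u₀ H j t (a • ψ) = a * heatBlock hφ κ u₀ H j t ψ := by
  simp only [heatBlock, map_smul, smul_eq_mul, integral_const_mul]
  ring

/-- The fundamental theorem of calculus for the heat flow started at time s; at elapsed time 0 the
flow is the fat cutoff, which a block does not see. -/
theorem block_heatOp_eq_add_integral (hφ : IsLittlewoodPaley φ) (κ : ℂ) (f : 𝒵' N) (j : ℤ) (s t : ℝ)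
    (ψ : 𝓢(Space N, ℂ)) :
    block hφ j f (heatOp hφ κ j (t - s) ψ) = block hφ j f ψ +
      ∫ τ in s..t, block hφ j f (heatOp hφ κ j (τ - s) (κ • lapS ψ)) := by
  have hd : ∀ τ ∈ uIcc s t, HasDerivAt (fun τ => block hφ j f (heatOp hφ κ j (τ - s) ψ))
      (block hφ j f (heatOp hφ κ j (τ - s) (κ • lapS ψ))) τ := fun τ _ => by
    have := (hasDerivAt_heatOp hφ κ j ψ (block hφ j f) (τ - s)).comp_sub_const τ s
    exact this
  have hc : Continuous fun τ => block hφ j f (heatOp hφ κ j (τ - s) (κ • lapS ψ)) :=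
    (block hφ j f).continuous.comp
      ((continuous_heatOp hφ κ j (κ • lapS ψ)).comp (continuous_id.sub continuous_const))
  rw [intervalIntegral.integral_eq_sub_of_hasDerivAt hd (hc.intervalIntegrable _ _), sub_self,
    heatOp_zero, block_fat]
  ring

end Duhamel

/-! ### Each Duhamel block satisfies the integrated heat equation. -/

section Evolution

variable {N : ℕ} {φ : 𝓢(Space N, ℂ)} {p q : ℝ≥0∞} {κ : ℂ} {C c : ℝ}
  {H : ℝ → 𝒵' N} {h : ℤ → ℝ → ℝ≥0∞} {t : ℝ}

theorem duhamel_le_lintegral (hc : 0 ≤ c) (g : ℝ → ℝ≥0∞) (t : ℝ) :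
    duhamel c g t ≤ ∫⁻ s in Ioc 0 t, g s := by
  refine setLIntegral_mono' measurableSet_Ioc fun s hs => ?_
  refine mul_le_of_le_one_left zero_le ?_
  rw [ENNReal.ofReal_le_one, Real.exp_le_one_iff, neg_nonpos]
  exact mul_nonneg hc (sub_nonneg.2 hs.2)

theorem lintegral_enorm_block_le [ENNReal.HolderConjugate p q] {hφ : IsLittlewoodPaley φ} {S : Set ℝ}
    (hH : IsMajorant hφ p S H h) (j : ℤ) (ψ : 𝓢(Space N, ℂ)) :
    ∫⁻ s in S, ‖block hφ j (H s) ψ‖ₑ ≤ (∫⁻ s in S, h j s) * eLpNorm (mulOp j (fat φ) ψ) q volume := by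
  rw [← lintegral_mul_const' _ _ ((mulOp j (fat φ) ψ).memLp q volume).eLpNorm_ne_top]
  refine lintegral_mono_ae ?_
  filter_upwards [hH.le j] with s hs
  rw [← block_fat]
  refine (enorm_apply_le_distLpNorm (p := p) (q := q) _ _).trans ?_
  gcongr

theorem integrableOn_block [ENNReal.HolderConjugate p q] {hφ : IsLittlewoodPaley φ} {S : Set ℝ}
    (hH : IsMajorant hφ p S H h) (j : ℤ) (hI : ∫⁻ s in S, h j s ≠ ∞) (ψ : 𝓢(Space N, ℂ)) :
    IntegrableOn (fun s => block hφ j (H s) ψ) S := by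
  refine ⟨(hH.pairing _).aestronglyMeasurable, ?_⟩
  refine (lintegral_enorm_block_le (q := q) hH j ψ).trans_lt ?_
  exact (ENNReal.mul_ne_top hI ((mulOp j (fat φ) ψ).memLp q volume).eLpNorm_ne_top).lt_top

/-- The Fubini hypothesis on the triangle s < τ. The indicator is essential: the flow is bounded by
the constant C only for nonnegative elapsed time τ - s. -/
theorem integrable_triangle [ENNReal.HolderConjugate p q] {hφ : IsLittlewoodPaley φ}
    (hC0 : 0 ≤ C) (hc : 0 ≤ c)
    (hC : ∀ τ : ℝ, 0 ≤ τ →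
      kernelNorm (heatSym hφ κ τ) ≤ ENNReal.ofReal (C * Real.exp (-(c * τ))))
    (hH : IsMajorant hφ p (Ioc 0 t) H h) (j : ℤ) (hI : ∫⁻ s in Ioc 0 t, h j s ≠ ∞)
    (χ : 𝓢(Space N, ℂ)) :
    Integrable (Function.uncurry fun τ s => (Iio τ).indicator
      (fun s => block hφ j (H s) (heatOp hφ κ j (τ - s) χ)) s)
      ((volume.restrict (Ioc 0 t)).prod (volume.restrict (Ioc 0 t))) := by
  set μ : Measure ℝ := volume.restrict (Ioc 0 t)
  have e : (Function.uncurry fun τ s => (Iio τ).indicator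
      (fun s => block hφ j (H s) (heatOp hφ κ j (τ - s) χ)) s) =
      {x : ℝ × ℝ | x.2 < x.1}.indicator
        fun x => block hφ j (H x.2) (heatOp hφ κ j (x.1 - x.2) χ) := by
    ext ⟨τ, s⟩
    simp [Function.uncurry, indicator]
  rw [e]
  have hm : AEMeasurable (fun x : ℝ × ℝ => block hφ j (H x.2) (heatOp hφ κ j (x.1 - x.2) χ))
      (μ.prod μ) :=
    aemeasurable_pairing (H := fun x : ℝ × ℝ => H x.2)
      (fun ψ => (hH.pairing ψ).comp_quasiMeasurePreserving Measure.quasiMeasurePreserving_snd)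
      (Ψ := fun r => blockTest hφ j (heatOp hφ κ j r χ))
      ((blockTest hφ j).continuous.comp (continuous_heatOp hφ κ j χ)) (r := fun x => x.1 - x.2)
      (measurable_fst.sub measurable_snd)
  refine ⟨(hm.indicator (measurableSet_lt measurable_snd measurable_fst)).aestronglyMeasurable, ?_⟩
  set K : ℝ≥0∞ := ENNReal.ofReal C * eLpNorm χ q volume
  have hK : K ≠ ∞ := ENNReal.mul_ne_top ENNReal.ofReal_ne_top (χ.memLp q volume).eLpNorm_ne_top
  have hle : ∀ᵐ x ∂μ.prod μ, ‖{x : ℝ × ℝ | x.2 < x.1}.indicator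
      (fun x => block hφ j (H x.2) (heatOp hφ κ j (x.1 - x.2) χ)) x‖ₑ ≤ h j x.2 * K := by
    filter_upwards [Measure.quasiMeasurePreserving_snd.ae (hH.le j)] with x hx
    by_cases hlt : x.2 < x.1
    · rw [indicator_of_mem (by exact hlt)]
      have h0 : 0 ≤ x.1 - x.2 := (sub_pos.2 hlt).le
      refine (enorm_block_heatOp_le (p := p) (q := q) hφ hC j h0 (H x.2) χ).trans ?_
      have : ENNReal.ofReal (C * Real.exp (-(c * 4 ^ j * (x.1 - x.2)))) ≤ ENNReal.ofReal C := by
        apply ENNReal.ofReal_le_ofReal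
        refine mul_le_of_le_one_right hC0 ?_
        rw [Real.exp_le_one_iff, neg_nonpos]
        positivity
      exact mul_le_mul' hx (mul_le_mul_left this _)
    · rw [indicator_of_notMem (by exact hlt), enorm_zero]
      exact zero_le
  refine (lintegral_mono_ae hle).trans_lt ?_
  have hm2 : Measurable fun x : ℝ × ℝ => h j x.2 * K :=
    ((hH.measurable j).comp measurable_snd).mul_const K
  rw [lintegral_prod _ hm2.aemeasurable]
  simp only
  rw [lintegral_const, lintegral_mul_const' _ _ hK]
  refine (ENNReal.mul_ne_top (ENNReal.mul_ne_top hI hK) ?_).lt_top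
  simp [μ]

theorem heatBlock_eq_add_integral [ENNReal.HolderConjugate p q] {hφ : IsLittlewoodPaley φ}
    (hC0 : 0 ≤ C) (hc : 0 < c)
    (hC : ∀ τ : ℝ, 0 ≤ τ →
      kernelNorm (heatSym hφ κ τ) ≤ ENNReal.ofReal (C * Real.exp (-(c * τ))))
    (ht : 0 ≤ t) (hH : IsMajorant hφ p (Ioc 0 t) H h) (u₀ : 𝒵' N) (j : ℤ)
    (hI : ∫⁻ s in Ioc 0 t, h j s ≠ ∞) (ψ : 𝓢(Space N, ℂ)) :
    IntegrableOn (fun τ => heatBlock hφ κ u₀ H j τ (κ • lapS ψ)) (Ioc 0 t) ∧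
      heatBlock hφ κ u₀ H j t ψ = block hφ j u₀ ψ +
        ((∫ τ in Ioc 0 t, block hφ j (H τ) ψ) +
          ∫ τ in Ioc 0 t, heatBlock hφ κ u₀ H j τ (κ • lapS ψ)) := by
  set χ : 𝓢(Space N, ℂ) := κ • lapS ψ with hχ
  set g : ℝ → ℝ → ℂ := fun τ s => block hφ j (H s) (heatOp hφ κ j (τ - s) χ) with hg
  have hF := integrable_triangle (q := q) hC0 hc.le hC hH j hI χ
  have hd : duhamel (c * 4 ^ j) (h j) t ≠ ∞ :=
    ((duhamel_le_lintegral (by positivity) _ t).trans_lt hI.lt_top).ne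
  have inner_s : ∀ τ ∈ Ioc 0 t, ∫ s in Ioc 0 t, (Iio τ).indicator (g τ) s = ∫ s in Ioc 0 τ, g τ s := by
    intro τ hτ
    rw [setIntegral_indicator measurableSet_Iio, integral_Ioc_eq_integral_Ioo]
    congr 2
    ext s
    simp only [mem_inter_iff, mem_Ioc, mem_Iio, mem_Ioo]
    have := hτ.2
    constructor
    · rintro ⟨⟨h1, h2⟩, h3⟩; exact ⟨h1, h3⟩
    · rintro ⟨h1, h2⟩; exact ⟨⟨h1, by linarith⟩, h2⟩
  have inner_τ : ∀ s ∈ Ioc 0 t, ∫ τ in Ioc 0 t, (Iio τ).indicator (g τ) s = ∫ τ in s..t, g τ s := by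
    intro s hs
    have : ∀ τ, (Iio τ).indicator (g τ) s = (Ioi s).indicator (fun τ => g τ s) τ := fun τ => by
      simp [indicator]
    simp only [this]
    rw [setIntegral_indicator measurableSet_Ioi, intervalIntegral.integral_of_le hs.2]
    congr 2
    ext τ
    simp only [mem_inter_iff, mem_Ioc, mem_Ioi]
    have := hs.1
    constructor
    · rintro ⟨⟨h1, h2⟩, h3⟩; exact ⟨h3, h2⟩
    · rintro ⟨h1, h2⟩; exact ⟨⟨by linarith, h2⟩, h1⟩
  have hcont : Continuous fun τ => block hφ j u₀ (heatOp hφ κ j τ χ) :=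
    (block hφ j u₀).continuous.comp (continuous_heatOp hφ κ j χ)
  have i1 : IntegrableOn (fun τ => block hφ j u₀ (heatOp hφ κ j τ χ)) (Ioc 0 t) :=
    (hcont.integrableOn_Icc (a := 0) (b := t)).mono_set Ioc_subset_Icc_self
  have i2 : IntegrableOn (fun τ => ∫ s in Ioc 0 τ, g τ s) (Ioc 0 t) := by
    refine hF.integral_prod_left.congr ?_
    filter_upwards [ae_restrict_mem measurableSet_Ioc] with τ hτ
    exact inner_s τ hτ
  refine ⟨i1.add i2, ?_⟩
  -- Fubini: the increments of the flow started at each s, integrated over s, are the time integral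
  -- of κΔ applied to the Duhamel term.
  have swap : ∫ s in Ioc 0 t, ∫ τ in s..t, g τ s = ∫ τ in Ioc 0 t, ∫ s in Ioc 0 τ, g τ s := by
    rw [← setIntegral_congr_fun measurableSet_Ioc inner_s,
      ← setIntegral_congr_fun measurableSet_Ioc inner_τ]
    exact (integral_integral_swap hF).symm
  have j1 : IntegrableOn (fun s => block hφ j (H s) ψ) (Ioc 0 t) := integrableOn_block (q := q) hH j hI ψ
  have j2 : IntegrableOn (fun s => ∫ τ in s..t, g τ s) (Ioc 0 t) := by
    refine hF.integral_prod_right.congr ?_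
    filter_upwards [ae_restrict_mem measurableSet_Ioc] with s hs
    exact inner_τ s hs
  have e1 := block_heatOp_eq_add_integral hφ κ u₀ j 0 t ψ
  simp only [sub_zero] at e1
  rw [intervalIntegral.integral_of_le ht] at e1
  have e2 : ∫ s in Ioc 0 t, block hφ j (H s) (heatOp hφ κ j (t - s) ψ) =
      (∫ s in Ioc 0 t, block hφ j (H s) ψ) + ∫ s in Ioc 0 t, ∫ τ in s..t, g τ s := by
    rw [← integral_add j1 j2]
    exact integral_congr_ae (ae_of_all _ fun s => block_heatOp_eq_add_integral hφ κ (H s) j s t ψ)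
  have e3 : ∫ τ in Ioc 0 t, heatBlock hφ κ u₀ H j τ χ =
      (∫ τ in Ioc 0 t, block hφ j u₀ (heatOp hφ κ j τ χ)) +
        ∫ τ in Ioc 0 t, ∫ s in Ioc 0 τ, g τ s := integral_add i1 i2
  rw [e3, heatBlock, e1, e2, swap]
  ring

end Evolution

/-! ### Summing localized functionals to an element of 𝒵'. -/

section Sum

variable {N : ℕ} {φ : 𝓢(Space N, ℂ)} {p q : ℝ≥0∞}

theorem summable_of_tsum_enorm_ne_top {ι : Type*} {f : ι → ℂ} (h : ∑' i, ‖f i‖ₑ ≠ ∞) : Summable f := by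
  have := ENNReal.summable_toReal h
  simp only [toReal_enorm] at this
  exact this.of_norm

theorem two_rpow_ne_zero (x : ℝ) : (2 : ℝ≥0∞) ^ x ≠ 0 :=
  (ENNReal.rpow_pos (by norm_num) (by norm_num)).ne'

theorem two_rpow_ne_top (x : ℝ) : (2 : ℝ≥0∞) ^ x ≠ ∞ :=
  ENNReal.rpow_ne_top_of_ne_zero (by norm_num) (by norm_num)

theorem ne_top_of_tsum_two_rpow {ι : Type*} {w : ι → ℝ} {A : ι → ℝ≥0∞}
    (hA : ∑' j, (2 : ℝ≥0∞) ^ w j * A j ≠ ∞) (j : ι) : A j ≠ ∞ := fun h => by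
  have := ENNReal.ne_top_of_tsum_ne_top hA j
  rw [h, ENNReal.mul_top (two_rpow_ne_zero _)] at this
  exact this rfl

/-- Frequency localized functionals with summable norms sum up to an element of `𝒵'`. -/
theorem exists_hasSum_functional (hφ : IsLittlewoodPaley φ) (hq : 1 ≤ q) {σ : ℝ}
    (V : ℤ → 𝓢(Space N, ℂ) →ₗ[ℂ] ℂ) {A : ℤ → ℝ≥0∞}
    (hV : ∀ j ψ, ‖V j ψ‖ₑ ≤ A j * eLpNorm (mulOp j (fat φ) ψ) q volume)
    (hA : ∑' j : ℤ, (2 : ℝ≥0∞) ^ ((j : ℝ) * σ) * A j ≠ ∞) :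
    ∃ f : 𝒵' N, ∀ ψ : 𝒵 N, HasSum (fun j => V j ψ) (f ψ) := by
  -- Any weight 2^{jσ} is affordable, because the blocks of a test function decay faster than every
  -- power; Q is continuous with Q 0 = 0, which yields continuity of the sum.
  obtain ⟨Q, hQc, hQ0, hQ⟩ := exists_eLpNorm_fat_le hφ hq σ
  set B := ∑' j : ℤ, (2 : ℝ≥0∞) ^ ((j : ℝ) * σ) * A j
  have hb : ∀ ψ : 𝒵 N, ∑' j, ‖V j ψ‖ₑ ≤ B * ENNReal.ofReal (Q ψ) := fun ψ => by
    rw [← ENNReal.tsum_mul_right]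
    refine ENNReal.tsum_le_tsum fun j => (hV j ψ).trans ?_
    calc _ ≤ A j * ((2 : ℝ≥0∞) ^ ((j : ℝ) * σ) * ENNReal.ofReal (Q ψ)) := by
          gcongr
          exact hQ ψ ψ.2 j
      _ = _ := by ring
  have hs : ∀ ψ : 𝒵 N, Summable fun j => V j ψ := fun ψ =>
    summable_of_tsum_enorm_ne_top
      ((hb ψ).trans_lt (ENNReal.mul_ne_top hA ENNReal.ofReal_ne_top).lt_top).ne
  let f : 𝒵 N →ₗ[ℂ] ℂ :=
    { toFun := fun ψ => ∑' j, V j ψ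
      map_add' := fun a b => by
        simp only [Submodule.coe_add, map_add]
        exact (hs a).tsum_add (hs b)
      map_smul' := fun a b => by
        simp only [Submodule.coe_smul, map_smul, smul_eq_mul, RingHom.id_apply]
        exact tsum_mul_left }
  have hf : ∀ ψ, ‖f ψ‖ₑ ≤ B * ENNReal.ofReal (Q ψ) := fun ψ =>
    enorm_tsum_le_tsum_enorm.trans (hb ψ)
  have hcont : Continuous f := by
    refine continuous_of_continuousAt_zero f ?_
    rw [ContinuousAt, map_zero, tendsto_iff_enorm_sub_tendsto_zero]
    simp only [sub_zero]
    have h1 : Tendsto (fun ψ : 𝒵 N => B * ENNReal.ofReal (Q ψ)) (𝓝 0) (𝓝 (B * ENNReal.ofReal (Q 0))) := by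
      refine ENNReal.Tendsto.const_mul ?_ (Or.inr hA)
      have : Continuous fun ψ : 𝒵 N => ENNReal.ofReal (Q ψ) :=
        ENNReal.continuous_ofReal.comp (hQc.comp continuous_subtype_val)
      simpa using this.tendsto 0
    rw [hQ0, ENNReal.ofReal_zero, mul_zero] at h1
    exact tendsto_of_tendsto_of_tendsto_of_le_of_le tendsto_const_nhds h1 (fun _ => zero_le) hf
  exact ⟨⟨f, hcont⟩, fun ψ => (hs ψ).hasSum⟩

end Sum

/-! ### The blocks sum up to a solution of the scalar heat equation. -/

section Existence

variable {N : ℕ} {φ : 𝓢(Space N, ℂ)} {p q : ℝ≥0∞} {κ : ℂ} {C c : ℝ}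
  {H : ℝ → 𝒵' N} {h : ℤ → ℝ → ℝ≥0∞}

theorem hasSum_integral_of_tsum_lintegral {ι X : Type*} [Countable ι] [MeasurableSpace X]
    {μ : Measure X} {F : ι → X → ℂ} (hF : ∀ i, Integrable (F i) μ)
    (hsum : ∑' i, ∫⁻ x, ‖F i x‖ₑ ∂μ ≠ ∞) {f : X → ℂ} (hf : ∀ᵐ x ∂μ, HasSum (fun i => F i x) (f x)) :
    Integrable f μ ∧ HasSum (fun i => ∫ x, F i x ∂μ) (∫ x, f x ∂μ) := by
  have hm : AEStronglyMeasurable f μ :=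
    aestronglyMeasurable_of_tendsto_ae atTop
      (f := fun s : Finset ι => fun x => ∑ i ∈ s, F i x)
      (fun s => Finset.aestronglyMeasurable_fun_sum s fun i _ => (hF i).1) (by
        filter_upwards [hf] with x hx
        exact hx)
  have hle : ∫⁻ x, ‖f x‖ₑ ∂μ ≤ ∑' i, ∫⁻ x, ‖F i x‖ₑ ∂μ := by
    rw [← lintegral_tsum fun i => (hF i).1.enorm]
    refine lintegral_mono_ae ?_
    filter_upwards [hf] with x hx
    rw [← hx.tsum_eq]
    exact enorm_tsum_le_tsum_enorm
  refine ⟨⟨hm, hle.trans_lt hsum.lt_top⟩, ?_⟩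
  have h1 : Summable fun i => ∫ x, ‖F i x‖ ∂μ := by
    have := ENNReal.summable_toReal hsum
    refine this.congr fun i => ?_
    rw [integral_norm_eq_lintegral_enorm (hF i).1]
  have h2 := hasSum_integral_of_summable_integral_norm hF h1
  have h3 : ∫ x, f x ∂μ = ∫ x, ∑' i, F i x ∂μ := by
    refine integral_congr_ae ?_
    filter_upwards [hf] with x hx
    exact hx.tsum_eq.symm
  rwa [h3]

/-- Duhamel's formula solves the heat equation `∂_t u = κ Δ u + H` in `𝒵'`. -/
theorem exists_heat_solution [ENNReal.HolderConjugate p q] (hφ : IsLittlewoodPaley φ)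
    (hC0 : 0 ≤ C) (hc : 0 < c)
    (hC : ∀ τ : ℝ, 0 ≤ τ →
      kernelNorm (heatSym hφ κ τ) ≤ ENNReal.ofReal (C * Real.exp (-(c * τ))))
    {T : ℝ≥0∞} (hH : IsMajorant hφ p (timeInterval T) H h) (u₀ : 𝒵' N) {A : ℤ → ℝ≥0∞} {σ σ' : ℝ}
    (hA : ∀ t ∈ timeInterval T, ∀ j, ENNReal.ofReal (Real.exp (-(c * 4 ^ j * t))) *
      distLpNorm p (block hφ j u₀) + duhamel (c * 4 ^ j) (h j) t ≤ A j)
    (hAs : ∑' j : ℤ, (2 : ℝ≥0∞) ^ ((j : ℝ) * σ) * A j ≠ ∞)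
    (hI : ∀ t ∈ timeInterval T,
      ∑' j : ℤ, (2 : ℝ≥0∞) ^ ((j : ℝ) * σ') * ∫⁻ s in Ioc 0 t, h j s ≠ ∞) :
    ∃ u : ℝ → 𝒵' N, SolvesEvolution T u₀ (fun t => H t + κ • lap (u t)) u ∧
      ∀ t ∈ timeInterval T, ∀ j ψ, block hφ j (u t) ψ = heatBlock hφ κ u₀ H j t ψ := by
  have hq : 1 ≤ q := one_le_of_holderConjugate (p := p)
  have hsub : ∀ t ∈ timeInterval T, Ioc 0 t ⊆ timeInterval T := fun t ht =>
    Ioc_subset_Icc_self.trans (Icc_subset_timeInterval ht)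
  have hHt : ∀ t ∈ timeInterval T, IsMajorant hφ p (Ioc 0 t) H h := fun t ht =>
    hH.mono_set (hsub t ht)
  have hIj : ∀ t ∈ timeInterval T, ∀ j, ∫⁻ s in Ioc 0 t, h j s ≠ ∞ := fun t ht j =>
    ne_top_of_tsum_two_rpow (hI t ht) j
  have hd : ∀ t ∈ timeInterval T, ∀ j, duhamel (c * 4 ^ j) (h j) t ≠ ∞ := fun t ht j =>
    ((duhamel_le_lintegral (by positivity) _ t).trans_lt (hIj t ht j).lt_top).ne
  have hbd : ∀ t ∈ timeInterval T, ∀ j ψ, ‖heatBlock hφ κ u₀ H j t ψ‖ₑ ≤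
      ENNReal.ofReal C * A j * eLpNorm (mulOp j (fat φ) ψ) q volume := fun t ht j ψ => by
    rw [← heatBlock_fat]
    refine (enorm_heatBlock_le (p := p) (q := q) hC0 hC (hHt t ht) u₀ ht.1 j _).trans ?_
    have := hA t ht j
    gcongr
  have hAs' : ∑' j : ℤ, (2 : ℝ≥0∞) ^ ((j : ℝ) * σ) * (ENNReal.ofReal C * A j) ≠ ∞ := by
    have : ∀ j : ℤ, (2 : ℝ≥0∞) ^ ((j : ℝ) * σ) * (ENNReal.ofReal C * A j) =
        ENNReal.ofReal C * ((2 : ℝ≥0∞) ^ ((j : ℝ) * σ) * A j) := fun j => by ring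
    simp only [this, ENNReal.tsum_mul_left]
    exact ENNReal.mul_ne_top ENNReal.ofReal_ne_top hAs
  have hex : ∀ t, ∃ f : 𝒵' N, t ∈ timeInterval T →
      ∀ ψ : 𝒵 N, HasSum (fun j => heatBlock hφ κ u₀ H j t ψ) (f ψ) := fun t => by
    by_cases ht : t ∈ timeInterval T
    · let V : ℤ → 𝓢(Space N, ℂ) →ₗ[ℂ] ℂ := fun j =>
        { toFun := heatBlock hφ κ u₀ H j t
          map_add' := heatBlock_add (p := p) (q := q) hC0 hC (hHt t ht) u₀ j (hd t ht j)
          map_smul' := heatBlock_smul hφ κ u₀ H j t }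
      obtain ⟨f, hf⟩ := exists_hasSum_functional hφ hq V (hbd t ht) hAs'
      exact ⟨f, fun _ => hf⟩
    · exact ⟨0, fun h => absurd h ht⟩
  choose u hu using hex
  refine ⟨u, fun t ht ψ => ?_, fun t ht i ψ => ?_⟩
  · set χ : 𝒵 N := κ • lapTest N ψ with hχ
    have hχc : (χ : 𝓢(Space N, ℂ)) = κ • lapS (ψ : 𝓢(Space N, ℂ)) := rfl
    have ev := fun j => heatBlock_eq_add_integral (p := p) (q := q) hC0 hc hC ht.1 (hHt t ht) u₀ j
      (hIj t ht j) ψ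
    -- The block equations are summed over j under the time integral: here for the source, in the
    -- weight σ', and next for the solution, in the weight σ.
    have s1 := hasSum_integral_of_tsum_lintegral (μ := volume.restrict (Ioc 0 t))
      (F := fun (j : ℤ) τ => block hφ j (H τ) ψ) (f := fun τ => H τ ψ)
      (fun j => integrableOn_block (q := q) (hHt t ht) j (hIj t ht j) ψ) (by
        obtain ⟨Q, -, -, hQ⟩ := exists_eLpNorm_fat_le hφ hq σ'
        have : ∑' j : ℤ, ∫⁻ τ in Ioc 0 t, ‖block hφ j (H τ) ψ‖ₑ ≤
            (∑' j : ℤ, (2 : ℝ≥0∞) ^ ((j : ℝ) * σ') * ∫⁻ s in Ioc 0 t, h j s) *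
              ENNReal.ofReal (Q ψ) := by
          rw [← ENNReal.tsum_mul_right]
          refine ENNReal.tsum_le_tsum fun j => ?_
          refine (lintegral_enorm_block_le (q := q) (hHt t ht) j ψ).trans ?_
          calc _ ≤ (∫⁻ s in Ioc 0 t, h j s) *
                ((2 : ℝ≥0∞) ^ ((j : ℝ) * σ') * ENNReal.ofReal (Q ψ)) := by
                gcongr
                exact hQ ψ ψ.2 j
            _ = _ := by ring
        exact (this.trans_lt (ENNReal.mul_ne_top (hI t ht) ENNReal.ofReal_ne_top).lt_top).ne)
      (ae_of_all _ fun τ => hasSum_block hφ (H τ) ψ)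
    have s2 := hasSum_integral_of_tsum_lintegral (μ := volume.restrict (Ioc 0 t))
      (F := fun (j : ℤ) τ => heatBlock hφ κ u₀ H j τ χ) (f := fun τ => u τ χ)
      (fun j => (ev j).1) (by
        obtain ⟨Q, -, -, hQ⟩ := exists_eLpNorm_fat_le hφ hq σ
        have : ∑' j : ℤ, ∫⁻ τ in Ioc 0 t, ‖heatBlock hφ κ u₀ H j τ χ‖ₑ ≤
            (∑' j : ℤ, (2 : ℝ≥0∞) ^ ((j : ℝ) * σ) * (ENNReal.ofReal C * A j)) *
              (ENNReal.ofReal (Q χ) * ENNReal.ofReal t) := by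
          rw [← ENNReal.tsum_mul_right]
          refine ENNReal.tsum_le_tsum fun j => ?_
          calc ∫⁻ τ in Ioc 0 t, ‖heatBlock hφ κ u₀ H j τ χ‖ₑ
              ≤ ∫⁻ _ in Ioc 0 t, ENNReal.ofReal C * A j *
                  ((2 : ℝ≥0∞) ^ ((j : ℝ) * σ) * ENNReal.ofReal (Q χ)) := by
                refine setLIntegral_mono' measurableSet_Ioc fun τ hτ => ?_
                refine (hbd τ (hsub t ht hτ) j χ).trans ?_
                gcongr
                exact hQ χ χ.2 j
            _ = _ := by
                rw [setLIntegral_const, Real.volume_Ioc, sub_zero]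
                ring
        exact (this.trans_lt (ENNReal.mul_ne_top hAs'
          (ENNReal.mul_ne_top ENNReal.ofReal_ne_top ENNReal.ofReal_ne_top)).lt_top).ne) (by
        filter_upwards [ae_restrict_mem measurableSet_Ioc] with τ hτ
        exact hu τ (hsub t ht hτ) χ)
    have e : ∀ τ, (H τ + κ • lap (u τ)) ψ = H τ ψ + u τ χ := fun τ => by
      rw [hχ, map_smul]
      rfl
    simp only [e]
    refine ⟨?_, ?_⟩
    · rw [intervalIntegrable_iff_integrableOn_Ioc_of_le ht.1]
      exact s1.1.add s2.1
    · rw [intervalIntegral.integral_of_le ht.1, integral_add s1.1 s2.1]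
      have h1 := hu t ht ψ
      have h2 := (hasSum_block hφ u₀ ψ).add (s1.2.add s2.2)
      refine h1.unique (h2.congr_fun ?_)
      intro j
      exact (ev j).2
  · have h1 := hu t ht (blockTest hφ i ψ)
    rw [block_apply]
    -- Only the blocks i-1, i, i+1 see the i-th cutoff. Swapping indices puts the cutoffs on the
    -- test function inside the i-th block, where they add up to the fat cutoff and disappear.
    have h2 : HasSum (fun j => heatBlock hφ κ u₀ H j t (blockTest hφ i ψ))
        (∑ j ∈ ({i - 1, i, i + 1} : Finset ℤ), heatBlock hφ κ u₀ H j t (mulOp i φ ψ)) :=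
      hasSum_sum_of_ne_finset_zero fun j hj => heatBlock_mulOp_eq_zero hφ κ u₀ H hj t ψ
    rw [h1.unique h2]
    simp only [heatBlock_swap hφ κ u₀ H i]
    have h3 := heatBlock_fat hφ κ u₀ H i t ψ
    rw [mulOp_fat] at h3
    rw [← h3]
    let V : 𝓢(Space N, ℂ) →ₗ[ℂ] ℂ :=
      { toFun := heatBlock hφ κ u₀ H i t
        map_add' := heatBlock_add (p := p) (q := q) hC0 hC (hHt t ht) u₀ i (hd t ht i)
        map_smul' := heatBlock_smul hφ κ u₀ H i t }
    exact (map_sum V (fun j => mulOp j φ ψ) _).symm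

end Existence

/-! ### The Laplacian on a frequency block. -/

section Block

variable {N : ℕ} {φ : 𝓢(Space N, ℂ)} {p q : ℝ≥0∞}

theorem block_add (hφ : IsLittlewoodPaley φ) (j : ℤ) (f g : 𝒵' N) :
    block hφ j (f + g) = block hφ j f + block hφ j g := rfl

theorem block_sub (hφ : IsLittlewoodPaley φ) (j : ℤ) (f g : 𝒵' N) :
    block hφ j (f - g) = block hφ j f - block hφ j g := rfl

theorem block_smul (hφ : IsLittlewoodPaley φ) (j : ℤ) (a : ℂ) (f : 𝒵' N) :
    block hφ j (a • f) = a • block hφ j f := rfl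

theorem block_lap (hφ : IsLittlewoodPaley φ) (j : ℤ) (f : 𝒵' N) (ψ : 𝓢(Space N, ℂ)) :
    block hφ j (lap f) ψ = block hφ j f (lapS ψ) := by
  change f (lapTest N (blockTest hφ j ψ)) = f (blockTest hφ j (lapS ψ))
  congr 1
  exact Subtype.ext (lapS_mulOp j φ ψ)

theorem block_lapS (hφ : IsLittlewoodPaley φ) (j : ℤ) (f : 𝒵' N) (ψ : 𝓢(Space N, ℂ)) :
    block hφ j f (lapS ψ) =
      ((4 : ℝ) ^ j : ℂ) * block hφ j f (mulOp j (lapSymbol (fat φ)) ψ) := by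
  rw [← block_fat, mulOp_lapS, map_smul, smul_eq_mul]

theorem ofReal_four_zpow (j : ℤ) : ENNReal.ofReal ((4 : ℝ) ^ j) = (2 : ℝ≥0∞) ^ ((j : ℝ) * 2) := by
  rw [show (2 : ℝ≥0∞) = ENNReal.ofReal 2 by simp, ENNReal.ofReal_rpow_of_pos two_pos, mul_comm,
    Real.rpow_mul two_pos.le, Real.rpow_intCast]
  norm_num

theorem enorm_block_lapS_le [ENNReal.HolderConjugate p q] (hφ : IsLittlewoodPaley φ) (j : ℤ)
    (f : 𝒵' N) (ψ : 𝓢(Space N, ℂ)) :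
    ‖block hφ j f (lapS ψ)‖ₑ ≤ ENNReal.ofReal ((4 : ℝ) ^ j) * kernelNorm (lapSymbol (fat φ)) *
      distLpNorm p (block hφ j f) * eLpNorm ψ q volume := by
  have hq : 1 ≤ q := one_le_of_holderConjugate (p := p)
  have e : ‖((4 : ℝ) ^ j : ℂ)‖ₑ = ENNReal.ofReal ((4 : ℝ) ^ j) := by
    rw [← ofReal_norm, norm_zpow, Complex.norm_real, Real.norm_ofNat]
  rw [block_lapS, enorm_mul, e]
  calc _ ≤ ENNReal.ofReal ((4 : ℝ) ^ j) * (distLpNorm p (block hφ j f) *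
        (kernelNorm (lapSymbol (fat φ)) * eLpNorm ψ q volume)) := by
        gcongr
        refine (enorm_apply_le_distLpNorm (p := p) (q := q) _ _).trans ?_
        gcongr
        exact eLpNorm_mulOp_le j _ ψ hq
    _ = _ := by ring

/-- The norm of the Laplacian on a frequency block. -/
noncomputable def lapConst (φ : 𝓢(Space N, ℂ)) : ℝ≥0∞ :=
  kernelNorm (lapSymbol (fat φ)) * kernelNorm (fat φ) + 1

theorem lapConst_ne_top (φ : 𝓢(Space N, ℂ)) : lapConst φ ≠ ∞ :=
  ENNReal.add_ne_top.2 ⟨ENNReal.mul_ne_top (kernelNorm_lt_top _).ne (kernelNorm_lt_top _).ne,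
    ENNReal.one_ne_top⟩

theorem distLpNorm_block_lap_le (hp : 1 ≤ p) (hφ : IsLittlewoodPaley φ) (j : ℤ) (f : 𝒵' N) :
    distLpNorm p (block hφ j (lap f)) ≤
      lapConst φ * (2 : ℝ≥0∞) ^ ((j : ℝ) * 2) * distLpNorm p (block hφ j f) := by
  have : ENNReal.HolderConjugate p p.conjExponent := ENNReal.HolderConjugate.conjExponent hp
  rcases eq_or_ne (distLpNorm p (block hφ j f)) ∞ with h | h
  · rw [h, ENNReal.mul_top]
    · exact le_top
    · exact mul_ne_zero (by simp [lapConst]) (two_rpow_ne_zero _)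
  rw [← ofReal_four_zpow]
  refine (distLpNorm_le_of_localized (q := p.conjExponent) (j := j) hp
    (fun ψ => block_fat hφ j (lap f) ψ)
    (fun ψ => by
      rw [block_lap]
      exact enorm_block_lapS_le (p := p) hφ j f ψ) ?_).trans ?_
  · exact ENNReal.mul_ne_top (ENNReal.mul_ne_top ENNReal.ofReal_ne_top (kernelNorm_lt_top _).ne) h
  · calc _ = kernelNorm (lapSymbol (fat φ)) * kernelNorm (fat φ) * ENNReal.ofReal ((4 : ℝ) ^ j) *
          distLpNorm p (block hφ j f) := by ring
      _ ≤ _ := by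
        gcongr
        exact le_self_add

end Block

/-! ### Integrals over the time interval and their continuity. -/

section TimeInterval

variable {T : ℝ≥0∞} {t : ℝ}

/-- Integrability is known only up to times inside the interval. Near t a single t₁ suffices: any
later time, or t itself at the right endpoint. -/
theorem exists_mem_timeInterval_eventually_le (ht : t ∈ timeInterval T) :
    ∃ t₁ ∈ timeInterval T, t ≤ t₁ ∧ ∀ᶠ t' in 𝓝[timeInterval T] t, t' ≤ t₁ := by
  by_cases h : ∃ t₁ ∈ timeInterval T, t < t₁
  · obtain ⟨t₁, h1, h2⟩ := h
    exact ⟨t₁, h1, h2.le, nhdsWithin_le_nhds ((eventually_lt_nhds h2).mono fun _ h => h.le)⟩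
  · push Not at h
    exact ⟨t, ht, le_rfl, eventually_mem_nhdsWithin.mono h⟩

theorem continuousOn_primitive_timeInterval {f : ℝ → ℂ}
    (hf : ∀ t ∈ timeInterval T, IntervalIntegrable f volume 0 t) :
    ContinuousOn (fun t => ∫ τ in (0 : ℝ)..t, f τ) (timeInterval T) := by
  intro t ht
  obtain ⟨t₁, ht₁, htt, hev⟩ := exists_mem_timeInterval_eventually_le ht
  have h1 := intervalIntegral.continuousOn_primitive_interval' (hf t₁ ht₁) left_mem_uIcc
  rw [uIcc_of_le ht₁.1] at h1
  refine (h1 t ⟨ht.1, htt⟩).mono_of_mem_nhdsWithin ?_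
  filter_upwards [hev, eventually_mem_nhdsWithin] with x hx hx2
  exact ⟨hx2.1, hx⟩

theorem tendsto_lintegral_uIoc {r : ℝ → ℝ≥0∞}
    (hr : ∀ t ∈ timeInterval T, ∫⁻ s in Ioc 0 t, r s ≠ ∞) (ht : t ∈ timeInterval T) :
    Tendsto (fun t' => ∫⁻ s in uIoc t t', r s) (𝓝[timeInterval T] t) (𝓝 0) := by
  obtain ⟨t₁, ht₁, htt, hev⟩ := exists_mem_timeInterval_eventually_le ht
  have h1 : Tendsto (fun t' => (volume.restrict (Ioc 0 t₁)) (uIoc t t')) (𝓝[timeInterval T] t)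
      (𝓝 0) := by
    have h2 : Tendsto (fun t' : ℝ => ENNReal.ofReal |t' - t|) (𝓝[timeInterval T] t) (𝓝 0) := by
      have : Continuous fun t' : ℝ => ENNReal.ofReal |t' - t| :=
        ENNReal.continuous_ofReal.comp (by fun_prop)
      simpa using (this.tendsto t).mono_left nhdsWithin_le_nhds
    refine tendsto_of_tendsto_of_tendsto_of_le_of_le tendsto_const_nhds h2 (fun _ => zero_le)
      fun t' => ?_
    refine (Measure.restrict_apply_le _ _).trans ?_
    rw [uIoc, Real.volume_Ioc, max_sub_min_eq_abs]
  refine (tendsto_setLIntegral_zero (hr t₁ ht₁) h1).congr' ?_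
  filter_upwards [hev, eventually_mem_nhdsWithin] with x hx hx2
  rw [Measure.restrict_restrict measurableSet_uIoc]
  congr 2
  rw [inter_eq_left]
  intro y hy
  rw [uIoc, mem_Ioc] at hy
  exact ⟨lt_of_le_of_lt (le_min ht.1 hx2.1) hy.1, hy.2.trans (max_le htt hx)⟩

end TimeInterval

/-! ### Continuity in time with values in the Besov space. -/

section TimeContinuity

variable {N : ℕ} {φ : 𝓢(Space N, ℂ)} {p q : ℝ≥0∞} {T : ℝ≥0∞} {u₀ : 𝒵' N} {R u : ℝ → 𝒵' N}

theorem SolvesEvolution.sub_apply (hu : SolvesEvolution T u₀ R u) {t t' : ℝ}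
    (ht : t ∈ timeInterval T) (ht' : t' ∈ timeInterval T) (ψ : 𝒵 N) :
    (u t' - u t) ψ = ∫ τ in t..t', R τ ψ := by
  rw [_root_.sub_apply, (hu t ht ψ).2, (hu t' ht' ψ).2,
    ← intervalIntegral.integral_interval_sub_left (hu t' ht' ψ).1 (hu t ht ψ).1]
  ring

/-- The increment is the time integral of R only weakly; pairing with a test function gives the
bound in the L^q norm, and localization converts it into an L^p bound at the price of the fat
kernel. -/
theorem SolvesEvolution.distLpNorm_sub_le (hp : 1 ≤ p) (hφ : IsLittlewoodPaley φ)
    (hu : SolvesEvolution T u₀ R u) {j : ℤ} {r : ℝ → ℝ≥0∞}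
    (hr : ∀ᵐ τ ∂volume.restrict (timeInterval T), distLpNorm p (block hφ j (R τ)) ≤ r τ)
    (hrt : ∀ t ∈ timeInterval T, ∫⁻ s in Ioc 0 t, r s ≠ ∞) {t t' : ℝ}
    (ht : t ∈ timeInterval T) (ht' : t' ∈ timeInterval T) :
    distLpNorm p (block hφ j (u t' - u t)) ≤ (∫⁻ s in uIoc t t', r s) * kernelNorm (fat φ) := by
  have : ENNReal.HolderConjugate p p.conjExponent := ENNReal.HolderConjugate.conjExponent hp
  have hmax : max t t' ∈ timeInterval T := by
    rcases max_choice t t' with h | h <;> rw [h] <;> assumption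
  have hsub0 : uIoc t t' ⊆ Ioc 0 (max t t') := fun y hy => by
    rw [uIoc, mem_Ioc] at hy
    exact ⟨lt_of_le_of_lt (le_min ht.1 ht'.1) hy.1, hy.2⟩
  have hsub : uIoc t t' ⊆ timeInterval T :=
    hsub0.trans (Ioc_subset_Icc_self.trans (Icc_subset_timeInterval hmax))
  refine distLpNorm_le_of_localized (q := p.conjExponent) (j := j) hp
    (fun ψ => block_fat hφ j (u t' - u t) ψ) (fun ψ => ?_)
    ((lintegral_mono_set hsub0).trans_lt (hrt _ hmax).lt_top).ne
  rw [block_apply, hu.sub_apply ht ht', ← lintegral_mul_const' _ _ (ψ.memLp _ volume).eLpNorm_ne_top]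
  rw [← ofReal_norm, intervalIntegral.norm_intervalIntegral_eq, ofReal_norm]
  refine (enorm_integral_le_lintegral_enorm _).trans (lintegral_mono_ae ?_)
  filter_upwards [ae_restrict_of_ae_restrict_of_subset hsub hr] with τ hτ
  refine (enorm_apply_le_distLpNorm (p := p) (q := p.conjExponent) (block hφ j (R τ)) ψ).trans ?_
  gcongr

theorem tendsto_tsum_of_dominated {ι α : Type*} [Countable ι] {l : Filter α} [l.IsCountablyGenerated]
    {F : α → ι → ℝ≥0∞} {bound : ι → ℝ≥0∞} (hb : ∑' i, bound i ≠ ∞)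
    (hF : ∀ᶠ a in l, ∀ i, F a i ≤ bound i) (h : ∀ i, Tendsto (fun a => F a i) l (𝓝 0)) :
    Tendsto (fun a => ∑' i, F a i) l (𝓝 0) := by
  let _ : MeasurableSpace ι := ⊤
  have : MeasurableSingletonClass ι := ⟨fun _ => trivial⟩
  have key := tendsto_lintegral_filter_of_dominated_convergence (μ := Measure.count) (l := l)
    (F := F) (f := fun _ => 0) bound (Eventually.of_forall fun a => measurable_from_top)
    (hF.mono fun a ha => ae_of_all _ ha) (by rwa [lintegral_count]) (ae_of_all _ h)
  simpa [lintegral_count] using key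

theorem blockTimeNorm_top_le (hφ : IsLittlewoodPaley φ) {j : ℤ} {B : ℝ≥0∞}
    (hB : ∀ t ∈ timeInterval T, distLpNorm p (block hφ j (u t)) ≤ B) :
    blockTimeNorm hφ T ∞ p j u ≤ B := by
  refine eLpNorm_top_le_of_ae ?_
  filter_upwards [ae_restrict_mem (measurableSet_timeInterval T)] with t ht
  exact hB t ht

/-- A bounded solution of an evolution equation with locally integrable right-hand side is
continuous in time. -/
theorem SolvesEvolution.memCLCont (hp : 1 ≤ p) (hφ : IsLittlewoodPaley φ)
    (hu : SolvesEvolution T u₀ R u) {r : ℤ → ℝ → ℝ≥0∞}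
    (hr : ∀ j, ∀ᵐ τ ∂volume.restrict (timeInterval T), distLpNorm p (block hφ j (R τ)) ≤ r j τ)
    (hrt : ∀ j, ∀ t ∈ timeInterval T, ∫⁻ s in Ioc 0 t, r j s ≠ ∞)
    {B : ℤ → ℝ≥0∞} {s : ℝ} (hB : ∀ t ∈ timeInterval T, ∀ j, distLpNorm p (block hφ j (u t)) ≤ B j)
    (hBs : ∑' j : ℤ, (2 : ℝ≥0∞) ^ ((j : ℝ) * s) * B j ≠ ∞) : MemCLCont hφ T p s u := by
  have hBj : ∀ j, B j ≠ ∞ := ne_top_of_tsum_two_rpow hBs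
  have hD : ∀ j, ∀ t ∈ timeInterval T,
      Tendsto (fun t' => distLpNorm p (block hφ j (u t' - u t))) (𝓝[timeInterval T] t) (𝓝 0) := by
    intro j t ht
    have h1 := ENNReal.Tendsto.mul_const (b := kernelNorm (fat φ)) (tendsto_lintegral_uIoc (hrt j) ht)
      (Or.inr (kernelNorm_lt_top _).ne)
    rw [zero_mul] at h1
    refine tendsto_of_tendsto_of_tendsto_of_le_of_le' tendsto_const_nhds h1
      (Eventually.of_forall fun _ => zero_le) ?_
    filter_upwards [eventually_mem_nhdsWithin] with t' ht'
    exact hu.distLpNorm_sub_le hp hφ (hr j) (hrt j) ht ht'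
  have hcont : ∀ j, ContinuousOn (fun t => distLpNorm p (block hφ j (u t))) (timeInterval T) := by
    intro j t ht
    have hf : distLpNorm p (block hφ j (u t)) ≠ ∞ := ((hB t ht j).trans_lt (hBj j).lt_top).ne
    have h1 := ENNReal.Tendsto.sub (tendsto_const_nhds (x := distLpNorm p (block hφ j (u t))))
      (hD j t ht) (Or.inl hf)
    have h2 := (tendsto_const_nhds (x := distLpNorm p (block hφ j (u t)))).add (hD j t ht)
    rw [tsub_zero] at h1
    rw [add_zero] at h2
    refine tendsto_of_tendsto_of_tendsto_of_le_of_le h1 h2 (fun t' => ?_) fun t' => ?_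
    · rw [tsub_le_iff_right]
      have e : block hφ j (u t) = block hφ j (u t') - block hφ j (u t' - u t) := by
        rw [block_sub]; abel
      calc _ = distLpNorm p (block hφ j (u t') - block hφ j (u t' - u t)) := by rw [← e]
        _ ≤ _ := CoupledSystem.distLpNorm_sub_le hp _ _
    · have e : block hφ j (u t') = block hφ j (u t) + block hφ j (u t' - u t) := by
        rw [block_sub]; abel
      calc _ = distLpNorm p (block hφ j (u t) + block hφ j (u t' - u t)) := by rw [← e]
        _ ≤ _ := distLpNorm_add_le hp _ _
  have hS := measurableSet_timeInterval T
  have hpair : ∀ ψ : 𝒵 N, AEMeasurable (fun t => u t ψ) (volume.restrict (timeInterval T)) := by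
    intro ψ
    have h1 : ContinuousOn (fun t => u₀ ψ + ∫ τ in (0 : ℝ)..t, R τ ψ) (timeInterval T) :=
      continuousOn_const.add (continuousOn_primitive_timeInterval fun t ht => (hu t ht ψ).1)
    exact (h1.congr fun t ht => (hu t ht ψ).2).aemeasurable hS
  have hCL : clNorm hφ T ∞ p s u < ∞ :=
    lt_of_le_of_lt (ENNReal.tsum_le_tsum fun j => mul_le_mul_right
      (blockTimeNorm_top_le hφ fun t ht => hB t ht j) _) hBs.lt_top
  have hbes : ∀ t ∈ timeInterval T, besovNorm hφ p s (u t) < ∞ := fun t ht =>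
    lt_of_le_of_lt (ENNReal.tsum_le_tsum fun j => mul_le_mul_right (hB t ht j) _) hBs.lt_top
  refine ⟨⟨hpair, fun j => (hcont j).aemeasurable hS, hCL⟩, hbes, fun t ht => ?_⟩
  have h2 : ∑' j : ℤ, (2 : ℝ≥0∞) ^ ((j : ℝ) * s) * (B j + B j) ≠ ∞ := by
    simp only [mul_add, ENNReal.tsum_add]
    exact ENNReal.add_ne_top.2 ⟨hBs, hBs⟩
  refine tendsto_tsum_of_dominated h2 ?_ fun j => ?_
  · filter_upwards [eventually_mem_nhdsWithin] with t' ht' j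
    exact mul_le_mul_right ((CoupledSystem.distLpNorm_sub_le hp _ _).trans
      (add_le_add (hB t' ht' j) (hB t ht j))) _
  · have := ENNReal.Tendsto.const_mul (a := (2 : ℝ≥0∞) ^ ((j : ℝ) * s)) (hD j t ht)
      (Or.inr (two_rpow_ne_top _))
    rwa [mul_zero] at this

end TimeContinuity

/-! ### Uniqueness by iterating the integral equation on each block. -/

section Uniqueness

variable {N : ℕ} {φ : 𝓢(Space N, ℂ)} {p q : ℝ≥0∞} {T : ℝ≥0∞} {ν : ℝ} {d e : ℝ → 𝒵' N}

theorem SolvesEvolution.sub {u₀ u₀' : 𝒵' N} {R R' u u' : ℝ → 𝒵' N}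
    (h : SolvesEvolution T u₀ R u) (h' : SolvesEvolution T u₀' R' u') :
    SolvesEvolution T (u₀ - u₀') (fun t => R t - R' t) (fun t => u t - u' t) := fun t ht ψ => by
  refine ⟨(h t ht ψ).1.sub (h' t ht ψ).1, ?_⟩
  have := intervalIntegral.integral_sub (h t ht ψ).1 (h' t ht ψ).1
  simp only [_root_.sub_apply]
  rw [this, (h t ht ψ).2, (h' t ht ψ).2]
  ring

theorem norm_block_lapS_le (hφ : IsLittlewoodPaley φ) (hq : 1 ≤ q) (j : ℤ) (f : 𝒵' N) {M : ℝ}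
    (hM0 : 0 ≤ M)
    (hM : ∀ ψ, ‖block hφ j f ψ‖ ≤ M * (eLpNorm ψ q volume).toReal) (ψ : 𝓢(Space N, ℂ)) :
    ‖block hφ j f (lapS ψ)‖ ≤
      (4 : ℝ) ^ j * (kernelNorm (lapSymbol (fat φ))).toReal * M * (eLpNorm ψ q volume).toReal := by
  rw [block_lapS, norm_mul]
  have e : ‖((4 : ℝ) ^ j : ℂ)‖ = (4 : ℝ) ^ j := by
    rw [norm_zpow, Complex.norm_real, Real.norm_ofNat]
  have h1 := ENNReal.toReal_mono (ENNReal.mul_ne_top (kernelNorm_lt_top _).ne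
    (ψ.memLp q volume).eLpNorm_ne_top) (eLpNorm_mulOp_le j (lapSymbol (fat φ)) ψ hq)
  rw [ENNReal.toReal_mul] at h1
  rw [e]
  calc _ ≤ (4 : ℝ) ^ j * (M * ((kernelNorm (lapSymbol (fat φ))).toReal *
        (eLpNorm ψ q volume).toReal)) := by
        gcongr
        exact (hM _).trans (by gcongr)
    _ = _ := by ring

theorem norm_integral_le_pow_div_factorial {f : ℝ → ℂ} {t A K : ℝ} (n : ℕ) (ht : 0 ≤ t)
    (hf : ∀ᵐ τ ∂volume.restrict (Ioc 0 t), ‖f τ‖ ≤ K * (A * ((K * τ) ^ n / n.factorial))) :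
    ‖∫ τ in (0 : ℝ)..t, f τ‖ ≤ A * ((K * t) ^ (n + 1) / (n + 1).factorial) := by
  have h1 := intervalIntegral.norm_integral_le_of_norm_le (μ := volume) ht
    ((ae_restrict_iff' measurableSet_Ioc).1 hf)
    (Continuous.intervalIntegrable (by fun_prop) _ _)
  refine h1.trans (le_of_eq ?_)
  have : ∀ τ : ℝ, K * (A * ((K * τ) ^ n / n.factorial)) =
      K ^ (n + 1) * A / n.factorial * τ ^ n := fun τ => by
    rw [mul_pow, pow_succ]; ring
  simp only [this]
  rw [intervalIntegral.integral_const_mul, integral_pow, Nat.factorial_succ, mul_pow]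
  have h2 : (n.factorial : ℝ) ≠ 0 := by positivity
  push_cast
  field_simp
  simp

/-- On block j the Laplacian is bounded by k, a multiple of 4^j, and K = (1 + |ν|)k dominates the
coefficients of both equations; one time integration raises the power. A bound for almost every time
returns at every time. -/
theorem picard_step (hφ : IsLittlewoodPaley φ) (hq : 1 ≤ q)
    (hd : SolvesEvolution T 0 (fun t => -lap (e t)) d)
    (he : SolvesEvolution T 0 (fun t => (ν : ℂ) • lap (e t) + lap (d t)) e) (j : ℤ) {B : ℝ}
    (hB : 0 ≤ B) (n : ℕ) {K : ℝ}
    (hK : K = (1 + |ν|) * ((4 : ℝ) ^ j * (kernelNorm (lapSymbol (fat φ))).toReal))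
    (h : ∀ᵐ τ ∂volume.restrict (timeInterval T), ∀ ψ,
      ‖block hφ j (d τ) ψ‖ ≤ B * ((K * τ) ^ n / n.factorial) * (eLpNorm ψ q volume).toReal ∧
      ‖block hφ j (e τ) ψ‖ ≤ B * ((K * τ) ^ n / n.factorial) * (eLpNorm ψ q volume).toReal)
    {t : ℝ} (ht : t ∈ timeInterval T) (ψ : 𝓢(Space N, ℂ)) :
    ‖block hφ j (d t) ψ‖ ≤
        B * ((K * t) ^ (n + 1) / (n + 1).factorial) * (eLpNorm ψ q volume).toReal ∧
      ‖block hφ j (e t) ψ‖ ≤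
        B * ((K * t) ^ (n + 1) / (n + 1).factorial) * (eLpNorm ψ q volume).toReal := by
  set k := (4 : ℝ) ^ j * (kernelNorm (lapSymbol (fat φ))).toReal with hk
  have hk0 : 0 ≤ k := by positivity
  have hK0 : 0 ≤ K := by rw [hK]; positivity
  set m := (eLpNorm ψ q volume).toReal with hm
  have hm0 : 0 ≤ m := ENNReal.toReal_nonneg
  have hsub : Ioc 0 t ⊆ timeInterval T := Ioc_subset_Icc_self.trans (Icc_subset_timeInterval ht)
  have key : ∀ᵐ τ ∂volume.restrict (Ioc 0 t),
      ‖block hφ j (d τ) (lapS ψ)‖ ≤ k * (B * m * ((K * τ) ^ n / n.factorial)) ∧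
      ‖block hφ j (e τ) (lapS ψ)‖ ≤ k * (B * m * ((K * τ) ^ n / n.factorial)) := by
    filter_upwards [ae_restrict_of_ae_restrict_of_subset hsub h,
      ae_restrict_mem measurableSet_Ioc] with τ hτ hτ0
    have h0 : 0 ≤ B * ((K * τ) ^ n / n.factorial) := by
      have := hτ0.1.le
      positivity
    have h1 := norm_block_lapS_le hφ hq j (d τ) h0 (fun ψ => (hτ ψ).1) ψ
    have h2 := norm_block_lapS_le hφ hq j (e τ) h0 (fun ψ => (hτ ψ).2) ψ
    exact ⟨h1.trans (le_of_eq (by rw [hk, hm]; ring)), h2.trans (le_of_eq (by rw [hk, hm]; ring))⟩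
  have ed : block hφ j (d t) ψ = ∫ τ in (0 : ℝ)..t, -block hφ j (e τ) (lapS ψ) := by
    rw [block_apply, (hd t ht _).2]
    simp only [_root_.zero_apply, zero_add]
    refine intervalIntegral.integral_congr fun τ _ => ?_
    simp only [_root_.neg_apply]
    rw [← block_lap]
    rfl
  have ee : block hφ j (e t) ψ =
      ∫ τ in (0 : ℝ)..t, (ν * block hφ j (e τ) (lapS ψ) + block hφ j (d τ) (lapS ψ)) := by
    rw [block_apply, (he t ht _).2]
    simp only [_root_.zero_apply, zero_add]
    refine intervalIntegral.integral_congr fun τ _ => ?_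
    rw [← block_lap, ← block_lap]
    rfl
  constructor
  · rw [ed, mul_right_comm]
    refine norm_integral_le_pow_div_factorial n ht.1 ?_
    filter_upwards [key, ae_restrict_mem measurableSet_Ioc] with τ hτ hτ0
    rw [norm_neg]
    have := hτ0.1.le
    have h3 : k ≤ K := by rw [hK]; nlinarith [abs_nonneg ν]
    exact hτ.2.trans (by gcongr)
  · rw [ee, mul_right_comm]
    refine norm_integral_le_pow_div_factorial n ht.1 ?_
    filter_upwards [key] with τ hτ
    refine (norm_add_le _ _).trans ?_
    rw [norm_mul, Complex.norm_real, Real.norm_eq_abs]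
    have := mul_le_mul_of_nonneg_left hτ.2 (abs_nonneg ν)
    calc _ ≤ |ν| * (k * (B * m * ((K * τ) ^ n / n.factorial))) +
          k * (B * m * ((K * τ) ^ n / n.factorial)) := add_le_add this hτ.1
      _ = (1 + |ν|) * k * (B * m * ((K * τ) ^ n / n.factorial)) := by ring
      _ = _ := by rw [hK]

theorem eq_zero_of_solvesEvolution (hp : 1 ≤ p) (hφ : IsLittlewoodPaley φ)
    (hd : SolvesEvolution T 0 (fun t => -lap (e t)) d)
    (he : SolvesEvolution T 0 (fun t => (ν : ℂ) • lap (e t) + lap (d t)) e)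
    (hb : ∀ j, ∃ B : ℝ≥0, ∀ᵐ τ ∂volume.restrict (timeInterval T),
      distLpNorm p (block hφ j (d τ)) ≤ B ∧ distLpNorm p (block hφ j (e τ)) ≤ B)
    {t : ℝ} (ht : t ∈ timeInterval T) : d t = 0 ∧ e t = 0 := by
  have : ENNReal.HolderConjugate p p.conjExponent := ENNReal.HolderConjugate.conjExponent hp
  set q := p.conjExponent
  have hq : 1 ≤ q := one_le_of_holderConjugate (p := p)
  suffices ∀ j ψ, block hφ j (d t) ψ = 0 ∧ block hφ j (e t) ψ = 0 from
    ⟨eq_zero_of_block_eq_zero hφ fun j => ContinuousLinearMap.ext fun ψ => (this j ψ).1,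
      eq_zero_of_block_eq_zero hφ fun j => ContinuousLinearMap.ext fun ψ => (this j ψ).2⟩
  intro j ψ
  obtain ⟨B, hB⟩ := hb j
  set K := (1 + |ν|) * ((4 : ℝ) ^ j * (kernelNorm (lapSymbol (fat φ))).toReal) with hK
  have real_bound : ∀ (f : 𝒵' N), distLpNorm p (block hφ j f) ≤ B → ∀ ψ,
      ‖block hφ j f ψ‖ ≤ B * (eLpNorm ψ q volume).toReal := by
    intro f hf ψ
    have h1 := (enorm_apply_le_distLpNorm (p := p) (q := q) (block hφ j f) ψ).trans
      (mul_le_mul_left hf _)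
    have h2 := ENNReal.toReal_mono (ENNReal.mul_ne_top ENNReal.coe_ne_top
      (ψ.memLp q volume).eLpNorm_ne_top) h1
    rwa [toReal_enorm, ENNReal.toReal_mul, ENNReal.coe_toReal] at h2
  have step := fun n => picard_step (B := B) hφ hq hd he j B.2 n hK
  have all : ∀ n : ℕ, ∀ᵐ τ ∂volume.restrict (timeInterval T), ∀ ψ,
      ‖block hφ j (d τ) ψ‖ ≤ B * ((K * τ) ^ n / n.factorial) * (eLpNorm ψ q volume).toReal ∧
      ‖block hφ j (e τ) ψ‖ ≤ B * ((K * τ) ^ n / n.factorial) * (eLpNorm ψ q volume).toReal := by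
    intro n
    induction n with
    | zero =>
      filter_upwards [hB] with τ hτ ψ
      simpa using ⟨real_bound _ hτ.1 ψ, real_bound _ hτ.2 ψ⟩
    | succ n ih =>
      filter_upwards [ae_restrict_mem (measurableSet_timeInterval T)] with τ hτ ψ
      exact step n ih hτ ψ
  have lim : Tendsto (fun n : ℕ => B * ((K * t) ^ (n + 1) / (n + 1).factorial) *
      (eLpNorm ψ q volume).toReal) atTop (𝓝 0) := by
    have h1 := (FloorSemiring.tendsto_pow_div_factorial_atTop (K * t)).comp (tendsto_add_atTop_nat 1)
    have h2 := (h1.const_mul (B : ℝ)).mul_const (eLpNorm ψ q volume).toReal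
    simpa using h2
  exact ⟨norm_le_zero_iff.1 (ge_of_tendsto' lim fun n => (step n (all n) ht ψ).1),
    norm_le_zero_iff.1 (ge_of_tendsto' lim fun n => (step n (all n) ht ψ).2)⟩

end Uniqueness

/-! ### Powers of the damping rates c 4^j and dyadic weights. -/

section Weights

theorem measurable_duhamel (c : ℝ) {h : ℝ → ℝ≥0∞} (hh : Measurable h) : Measurable (duhamel c h) := by
  have e : duhamel c h = fun t => ∫⁻ s, {x : ℝ × ℝ | 0 < x.2 ∧ x.2 ≤ x.1}.indicator
      (fun x => ENNReal.ofReal (Real.exp (-(c * (x.1 - x.2)))) * h x.2) (t, s) := by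
    ext t
    rw [duhamel, ← lintegral_indicator measurableSet_Ioc]
    rfl
  rw [e]
  refine Measurable.lintegral_prod_right' (f := {x : ℝ × ℝ | 0 < x.2 ∧ x.2 ≤ x.1}.indicator
      (fun x => ENNReal.ofReal (Real.exp (-(c * (x.1 - x.2)))) * h x.2)) ?_
  refine Measurable.indicator ?_
    ((measurableSet_lt measurable_const measurable_snd).inter
      (measurableSet_le measurable_snd measurable_fst))
  exact (by fun_prop : Measurable fun x : ℝ × ℝ =>
    ENNReal.ofReal (Real.exp (-(c * (x.1 - x.2))))).mul (hh.comp measurable_snd)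

theorem two_div_toReal (ρ : ℝ≥0∞) : (2 / ρ).toReal = 2 * ρ⁻¹.toReal := by
  rw [div_eq_mul_inv, ENNReal.toReal_mul, ENNReal.toReal_ofNat]

theorem toReal_inv_le_one {ρ : ℝ≥0∞} (hρ : 1 ≤ ρ) : ρ⁻¹.toReal ≤ 1 := by
  have := ENNReal.toReal_mono ENNReal.one_ne_top (ENNReal.inv_le_one.2 hρ)
  simpa using this

theorem toReal_inv_le_toReal_inv {ρ ρ₁ : ℝ≥0∞} (hρ : 1 ≤ ρ) (h : ρ ≤ ρ₁) :
    ρ₁⁻¹.toReal ≤ ρ⁻¹.toReal :=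
  ENNReal.toReal_mono (ENNReal.inv_ne_top.2 (one_pos.trans_le hρ).ne') (ENNReal.inv_le_inv.2 h)

/-- The constant in the powers of the damping rates `c 4^j`. -/
noncomputable def rateConst (c : ℝ) : ℝ≥0∞ := ENNReal.ofReal (max 1 c⁻¹)

theorem one_le_rateConst (c : ℝ) : 1 ≤ rateConst c := by
  rw [rateConst, ENNReal.one_le_ofReal]
  exact le_max_left _ _

/-- As θ stays in [0, 1], the power of 1/c is bounded by max(1, 1/c); hence the constants do not
depend on the time exponents. -/
theorem ofReal_rate_rpow_le {c : ℝ} (hc : 0 < c) (j : ℤ) {θ : ℝ} (h0 : 0 ≤ θ) (h1 : θ ≤ 1) :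
    ENNReal.ofReal (c * 4 ^ j)⁻¹ ^ θ ≤ rateConst c * (2 : ℝ≥0∞) ^ ((j : ℝ) * -(2 * θ)) := by
  have e1 : ENNReal.ofReal ((4 : ℝ) ^ j)⁻¹ ^ θ = (2 : ℝ≥0∞) ^ ((j : ℝ) * -(2 * θ)) := by
    rw [ENNReal.ofReal_inv_of_pos (by positivity), ofReal_four_zpow, ← ENNReal.rpow_neg,
      ← ENNReal.rpow_mul]
    congr 1
    ring
  rw [mul_inv, ENNReal.ofReal_mul (by positivity), ENNReal.mul_rpow_of_nonneg _ _ h0, e1]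
  gcongr
  calc ENNReal.ofReal c⁻¹ ^ θ ≤ rateConst c ^ θ := by
        gcongr
        exact ENNReal.ofReal_le_ofReal (le_max_right _ _)
    _ ≤ rateConst c ^ (1 : ℝ) := ENNReal.rpow_le_rpow_of_exponent_le (one_le_rateConst c) h1
    _ = _ := ENNReal.rpow_one _

theorem two_rpow_add (x y : ℝ) : (2 : ℝ≥0∞) ^ (x + y) = (2 : ℝ≥0∞) ^ x * (2 : ℝ≥0∞) ^ y :=
  ENNReal.rpow_add _ _ (by norm_num) (by norm_num)

theorem eLpNorm_const_mul_le {X : Type*} [MeasurableSpace X] {a : ℝ≥0∞} (ha : a ≠ ∞) (k : X → ℝ≥0∞)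
    (ρ : ℝ≥0∞) (μ : Measure X) : eLpNorm (fun t => a * k t) ρ μ ≤ a * eLpNorm k ρ μ := by
  lift a to ℝ≥0 using ha
  exact eLpNorm_le_nnreal_smul_eLpNorm_of_ae_le_mul' (f := fun t => (a : ℝ≥0∞) * k t) (g := k)
    (c := a) (ae_of_all _ fun t => by simp) ρ

/-- Local integrability follows from the damped bound with rate 1, since exp(-(t-s)) ≥ exp(-t). The
growth in t is harmless: the bound is only used qualitatively. -/
theorem lintegral_Ioc_le_eLpNorm {T ρ : ℝ≥0∞} {h : ℝ → ℝ≥0∞}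
    (hh : AEMeasurable h (volume.restrict (timeInterval T))) (hρ : 1 ≤ ρ) {t : ℝ}
    (ht : t ∈ timeInterval T) :
    ∫⁻ s in Ioc 0 t, h s ≤
      ENNReal.ofReal (Real.exp t) * eLpNorm h ρ (volume.restrict (timeInterval T)) := by
  have h1 := duhamel_le_eLpNorm one_pos (fun t ht => Icc_subset_timeInterval ht) hh hρ ht
  rw [inv_one, ENNReal.ofReal_one, ENNReal.one_rpow, one_mul] at h1
  refine le_trans ?_ (mul_le_mul_right h1 _)
  rw [duhamel, ← lintegral_const_mul' _ _ ENNReal.ofReal_ne_top]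
  refine setLIntegral_mono' measurableSet_Ioc fun s hs => ?_
  rw [← mul_assoc, ← ENNReal.ofReal_mul (Real.exp_pos _).le, ← Real.exp_add]
  refine le_mul_of_one_le_left zero_le ?_
  rw [ENNReal.one_le_ofReal, Real.one_le_exp_iff]
  linarith [hs.1]

end Weights

/-! ### The scalar heat equation in Chemin-Lerner spaces. -/

section Scalar

variable {N : ℕ} {φ : 𝓢(Space N, ℂ)}

/-- The norm in time of a function dominated by Duhamel's formula. -/
theorem eLpNorm_heat_le {c : ℝ} (hc : 0 < c) {T ρ ρ₁ : ℝ≥0∞} (hρ : 1 ≤ ρ) (hρ₁ : ρ ≤ ρ₁) {h : ℝ → ℝ≥0∞}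
    (hh : Measurable h) (b K : ℝ≥0∞) (hK : K ≠ ∞) (hb : b ≠ ∞) (j : ℤ) {f : ℝ → ℝ≥0∞} (s : ℝ)
    (hf : ∀ t ∈ timeInterval T, f t ≤
      K * (ENNReal.ofReal (Real.exp (-(c * 4 ^ j * t))) * b + duhamel (c * 4 ^ j) h t)) :
    (2 : ℝ≥0∞) ^ ((j : ℝ) * (s + (2 / ρ₁).toReal)) *
        eLpNorm f ρ₁ (volume.restrict (timeInterval T)) ≤
      K * rateConst c * ((2 : ℝ≥0∞) ^ ((j : ℝ) * s) * b +
        (2 : ℝ≥0∞) ^ ((j : ℝ) * (s - 2 + (2 / ρ).toReal)) *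
          eLpNorm h ρ (volume.restrict (timeInterval T))) := by
  set μ := volume.restrict (timeInterval T)
  have hcj : 0 < c * 4 ^ j := by positivity
  have hSm := measurableSet_timeInterval T
  have hρ₁' : 1 ≤ ρ₁ := hρ.trans hρ₁
  set g : ℝ → ℝ≥0∞ := fun t => ENNReal.ofReal (Real.exp (-(c * 4 ^ j * t))) with hg
  have hgm : Measurable g := by fun_prop
  have h1 : eLpNorm f ρ₁ μ ≤ K * (b * eLpNorm g ρ₁ μ + eLpNorm (duhamel (c * 4 ^ j) h) ρ₁ μ) := by
    have e1 : eLpNorm f ρ₁ μ ≤ eLpNorm (fun t => K * (b * g t + duhamel (c * 4 ^ j) h t)) ρ₁ μ := by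
      refine eLpNorm_mono_enorm_ae ?_
      filter_upwards [ae_restrict_mem hSm] with t ht
      simp only [enorm_eq_self]
      exact (hf t ht).trans (le_of_eq (by simp only [hg]; ring))
    refine e1.trans ((eLpNorm_const_mul_le hK _ _ _).trans ?_)
    gcongr
    refine (eLpNorm_add_le (f := fun t => b * g t) (hgm.const_mul b).aestronglyMeasurable
      (measurable_duhamel _ hh).aestronglyMeasurable hρ₁').trans ?_
    gcongr
    exact eLpNorm_const_mul_le hb g _ _
  have h2 : eLpNorm g ρ₁ μ ≤ rateConst c * (2 : ℝ≥0∞) ^ ((j : ℝ) * -(2 / ρ₁).toReal) := by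
    rw [two_div_toReal]
    exact (eLpNorm_exp_le hcj hSm (fun t ht => ht.1) hρ₁').trans
      (ofReal_rate_rpow_le hc j ENNReal.toReal_nonneg (toReal_inv_le_one hρ₁'))
  have h3 : eLpNorm (duhamel (c * 4 ^ j) h) ρ₁ μ ≤ rateConst c *
      (2 : ℝ≥0∞) ^ ((j : ℝ) * -(2 - (2 / ρ).toReal + (2 / ρ₁).toReal)) * eLpNorm h ρ μ := by
    refine (eLpNorm_duhamel_le hcj hSm (fun t ht => Icc_subset_timeInterval ht) hh.aemeasurable
      hρ hρ₁).trans ?_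
    gcongr
    have t1 := toReal_inv_le_one hρ
    have t2 := toReal_inv_le_toReal_inv hρ hρ₁
    have t3 : 0 ≤ ρ₁⁻¹.toReal := ENNReal.toReal_nonneg
    refine (ofReal_rate_rpow_le hc j (by linarith) (by linarith)).trans (le_of_eq ?_)
    rw [two_div_toReal, two_div_toReal]
    congr 3
    ring
  calc _ ≤ (2 : ℝ≥0∞) ^ ((j : ℝ) * (s + (2 / ρ₁).toReal)) *
        (K * (b * (rateConst c * (2 : ℝ≥0∞) ^ ((j : ℝ) * -(2 / ρ₁).toReal)) +
          rateConst c * (2 : ℝ≥0∞) ^ ((j : ℝ) * -(2 - (2 / ρ).toReal + (2 / ρ₁).toReal)) *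
            eLpNorm h ρ μ)) := by
        gcongr
        exact h1.trans (by gcongr)
    _ = K * rateConst c * (((2 : ℝ≥0∞) ^ ((j : ℝ) * (s + (2 / ρ₁).toReal)) *
          (2 : ℝ≥0∞) ^ ((j : ℝ) * -(2 / ρ₁).toReal)) * b +
          ((2 : ℝ≥0∞) ^ ((j : ℝ) * (s + (2 / ρ₁).toReal)) *
            (2 : ℝ≥0∞) ^ ((j : ℝ) * -(2 - (2 / ρ).toReal + (2 / ρ₁).toReal))) *
            eLpNorm h ρ μ) := by ring
    _ = _ := by
        rw [← two_rpow_add, ← two_rpow_add]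
        congr 3
        · congr 2; ring
        · congr 2; ring

/-- Well-posedness of `∂_t u = κ Δ u + H` for `Re κ > 0`, with smoothing estimates. -/
theorem exists_heat_wellposed (hφ : IsLittlewoodPaley φ) {κ : ℂ} (hκ : 0 < κ.re) :
    ∃ K : ℝ≥0∞, K ≠ ∞ ∧ ∀ (p : ℝ≥0∞), 1 ≤ p → ∀ (T ρ : ℝ≥0∞), 1 ≤ ρ → ∀ (s : ℝ) (u₀ : 𝒵' N)
      (H : ℝ → 𝒵' N) (h : ℤ → ℝ → ℝ≥0∞), besovNorm hφ p s u₀ ≠ ∞ →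
      IsMajorant hφ p (timeInterval T) H h →
      ∑' j : ℤ, (2 : ℝ≥0∞) ^ ((j : ℝ) * (s - 2 + (2 / ρ).toReal)) *
        eLpNorm (h j) ρ (volume.restrict (timeInterval T)) ≠ ∞ →
      ∃ u : ℝ → 𝒵' N, SolvesEvolution T u₀ (fun t => H t + κ • lap (u t)) u ∧
        (∃ B : ℤ → ℝ≥0∞, ∑' j : ℤ, (2 : ℝ≥0∞) ^ ((j : ℝ) * s) * B j ≠ ∞ ∧
          ∀ t ∈ timeInterval T, ∀ j, distLpNorm p (block hφ j (u t)) ≤ B j) ∧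
        MemCLCont hφ T p s u ∧
        ∀ ρ' ρ₁ : ℝ≥0∞, 1 ≤ ρ' → ρ' ≤ ρ₁ → ∀ j : ℤ,
          (2 : ℝ≥0∞) ^ ((j : ℝ) * (s + (2 / ρ₁).toReal)) * blockTimeNorm hφ T ρ₁ p j u ≤
            K * ((2 : ℝ≥0∞) ^ ((j : ℝ) * s) * distLpNorm p (block hφ j u₀) +
              (2 : ℝ≥0∞) ^ ((j : ℝ) * (s - 2 + (2 / ρ').toReal)) *
                eLpNorm (h j) ρ' (volume.restrict (timeInterval T))) := by
  obtain ⟨C, c, hC0, hc, hC⟩ := exists_kernelNorm_heatSym_le hφ hκ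
  set K₀ : ℝ≥0∞ := ENNReal.ofReal C * kernelNorm (fat φ) with hK₀
  have hK₀t : K₀ ≠ ∞ := ENNReal.mul_ne_top ENNReal.ofReal_ne_top (kernelNorm_lt_top _).ne
  refine ⟨K₀ * rateConst c, ENNReal.mul_ne_top hK₀t ENNReal.ofReal_ne_top, ?_⟩
  intro p hp T ρ hρ s u₀ H h hu₀ hH hsum
  have : ENNReal.HolderConjugate p p.conjExponent := ENNReal.HolderConjugate.conjExponent hp
  set q := p.conjExponent
  set S := timeInterval T with hS
  have hb : ∀ j, distLpNorm p (block hφ j u₀) ≠ ∞ := ne_top_of_tsum_two_rpow hu₀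
  -- A bound for block j uniform in time: the exponent -2 + 2/ρ is the gain (4^j)^{-(1-1/ρ)} of the
  -- damped integral when the output is measured in L^∞.
  set A : ℤ → ℝ≥0∞ := fun j => rateConst c * (distLpNorm p (block hφ j u₀) +
    (2 : ℝ≥0∞) ^ ((j : ℝ) * (-2 + (2 / ρ).toReal)) * eLpNorm (h j) ρ (volume.restrict S)) with hA
  have hAle : ∀ t ∈ S, ∀ j, ENNReal.ofReal (Real.exp (-(c * 4 ^ j * t))) *
      distLpNorm p (block hφ j u₀) + duhamel (c * 4 ^ j) (h j) t ≤ A j := by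
    intro t ht j
    have hcj : 0 < c * 4 ^ j := by positivity
    simp only [hA, mul_add]
    refine add_le_add ?_ ?_
    · refine mul_le_mul_left (le_trans ?_ (one_le_rateConst c)) _
      rw [ENNReal.ofReal_le_one, Real.exp_le_one_iff, neg_nonpos]
      exact mul_nonneg hcj.le ht.1
    · refine (duhamel_le_eLpNorm hcj (fun t ht => Icc_subset_timeInterval ht)
        (hH.measurable j).aemeasurable hρ ht).trans ?_
      rw [← mul_assoc]
      refine mul_le_mul_left ?_ _
      have t1 := toReal_inv_le_one hρ
      have t2 : 0 ≤ ρ⁻¹.toReal := ENNReal.toReal_nonneg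
      refine (ofReal_rate_rpow_le hc j (by linarith) (by linarith)).trans (le_of_eq ?_)
      rw [two_div_toReal]
      congr 3
      ring
  have hAs : ∑' j : ℤ, (2 : ℝ≥0∞) ^ ((j : ℝ) * s) * A j ≠ ∞ := by
    have e : ∀ j : ℤ, (2 : ℝ≥0∞) ^ ((j : ℝ) * s) * A j =
        rateConst c * ((2 : ℝ≥0∞) ^ ((j : ℝ) * s) * distLpNorm p (block hφ j u₀) +
          (2 : ℝ≥0∞) ^ ((j : ℝ) * (s - 2 + (2 / ρ).toReal)) *
            eLpNorm (h j) ρ (volume.restrict S)) := fun j => by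
      have : (j : ℝ) * (s - 2 + (2 / ρ).toReal) = (j : ℝ) * s + (j : ℝ) * (-2 + (2 / ρ).toReal) := by
        ring
      rw [this, two_rpow_add]
      simp only [hA]
      ring
    simp only [e, ENNReal.tsum_mul_left, ENNReal.tsum_add]
    exact ENNReal.mul_ne_top ENNReal.ofReal_ne_top (ENNReal.add_ne_top.2 ⟨hu₀, hsum⟩)
  have hint : ∀ t ∈ S, ∀ j, ∫⁻ s in Ioc 0 t, h j s ≤
      ENNReal.ofReal (Real.exp t) * eLpNorm (h j) ρ (volume.restrict S) := fun t ht j =>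
    lintegral_Ioc_le_eLpNorm (hH.measurable j).aemeasurable hρ ht
  have hI : ∀ t ∈ S, ∑' j : ℤ, (2 : ℝ≥0∞) ^ ((j : ℝ) * (s - 2 + (2 / ρ).toReal)) *
      ∫⁻ s in Ioc 0 t, h j s ≠ ∞ := by
    intro t ht
    have : ∑' j : ℤ, (2 : ℝ≥0∞) ^ ((j : ℝ) * (s - 2 + (2 / ρ).toReal)) * ∫⁻ s in Ioc 0 t, h j s ≤
        ENNReal.ofReal (Real.exp t) * ∑' j : ℤ, (2 : ℝ≥0∞) ^ ((j : ℝ) * (s - 2 + (2 / ρ).toReal)) *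
          eLpNorm (h j) ρ (volume.restrict S) := by
      rw [← ENNReal.tsum_mul_left]
      refine ENNReal.tsum_le_tsum fun j => (mul_le_mul_right (hint t ht j) _).trans (le_of_eq ?_)
      ring
    exact (this.trans_lt (ENNReal.mul_ne_top ENNReal.ofReal_ne_top hsum).lt_top).ne
  obtain ⟨u, hu, hblock⟩ := exists_heat_solution (p := p) (q := q) hφ hC0.le hc hC hH u₀ hAle hAs hI
  have hdist : ∀ t ∈ S, ∀ j, distLpNorm p (block hφ j (u t)) ≤
      K₀ * (ENNReal.ofReal (Real.exp (-(c * 4 ^ j * t))) * distLpNorm p (block hφ j u₀) +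
        duhamel (c * 4 ^ j) (h j) t) := by
    intro t ht j
    have hfin : ENNReal.ofReal C * (ENNReal.ofReal (Real.exp (-(c * 4 ^ j * t))) *
        distLpNorm p (block hφ j u₀) + duhamel (c * 4 ^ j) (h j) t) ≠ ∞ :=
      ENNReal.mul_ne_top ENNReal.ofReal_ne_top
        ((hAle t ht j).trans_lt (ne_top_of_tsum_two_rpow hAs j).lt_top).ne
    refine (distLpNorm_le_of_localized (q := q) (j := j) hp (fun ψ => block_fat hφ j (u t) ψ)
      (fun ψ => ?_) hfin).trans (le_of_eq (by rw [hK₀]; ring))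
    rw [hblock t ht]
    exact enorm_heatBlock_le (p := p) hC0.le hC (hH.mono_set
      (Ioc_subset_Icc_self.trans (Icc_subset_timeInterval ht))) u₀ ht.1 j ψ
  have hB : ∀ t ∈ S, ∀ j, distLpNorm p (block hφ j (u t)) ≤ K₀ * A j := fun t ht j =>
    (hdist t ht j).trans (mul_le_mul_right (hAle t ht j) _)
  have hBs : ∑' j : ℤ, (2 : ℝ≥0∞) ^ ((j : ℝ) * s) * (K₀ * A j) ≠ ∞ := by
    have e : ∀ j : ℤ, (2 : ℝ≥0∞) ^ ((j : ℝ) * s) * (K₀ * A j) =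
      K₀ * ((2 : ℝ≥0∞) ^ ((j : ℝ) * s) * A j) := fun j => by ring
    simp only [e, ENNReal.tsum_mul_left]
    exact ENNReal.mul_ne_top hK₀t hAs
  refine ⟨u, hu, ⟨_, hBs, hB⟩, ?_, fun ρ' ρ₁ hρ' hρ₁ j =>
    eLpNorm_heat_le hc hρ' hρ₁ (hH.measurable j) _ _ hK₀t (hb j) j s fun t ht => hdist t ht j⟩
  -- On one block the right-hand side H + κΔu is bounded by the majorant of H plus a constant in
  -- time, as Δ is bounded there.
  refine hu.memCLCont hp hφ (r := fun j τ => h j τ + ‖κ‖ₑ *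
    (lapConst φ * (2 : ℝ≥0∞) ^ ((j : ℝ) * 2) * (K₀ * A j))) (fun j => ?_) (fun j t ht => ?_) hB hBs
  · filter_upwards [hH.le j, ae_restrict_mem (measurableSet_timeInterval T)] with τ hτ hτS
    rw [block_add, block_smul]
    refine (distLpNorm_add_le hp _ _).trans (add_le_add hτ ?_)
    refine (distLpNorm_smul_le _ _).trans (mul_le_mul_right ?_ _)
    exact (distLpNorm_block_lap_le hp hφ j (u τ)).trans (mul_le_mul_right (hB τ hτS j) _)
  · rw [lintegral_add_left (hH.measurable j), setLIntegral_const, Real.volume_Ioc]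
    refine ENNReal.add_ne_top.2 ⟨ne_top_of_tsum_two_rpow (hI t ht) j,
      ENNReal.mul_ne_top (ENNReal.mul_ne_top enorm_ne_top ?_) ENNReal.ofReal_ne_top⟩
    exact ENNReal.mul_ne_top (ENNReal.mul_ne_top (lapConst_ne_top φ) (two_rpow_ne_top _))
      (ne_top_of_tsum_two_rpow hBs j)

end Scalar

/-! ### Reduction of the coupled system to two scalar heat equations. -/

section Coupled

variable {N : ℕ} {φ : 𝓢(Space N, ℂ)} {p : ℝ≥0∞} {T : ℝ≥0∞}

/-- Diagonalization of the coupled system: `μ` and `ν - μ` are the two (complex) viscosities. -/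
theorem exists_complex_viscosity {ν : ℝ} (hν : 0 < ν) :
    ∃ μ : ℂ, 0 < μ.re ∧ 0 < ((ν : ℂ) - μ).re ∧ μ * μ = ν * μ - 1 := by
  obtain ⟨D, hD⟩ := IsAlgClosed.exists_pow_nat_eq ((ν : ℂ) ^ 2 - 4) (n := 2) two_pos
  have hD' : D * D = ((ν ^ 2 - 4 : ℝ) : ℂ) := by
    push_cast
    rw [← hD, pow_two]
  have hre := congrArg Complex.re hD'
  have him := congrArg Complex.im hD'
  rw [Complex.mul_re, Complex.ofReal_re] at hre
  rw [Complex.mul_im, Complex.ofReal_im] at him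
  have h1 : |D.re| < ν := by
    refine abs_lt_of_sq_lt_sq ?_ hν.le
    -- D² = ν² - 4 is real, so D is either purely imaginary or real with D² < ν²; in both cases |Re
    -- D| < ν, and the roots (ν ± D)/2 have positive real part.
    have h2 : D.re * D.im = 0 := by linarith
    rcases mul_eq_zero.1 h2 with h | h
    · rw [h]; nlinarith
    · rw [h] at hre; nlinarith
  obtain ⟨h2, h3⟩ := abs_lt.1 h1
  refine ⟨((ν : ℂ) + D) / 2, ?_, ?_, ?_⟩
  · simp
    linarith
  · have : (ν : ℂ) - (ν + D) / 2 = (ν - D) / 2 := by ring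
    rw [this]
    simp
    linarith
  · linear_combination hD / 4

theorem SolvesEvolution.const_smul {u₀ : 𝒵' N} {R u : ℝ → 𝒵' N} (h : SolvesEvolution T u₀ R u)
    (c : ℂ) : SolvesEvolution T (c • u₀) (fun t => c • R t) (fun t => c • u t) := fun t ht ψ => by
  refine ⟨(h t ht ψ).1.const_mul c, ?_⟩
  simp only [_root_.smul_apply, smul_eq_mul]
  rw [intervalIntegral.integral_const_mul, (h t ht ψ).2]
  ring

theorem lap_sub (f g : 𝒵' N) : lap (f - g) = lap f - lap g := rfl

theorem lap_smul (c : ℂ) (f : 𝒵' N) : lap (c • f) = c • lap f := rfl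

/-- A majorant must be measurable, while block norms are only almost everywhere measurable; a
measurable modification has the same norm for every exponent. -/
theorem MemCL.exists_measurable {hφ : IsLittlewoodPaley φ} {ρ : ℝ≥0∞} {s : ℝ} {f : ℝ → 𝒵' N}
    (hf : MemCL hφ T ρ p s f) : ∃ h : ℤ → ℝ → ℝ≥0∞, (∀ j, Measurable (h j)) ∧
      (∀ j, ∀ᵐ t ∂volume.restrict (timeInterval T), distLpNorm p (block hφ j (f t)) = h j t) ∧
      ∀ j ρ', eLpNorm (h j) ρ' (volume.restrict (timeInterval T)) = blockTimeNorm hφ T ρ' p j f :=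
  ⟨fun j => (hf.measurable_norm j).mk _, fun j => (hf.measurable_norm j).measurable_mk,
    fun j => (hf.measurable_norm j).ae_eq_mk,
    fun j _ => (eLpNorm_congr_ae (hf.measurable_norm j).ae_eq_mk).symm⟩

theorem blockTimeNorm_sub_smul_le (hp : 1 ≤ p) {hφ : IsLittlewoodPaley φ} {ρ : ℝ≥0∞} (hρ : 1 ≤ ρ)
    {j : ℤ} {f g : ℝ → 𝒵' N}
    (hf : AEMeasurable (fun t => distLpNorm p (block hφ j (f t))) (volume.restrict (timeInterval T)))
    (hg : AEMeasurable (fun t => distLpNorm p (block hφ j (g t))) (volume.restrict (timeInterval T)))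
    (c : ℂ) : blockTimeNorm hφ T ρ p j (fun t => f t - c • g t) ≤
      blockTimeNorm hφ T ρ p j f + ‖c‖ₑ * blockTimeNorm hφ T ρ p j g := by
  rw [blockTimeNorm, blockTimeNorm, blockTimeNorm]
  refine (eLpNorm_mono_enorm (g := fun t => distLpNorm p (block hφ j (f t)) +
    ‖c‖ₑ * distLpNorm p (block hφ j (g t))) fun t => ?_).trans ?_
  · simp only [enorm_eq_self]
    rw [block_sub, block_smul]
    exact (distLpNorm_sub_le hp _ _).trans (add_le_add le_rfl (distLpNorm_smul_le c _))
  · refine (eLpNorm_add_le hf.aestronglyMeasurable (hg.const_mul _).aestronglyMeasurable hρ).trans ?_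
    exact add_le_add le_rfl (eLpNorm_const_mul_le enorm_ne_top _ _ _)

theorem lintegral_Ioc_const_mul_ne_top {t : ℝ} {a : ℝ≥0∞} (ha : a ≠ ∞) : ∫⁻ _ in Ioc 0 t, a ≠ ∞ := by
  rw [setLIntegral_const, Real.volume_Ioc]
  exact ENNReal.mul_ne_top ha ENNReal.ofReal_ne_top

/-- Solve for w = v + μa with viscosity ν - μ, then for a with viscosity μ and source F - Δw, and
set v = w - μa. The exponent ρ only serves to construct the solution; the block estimates hold for
all ρ' ≤ ρ₁ with one constant, finite or not. -/
theorem exists_coupled_solution (hφ : IsLittlewoodPaley φ) {ν : ℝ} (hν : 0 < ν) :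
    ∃ K : ℝ≥0∞, K ≠ ∞ ∧ ∀ (p : ℝ≥0∞), 1 ≤ p → ∀ (T ρ : ℝ≥0∞), 1 ≤ ρ → ∀ (s : ℝ) (a₀ v₀ : 𝒵' N)
      (F G : ℝ → 𝒵' N), besovNorm hφ p s a₀ < ∞ → besovNorm hφ p s v₀ < ∞ →
      MemCL hφ T ρ p (s - 2 + (2 / ρ).toReal) F → MemCL hφ T ρ p (s - 2 + (2 / ρ).toReal) G →
      ∃ a v : ℝ → 𝒵' N, MemCLCont hφ T p s a ∧ MemCLCont hφ T p s v ∧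
        IsSolution ν T a₀ v₀ F G a v ∧
        ∀ ρ' ρ₁ : ℝ≥0∞, 1 ≤ ρ' → ρ' ≤ ρ₁ → ∀ j : ℤ,
          (2 : ℝ≥0∞) ^ ((j : ℝ) * (s + (2 / ρ₁).toReal)) *
              (blockTimeNorm hφ T ρ₁ p j a + blockTimeNorm hφ T ρ₁ p j v) ≤
            K * ((2 : ℝ≥0∞) ^ ((j : ℝ) * s) *
                (distLpNorm p (block hφ j a₀) + distLpNorm p (block hφ j v₀)) +
              (2 : ℝ≥0∞) ^ ((j : ℝ) * (s - 2 + (2 / ρ').toReal)) *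
                (blockTimeNorm hφ T ρ' p j F + blockTimeNorm hφ T ρ' p j G)) := by
  obtain ⟨μ, hμ, hνμ, hroot⟩ := exists_complex_viscosity hν
  obtain ⟨Kw, hKw, hw⟩ := exists_heat_wellposed hφ hνμ
  obtain ⟨Ka, hKa, ha⟩ := exists_heat_wellposed hφ hμ
  set m : ℝ≥0∞ := 1 + ‖μ‖ₑ with hm
  have hmt : m ≠ ∞ := ENNReal.add_ne_top.2 ⟨ENNReal.one_ne_top, enorm_ne_top⟩
  have hm1 : 1 ≤ m := le_self_add
  have hmμ : ‖μ‖ₑ ≤ m := le_add_self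
  have hL := lapConst_ne_top φ
  set K₁ : ℝ≥0∞ := Kw * m with hK₁
  set K₂ : ℝ≥0∞ := Ka * (1 + lapConst φ * K₁) with hK₂
  have hK₁t : K₁ ≠ ∞ := ENNReal.mul_ne_top hKw hmt
  have hK₂t : K₂ ≠ ∞ := ENNReal.mul_ne_top hKa
    (ENNReal.add_ne_top.2 ⟨ENNReal.one_ne_top, ENNReal.mul_ne_top hL hK₁t⟩)
  refine ⟨K₂ + (K₁ + ‖μ‖ₑ * K₂), ENNReal.add_ne_top.2 ⟨hK₂t, ENNReal.add_ne_top.2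
    ⟨hK₁t, ENNReal.mul_ne_top enorm_ne_top hK₂t⟩⟩, ?_⟩
  intro p hp T ρ hρ s a₀ v₀ F G ha₀ hv₀ hF hG
  set vol := volume.restrict (timeInterval T) with hvol
  obtain ⟨f, hfm, hfe, hfn⟩ := hF.exists_measurable
  obtain ⟨g, hgm, hge, hgn⟩ := hG.exists_measurable
  set D : ℤ → ℝ≥0∞ := fun j => (2 : ℝ≥0∞) ^ ((j : ℝ) * s) *
    (distLpNorm p (block hφ j a₀) + distLpNorm p (block hφ j v₀)) with hD
  set X : ℝ≥0∞ → ℤ → ℝ≥0∞ := fun ρ' j => (2 : ℝ≥0∞) ^ ((j : ℝ) * (s - 2 + (2 / ρ').toReal)) *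
    (blockTimeNorm hφ T ρ' p j F + blockTimeNorm hφ T ρ' p j G) with hX
  have hDs : ∑' j, D j ≠ ∞ := by
    simp only [hD, mul_add (R := ℝ≥0∞), ENNReal.tsum_add]
    exact ENNReal.add_ne_top.2 ⟨ha₀.ne, hv₀.ne⟩
  have hXs : ∑' j, X ρ j ≠ ∞ := by
    simp only [hX, mul_add (R := ℝ≥0∞), ENNReal.tsum_add]
    exact ENNReal.add_ne_top.2 ⟨hF.norm_lt_top.ne, hG.norm_lt_top.ne⟩
  have hDX : ∀ k : ℝ≥0∞, k ≠ ∞ → ∑' j, k * (D j + X ρ j) ≠ ∞ := fun k hk => by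
    rw [ENNReal.tsum_mul_left, ENNReal.tsum_add]
    exact ENNReal.mul_ne_top hk (ENNReal.add_ne_top.2 ⟨hDs, hXs⟩)
  -- the diagonalized unknown
  have hw₀ : ∀ j : ℤ, (2 : ℝ≥0∞) ^ ((j : ℝ) * s) * distLpNorm p (block hφ j (v₀ + μ • a₀)) ≤ m * D j := by
    intro j
    have h1 : distLpNorm p (block hφ j (v₀ + μ • a₀)) ≤
        m * (distLpNorm p (block hφ j a₀) + distLpNorm p (block hφ j v₀)) := by
      rw [block_add, block_smul]
      refine (distLpNorm_add_le hp _ _).trans ?_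
      rw [mul_add, add_comm]
      exact add_le_add ((distLpNorm_smul_le _ _).trans (mul_le_mul_left hmμ _))
        (le_mul_of_one_le_left zero_le hm1)
    refine (mul_le_mul_right h1 _).trans (le_of_eq ?_)
    simp only [hD]
    ring
  have hw₀s : besovNorm hφ p s (v₀ + μ • a₀) ≠ ∞ := by
    refine ((ENNReal.tsum_le_tsum hw₀).trans_lt ?_).ne
    rw [ENNReal.tsum_mul_left]
    exact (ENNReal.mul_ne_top hmt hDs).lt_top
  have hwH : IsMajorant hφ p (timeInterval T) (fun t => G t + μ • F t)
      (fun j t => g j t + ‖μ‖ₑ * f j t) := by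
    refine ⟨fun ψ => ?_, fun j => (hgm j).add ((hfm j).const_mul _), fun j => ?_⟩
    · exact (hG.measurable_pairing ψ).add ((hF.measurable_pairing ψ).const_mul μ)
    · filter_upwards [hfe j, hge j] with t h1 h2
      rw [block_add, block_smul, ← h1, ← h2]
      exact (distLpNorm_add_le hp _ _).trans (add_le_add le_rfl (distLpNorm_smul_le _ _))
  have hwn : ∀ ρ', 1 ≤ ρ' → ∀ j : ℤ, (2 : ℝ≥0∞) ^ ((j : ℝ) * (s - 2 + (2 / ρ').toReal)) *
      eLpNorm (fun t => g j t + ‖μ‖ₑ * f j t) ρ' vol ≤ m * X ρ' j := by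
    intro ρ' hρ' j
    have h1 : eLpNorm (fun t => g j t + ‖μ‖ₑ * f j t) ρ' vol ≤
        m * (blockTimeNorm hφ T ρ' p j F + blockTimeNorm hφ T ρ' p j G) := by
      refine (eLpNorm_add_le (hgm j).aestronglyMeasurable
        ((hfm j).const_mul _).aestronglyMeasurable hρ').trans ?_
      rw [mul_add, add_comm, ← hfn, ← hgn]
      exact add_le_add ((eLpNorm_const_mul_le enorm_ne_top _ _ _).trans (mul_le_mul_left hmμ _))
        (le_mul_of_one_le_left zero_le hm1)
    refine (mul_le_mul_right h1 _).trans (le_of_eq ?_)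
    simp only [hX]
    ring
  obtain ⟨w, hwe, ⟨Bw, hBws, hBw⟩, hwc, hwest⟩ := hw p hp T ρ hρ s _ _ _ hw₀s hwH (by
    refine ((ENNReal.tsum_le_tsum (hwn ρ hρ)).trans_lt ?_).ne
    rw [ENNReal.tsum_mul_left]
    exact (ENNReal.mul_ne_top hmt hXs).lt_top)
  have hwe' : ∀ ρ' ρ₁, 1 ≤ ρ' → ρ' ≤ ρ₁ → ∀ j : ℤ,
      (2 : ℝ≥0∞) ^ ((j : ℝ) * (s + (2 / ρ₁).toReal)) * blockTimeNorm hφ T ρ₁ p j w ≤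
        K₁ * (D j + X ρ' j) := by
    intro ρ' ρ₁ h1 h2 j
    refine (hwest ρ' ρ₁ h1 h2 j).trans ?_
    rw [hK₁, mul_assoc, mul_add m]
    exact mul_le_mul_right (add_le_add (hw₀ j) (hwn ρ' h1 j)) _
  -- the first unknown
  obtain ⟨w', hwm', hwe'', hwn'⟩ := hwc.memCL.exists_measurable
  have haH : IsMajorant hφ p (timeInterval T) (fun t => F t - lap (w t))
      (fun j t => f j t + lapConst φ * (2 : ℝ≥0∞) ^ ((j : ℝ) * 2) * w' j t) := by
    refine ⟨fun ψ => ?_, fun j => (hfm j).add ((hwm' j).const_mul _), fun j => ?_⟩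
    · exact (hF.measurable_pairing ψ).sub (hwc.memCL.measurable_pairing (lapTest N ψ))
    · filter_upwards [hfe j, hwe'' j] with t h1 h2
      rw [block_sub, ← h1, ← h2]
      exact (distLpNorm_sub_le hp _ _).trans
        (add_le_add le_rfl (distLpNorm_block_lap_le hp hφ j (w t)))
  have han : ∀ ρ', 1 ≤ ρ' → ∀ j : ℤ, (2 : ℝ≥0∞) ^ ((j : ℝ) * (s - 2 + (2 / ρ').toReal)) *
      eLpNorm (fun t => f j t + lapConst φ * (2 : ℝ≥0∞) ^ ((j : ℝ) * 2) * w' j t) ρ' vol ≤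
        X ρ' j + lapConst φ * (K₁ * (D j + X ρ' j)) := by
    intro ρ' hρ' j
    have hcst : lapConst φ * (2 : ℝ≥0∞) ^ ((j : ℝ) * 2) ≠ ∞ :=
      ENNReal.mul_ne_top hL (two_rpow_ne_top _)
    have h1 : eLpNorm (fun t => f j t + lapConst φ * (2 : ℝ≥0∞) ^ ((j : ℝ) * 2) * w' j t) ρ' vol ≤
        blockTimeNorm hφ T ρ' p j F +
          lapConst φ * (2 : ℝ≥0∞) ^ ((j : ℝ) * 2) * blockTimeNorm hφ T ρ' p j w := by
      refine (eLpNorm_add_le (hfm j).aestronglyMeasurable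
        ((hwm' j).const_mul _).aestronglyMeasurable hρ').trans ?_
      rw [← hfn, ← hwn']
      exact add_le_add le_rfl (eLpNorm_const_mul_le hcst _ _ _)
    refine (mul_le_mul_right h1 _).trans ?_
    rw [mul_add]
    refine add_le_add ?_ ?_
    · simp only [hX]
      exact mul_le_mul_right le_self_add _
    -- Taking both time exponents equal to ρ' shows that w gains two derivatives over the source,
    -- which the weight 2^{2j} of Δw uses up exactly.
    · refine le_trans (le_of_eq ?_) (mul_le_mul_right (hwe' ρ' ρ' hρ' le_rfl j) _)
      rw [show (j : ℝ) * (s + (2 / ρ').toReal) =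
        (j : ℝ) * (s - 2 + (2 / ρ').toReal) + (j : ℝ) * 2 by ring, two_rpow_add]
      ring
  obtain ⟨a, hae, ⟨Ba, hBas, hBa⟩, hac, haest⟩ := ha p hp T ρ hρ s a₀ _ _ ha₀.ne haH (by
    refine ((ENNReal.tsum_le_tsum (han ρ hρ)).trans_lt ?_).ne
    rw [ENNReal.tsum_add, ENNReal.tsum_mul_left]
    exact (ENNReal.add_ne_top.2 ⟨hXs, ENNReal.mul_ne_top hL (hDX _ hK₁t)⟩).lt_top)
  have hae' : ∀ ρ' ρ₁, 1 ≤ ρ' → ρ' ≤ ρ₁ → ∀ j : ℤ,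
      (2 : ℝ≥0∞) ^ ((j : ℝ) * (s + (2 / ρ₁).toReal)) * blockTimeNorm hφ T ρ₁ p j a ≤
        K₂ * (D j + X ρ' j) := by
    intro ρ' ρ₁ h1 h2 j
    refine (haest ρ' ρ₁ h1 h2 j).trans ?_
    rw [hK₂, mul_assoc]
    refine mul_le_mul_right ?_ _
    have h3 : (2 : ℝ≥0∞) ^ ((j : ℝ) * s) * distLpNorm p (block hφ j a₀) ≤ D j :=
      mul_le_mul_right le_self_add _
    refine (add_le_add h3 (han ρ' h1 j)).trans (le_of_eq ?_)
    ring
  -- the second unknown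
  have hsol : IsSolution ν T a₀ v₀ F G a (fun t => w t - μ • a t) := by
    constructor
    · have e : (fun t => F t - lap (w t) + μ • lap (a t)) =
          fun t => F t - lap (w t - μ • a t) := by
        ext1 t
        rw [lap_sub, lap_smul]
        abel
      rwa [e] at hae
    · have h1 := hwe.sub (hae.const_smul μ)
      rw [add_sub_cancel_right] at h1
      have e : (fun t => G t + μ • F t + ((ν : ℂ) - μ) • lap (w t) -
          μ • (F t - lap (w t) + μ • lap (a t))) =
          fun t => G t + (ν : ℂ) • lap (w t - μ • a t) + lap (a t) := by
        ext t ψ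
        rw [lap_sub, lap_smul]
        simp only [_root_.add_apply, _root_.sub_apply, _root_.smul_apply, smul_eq_mul]
        -- The coefficients of Δa agree by -μ² = 1 - νμ; those of Δw agree identically.
        linear_combination -(lap (a t) ψ) * hroot
      rwa [e] at h1
  have hBv : ∀ t ∈ timeInterval T, ∀ j,
      distLpNorm p (block hφ j (w t - μ • a t)) ≤ Bw j + ‖μ‖ₑ * Ba j := fun t ht j => by
    rw [block_sub, block_smul]
    exact (distLpNorm_sub_le hp _ _).trans (add_le_add (hBw t ht j)
      ((distLpNorm_smul_le _ _).trans (mul_le_mul_right (hBa t ht j) _)))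
  have hBvs : ∑' j : ℤ, (2 : ℝ≥0∞) ^ ((j : ℝ) * s) * (Bw j + ‖μ‖ₑ * Ba j) ≠ ∞ := by
    simp only [mul_add (R := ℝ≥0∞), ENNReal.tsum_add, mul_left_comm _ ‖μ‖ₑ, ENNReal.tsum_mul_left]
    exact ENNReal.add_ne_top.2 ⟨hBws, ENNReal.mul_ne_top enorm_ne_top hBas⟩
  -- Continuity of v, and measurability of its block norms, are read off from its own evolution
  -- equation, as the norm of a difference is not a function of the two norms.
  have hvc : MemCLCont hφ T p s (fun t => w t - μ • a t) := by
    refine hsol.eq_v.memCLCont hp hφ (r := fun j t => g j t +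
      (‖(ν : ℂ)‖ₑ * (lapConst φ * (2 : ℝ≥0∞) ^ ((j : ℝ) * 2) * (Bw j + ‖μ‖ₑ * Ba j)) +
        lapConst φ * (2 : ℝ≥0∞) ^ ((j : ℝ) * 2) * Ba j)) (fun j => ?_) (fun j t ht => ?_) hBv hBvs
    · filter_upwards [hge j, ae_restrict_mem (measurableSet_timeInterval T)] with t h1 ht
      rw [block_add, block_add, block_smul, ← h1, ← add_assoc]
      refine (distLpNorm_add_le hp _ _).trans (add_le_add ((distLpNorm_add_le hp _ _).trans
        (add_le_add le_rfl ((distLpNorm_smul_le _ _).trans (mul_le_mul_right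
          ((distLpNorm_block_lap_le hp hφ j _).trans (mul_le_mul_right (hBv t ht j) _)) _)))) ?_)
      exact (distLpNorm_block_lap_le hp hφ j _).trans (mul_le_mul_right (hBa t ht j) _)
    · have hcst : lapConst φ * (2 : ℝ≥0∞) ^ ((j : ℝ) * 2) ≠ ∞ :=
        ENNReal.mul_ne_top hL (two_rpow_ne_top _)
      rw [lintegral_add_left (hgm j)]
      refine ENNReal.add_ne_top.2 ⟨?_, lintegral_Ioc_const_mul_ne_top (ENNReal.add_ne_top.2
        ⟨ENNReal.mul_ne_top enorm_ne_top (ENNReal.mul_ne_top hcst (ne_top_of_tsum_two_rpow hBvs j)),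
          ENNReal.mul_ne_top hcst (ne_top_of_tsum_two_rpow hBas j)⟩)⟩
      refine ((lintegral_Ioc_le_eLpNorm (hgm j).aemeasurable hρ ht).trans_lt ?_).ne
      rw [hgn]
      exact (ENNReal.mul_ne_top ENNReal.ofReal_ne_top
        (ne_top_of_tsum_two_rpow hG.norm_lt_top.ne j)).lt_top
  refine ⟨a, _, hac, hvc, hsol, fun ρ' ρ₁ h1 h2 j => ?_⟩
  have h3 := blockTimeNorm_sub_smul_le (ρ := ρ₁) hp (h1.trans h2) (hwc.memCL.measurable_norm j)
    (hac.memCL.measurable_norm j) μ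
  have h4 := hae' ρ' ρ₁ h1 h2 j
  have h5 := hwe' ρ' ρ₁ h1 h2 j
  calc _ ≤ (2 : ℝ≥0∞) ^ ((j : ℝ) * (s + (2 / ρ₁).toReal)) * (blockTimeNorm hφ T ρ₁ p j a +
        (blockTimeNorm hφ T ρ₁ p j w + ‖μ‖ₑ * blockTimeNorm hφ T ρ₁ p j a)) := by gcongr
    _ = (2 : ℝ≥0∞) ^ ((j : ℝ) * (s + (2 / ρ₁).toReal)) * blockTimeNorm hφ T ρ₁ p j a +
        ((2 : ℝ≥0∞) ^ ((j : ℝ) * (s + (2 / ρ₁).toReal)) * blockTimeNorm hφ T ρ₁ p j w +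
          ‖μ‖ₑ * ((2 : ℝ≥0∞) ^ ((j : ℝ) * (s + (2 / ρ₁).toReal)) *
            blockTimeNorm hφ T ρ₁ p j a)) := by ring
    _ ≤ K₂ * (D j + X ρ' j) + (K₁ * (D j + X ρ' j) + ‖μ‖ₑ * (K₂ * (D j + X ρ' j))) := by gcongr
    _ = _ := by ring

theorem MemCLCont.exists_ae_bound {hφ : IsLittlewoodPaley φ} {s : ℝ} {u : ℝ → 𝒵' N}
    (h : MemCLCont hφ T p s u) (j : ℤ) : ∃ B : ℝ≥0,
      ∀ᵐ τ ∂volume.restrict (timeInterval T), distLpNorm p (block hφ j (u τ)) ≤ B := by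
  have h1 : blockTimeNorm hφ T ∞ p j u ≠ ∞ := ne_top_of_tsum_two_rpow h.memCL.norm_lt_top.ne j
  refine ⟨(blockTimeNorm hφ T ∞ p j u).toNNReal, ?_⟩
  rw [ENNReal.coe_toNNReal h1, blockTimeNorm, eLpNorm_exponent_top]
  simpa using enorm_ae_le_eLpNormEssSup (fun t => distLpNorm p (block hφ j (u t)))
    (volume.restrict (timeInterval T))

/-- The difference solves the homogeneous system with zero data. Uniqueness needs only that each
block is essentially bounded in time; the L^{ρ₁} smoothness plays no role. -/
theorem IsSolution.eqOn (hp : 1 ≤ p) {hφ : IsLittlewoodPaley φ} {s ν : ℝ} {a₀ v₀ : 𝒵' N}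
    {F G a v a' v' : ℝ → 𝒵' N} (h : IsSolution ν T a₀ v₀ F G a v)
    (h' : IsSolution ν T a₀ v₀ F G a' v') (ha : MemCLCont hφ T p s a) (hv : MemCLCont hφ T p s v)
    (ha' : MemCLCont hφ T p s a') (hv' : MemCLCont hφ T p s v') :
    EqOn a' a (timeInterval T) ∧ EqOn v' v (timeInterval T) := by
  have hd := h'.eq_a.sub h.eq_a
  have he := h'.eq_v.sub h.eq_v
  rw [sub_self] at hd he
  have e1 : (fun t => F t - lap (v' t) - (F t - lap (v t))) = fun t => -lap (v' t - v t) := by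
    ext1 t
    rw [lap_sub]
    abel
  have e2 : (fun t => G t + (ν : ℂ) • lap (v' t) + lap (a' t) -
      (G t + (ν : ℂ) • lap (v t) + lap (a t))) =
      fun t => (ν : ℂ) • lap (v' t - v t) + lap (a' t - a t) := by
    ext1 t
    rw [lap_sub, lap_sub, smul_sub]
    abel
  rw [e1] at hd
  rw [e2] at he
  have key : ∀ t ∈ timeInterval T, a' t - a t = 0 ∧ v' t - v t = 0 := fun t ht => by
    refine eq_zero_of_solvesEvolution hp hφ (d := fun t => a' t - a t) (e := fun t => v' t - v t)
      hd he (fun j => ?_) ht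
    obtain ⟨B₁, h1⟩ := ha.exists_ae_bound j
    obtain ⟨B₂, h2⟩ := hv.exists_ae_bound j
    obtain ⟨B₃, h3⟩ := ha'.exists_ae_bound j
    obtain ⟨B₄, h4⟩ := hv'.exists_ae_bound j
    refine ⟨B₃ + B₁ + (B₄ + B₂), ?_⟩
    filter_upwards [h1, h2, h3, h4] with τ k1 k2 k3 k4
    push_cast
    exact ⟨((distLpNorm_sub_le hp _ _).trans (add_le_add k3 k1)).trans le_self_add,
      ((distLpNorm_sub_le hp _ _).trans (add_le_add k4 k2)).trans le_add_self⟩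
  exact ⟨fun t ht => sub_eq_zero.1 (key t ht).1, fun t ht => sub_eq_zero.1 (key t ht).2⟩

end Coupled

end CoupledSystem

/-! ### The lemma itself. -/

open CoupledSystem in
theorem lemma3p4 (N : ℕ) (φ : 𝓢(Space N, ℂ)) (hφ : IsLittlewoodPaley φ)
    (ν : ℝ) (hν : 0 < ν) (ρ₁ ρ₂ : ℝ≥0∞) (hρ₂ : 1 ≤ ρ₂) (hρ : ρ₂ ≤ ρ₁) :
    ∃ C : ℝ≥0, 0 < C ∧
      ∀ (s : ℝ) (p : ℝ≥0∞), 1 ≤ p → ∀ T : ℝ≥0∞, 0 < T → ∀ ρ : ℝ≥0∞, (ρ = ρ₁ ∨ ρ = ρ₂) →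
      ∀ (a₀ v₀ : 𝒵' N) (F G : ℝ → 𝒵' N),
        besovNorm hφ p s a₀ < ∞ → besovNorm hφ p s v₀ < ∞ →
        MemCL hφ T ρ p (s - 2 + (2 / ρ).toReal) F →
        MemCL hφ T ρ p (s - 2 + (2 / ρ).toReal) G →
        ∃ a v : ℝ → 𝒵' N,
          (MemCLCont hφ T p s a ∧ MemCL hφ T ρ₁ p (s + (2 / ρ₁).toReal) a) ∧
          (MemCLCont hφ T p s v ∧ MemCL hφ T ρ₁ p (s + (2 / ρ₁).toReal) v) ∧
          IsSolution ν T a₀ v₀ F G a v ∧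
          (∀ a' v' : ℝ → 𝒵' N,
            (MemCLCont hφ T p s a' ∧ MemCL hφ T ρ₁ p (s + (2 / ρ₁).toReal) a') →
            (MemCLCont hφ T p s v' ∧ MemCL hφ T ρ₁ p (s + (2 / ρ₁).toReal) v') →
            IsSolution ν T a₀ v₀ F G a' v' →
            EqOn a' a (timeInterval T) ∧ EqOn v' v (timeInterval T)) ∧
          ∀ k₀ : ℤ,
            clNormHigh hφ k₀ T ρ₁ p (s + (2 / ρ₁).toReal) a +
                clNormHigh hφ k₀ T ρ₁ p (s + (2 / ρ₁).toReal) v ≤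
              C * (besovNormHigh hφ k₀ p s a₀ + besovNormHigh hφ k₀ p s v₀ +
                (clNormHigh hφ k₀ T ρ₂ p (s - 2 + (2 / ρ₂).toReal) F +
                  clNormHigh hφ k₀ T ρ₂ p (s - 2 + (2 / ρ₂).toReal) G)) := by
  obtain ⟨K, hK, hmain⟩ := exists_coupled_solution hφ hν
  lift K to ℝ≥0 using hK
  -- K may vanish; adding 1 makes the constant positive. It depends on ν, N and φ only.
  refine ⟨K + 1, by positivity, ?_⟩
  intro s p hp T _ ρ hρρ a₀ v₀ F G ha₀ hv₀ hF hG
  have h1ρ : 1 ≤ ρ := by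
    rcases hρρ with rfl | rfl
    exacts [hρ₂.trans hρ, hρ₂]
  have hρle : ρ ≤ ρ₁ := by
    rcases hρρ with rfl | rfl
    exacts [le_rfl, hρ]
  obtain ⟨a, v, ha, hv, hsol, hest⟩ := hmain p hp T ρ h1ρ s a₀ v₀ F G ha₀ hv₀ hF hG
  -- Finiteness of the L^{ρ₁} norm comes from the exponent ρ of the hypothesis, for which the source
  -- norm is finite, and not from ρ₂.
  have hfin : ∑' j : ℤ, (2 : ℝ≥0∞) ^ ((j : ℝ) * (s + (2 / ρ₁).toReal)) *
      (blockTimeNorm hφ T ρ₁ p j a + blockTimeNorm hφ T ρ₁ p j v) < ∞ := by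
    refine (ENNReal.tsum_le_tsum (hest ρ ρ₁ h1ρ hρle)).trans_lt ?_
    simp only [mul_add (R := ℝ≥0∞), ENNReal.tsum_add, ENNReal.tsum_mul_left]
    exact (ENNReal.add_lt_top.2 ⟨ENNReal.add_lt_top.2
      ⟨ENNReal.mul_lt_top ENNReal.coe_lt_top ha₀, ENNReal.mul_lt_top ENNReal.coe_lt_top hv₀⟩,
      ENNReal.add_lt_top.2 ⟨ENNReal.mul_lt_top ENNReal.coe_lt_top hF.norm_lt_top,
        ENNReal.mul_lt_top ENNReal.coe_lt_top hG.norm_lt_top⟩⟩)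
  simp only [mul_add (R := ℝ≥0∞), ENNReal.tsum_add] at hfin
  obtain ⟨hfa, hfv⟩ := ENNReal.add_lt_top.1 hfin
  refine ⟨a, v, ⟨ha, ha.memCL.measurable_pairing, ha.memCL.measurable_norm, hfa⟩,
    ⟨hv, hv.memCL.measurable_pairing, hv.memCL.measurable_norm, hfv⟩, hsol,
    fun a' v' ha' hv' h' => hsol.eqOn hp h' ha hv ha'.1 hv'.1, fun k₀ => ?_⟩
  -- The same block estimates with ρ₂, summed over j ≥ k₀; nothing here requires the right-hand side
  -- to be finite.
  have h := ENNReal.tsum_le_tsum fun j : Set.Ici k₀ => hest ρ₂ ρ₁ hρ₂ hρ j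
  rw [ENNReal.tsum_mul_left] at h
  simp only [mul_add (R := ℝ≥0∞), ENNReal.tsum_add] at h
  refine h.trans ?_
  simp only [← mul_add (R := ℝ≥0∞)]
  refine mul_le_mul_left ?_ _
  push_cast
  exact le_self_add
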